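/- Let $m,c>0$ and $\beta,v_0\in\mathbb R$. For $\sigma>0$ let $\delta_\sigma(x)=\frac{1}{\sigma\sqrt{2\pi}}e^{-x^2/(2\sigma^2)}$. For a smooth function $f$ consider, for $x\in\mathbb R$, $t\ge 0$, the system $$\frac{\partial^2\phi}{\partial t^2}(x,t)=c^2\frac{\partial^2\phi}{\partial x^2}(x,t)+\beta f(x-y(t)),\qquad \phi(x,0)=0,\quad \phi_t(x,0)=0,$$ $$m\,y''(t)=\beta\,\frac{\partial}{\partial z}\int_{-\infty}^{\infty}\phi(x,t)f(x-z)\,dx\,\Big|_{z=y(t)},\qquad y(0)=0,\quad y'(0)=v_0,$$ where $\phi$ is $C^2$ on $\mathbb R\times[0,\infty)$, $y$ is $C^2$ on $[0,\infty)$ and the two differential equations hold for $t>0$. A solution of the system with $f=\delta$ is a pair $(\phi,y)$ with $\phi$ continuous on $\mathbb R\times[0,\infty)$, $\phi(x,0)=0$, $y$ of class $C^2$ on $[0,\infty)$, $y(0)=0$, $y'(0)=v_0$, such that the wave equation and its zero initial data hold weakly, $$\int_0^\infty\!\!\int_{\mathbb R}\phi\,(\psi_{tt}-c^2\psi_{xx})\,dx\,dt=\beta\int_0^\infty\psi(y(t),t)\,dt\qquad\text{for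 all }\psi\in C_c^\infty(\mathbb R^2),$$ and, for $t>0$, $m\,y''(t)=\lim_{\varepsilon\to0+}\beta\,\frac{\partial}{\partial z}\int\phi(x,t)\,\delta_\varepsilon(x-z)\,dx\,\big|_{z=y(t)}$. 1. For every $\sigma>0$ the system with $f=\delta_\sigma$ has a solution $(\phi_\sigma,y_\sigma)$ on the whole time interval $[0,\infty)$, and this solution is unique. 2. If $|v_0|<c$, there is a solution $(\phi,y)$ of the system with $f=\delta$ such that $v=y'$ is smooth and monotone on $[0,\infty)$, $\sup_{t\ge0}|v(t)|<c$ and, if $\beta\ne0$, $v(t)\to0$ exponentially fast as $t\to\infty$; it is the unique solution with $\sup_{t\ge0}|y'(t)|<c$. As $\sigma\to0+$, the solutions $(\phi_\sigma,y_\sigma)$ converge to $(\phi,y)$: for every $T>0$, $y_\sigma\to y$ and $y_\sigma'\to y'$ uniformly on $[0,T]$, and $\phi_\sigma\to\phi$ uniformly on $\mathbb R\times[0,T]$. -/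

import Mathlib

open Set Filter Topology MeasureTheory
open scoped ContDiff

noncomputable section

namespace PointParticle

/-- The Gaussian density with mean zero and standard deviation `σ`. -/
def gaussianDelta (σ x : ℝ) : ℝ :=
  1 / (σ * Real.sqrt (2 * Real.pi)) * Real.exp (-x ^ 2 / (2 * σ ^ 2))

/-- The velocity of a trajectory on `[0, ∞)` (one-sided derivative at `t = 0`). -/
def velocity (y : ℝ → ℝ) (t : ℝ) : ℝ := derivWithin y (Ici 0) t

/-- `F = β ∂/∂z ∫ u(x) f(x - z) dx` at the point `z = η`, where the integrals converge and the
derivative exists: the force at `η` in the field `u` for the smearing function `f`. -/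
def HasForce (β : ℝ) (f u : ℝ → ℝ) (η F : ℝ) : Prop :=
  (∀ z : ℝ, Integrable (fun x : ℝ => u x * f (x - z))) ∧
    HasDerivAt (fun z : ℝ => β * ∫ x : ℝ, u x * f (x - z)) F η

/-- Trajectories of class `C²` on `[0, ∞)` with `y(0) = 0` and `y'(0) = v₀`. -/
structure IsTrajectory (v₀ : ℝ) (y : ℝ → ℝ) : Prop where
  contDiffOn : ContDiffOn ℝ 2 y (Ici 0)
  position_zero : y 0 = 0
  velocity_zero : velocity y 0 = v₀

/-- Global classical solutions `(φ, y)`, on `x ∈ ℝ`, `t ∈ [0, ∞)`, of the system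
`φ_tt = c² φ_xx + β f(x - y(t))`, `m y'' = β ∂/∂y ∫ φ(x,t) f(x - y) dx` with
`φ(x,0) = φ_t(x,0) = 0`, `y(0) = 0`, `y'(0) = v₀`.
Values at negative times are irrelevant. -/
structure IsSmoothSolution (m c β v₀ : ℝ) (f : ℝ → ℝ) (φ : ℝ → ℝ → ℝ) (y : ℝ → ℝ) :
    Prop where
  field_contDiffOn : ContDiffOn ℝ 2 (fun p : ℝ × ℝ => φ p.1 p.2) (univ ×ˢ Ici 0)
  field_zero : ∀ x : ℝ, φ x 0 = 0
  field_deriv_zero : ∀ x : ℝ, derivWithin (fun s : ℝ => φ x s) (Ici 0) 0 = 0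
  wave : ∀ x t : ℝ, 0 < t →
    iteratedDeriv 2 (fun s : ℝ => φ x s) t =
      c ^ 2 * iteratedDeriv 2 (fun z : ℝ => φ z t) x + β * f (x - y t)
  trajectory : IsTrajectory v₀ y
  newton : ∀ t : ℝ, 0 < t →
    HasForce β f (fun x : ℝ => φ x t) (y t) (m * iteratedDeriv 2 y t)

/-- Weak form on `t ≥ 0` of `φ_tt = c² φ_xx + β δ(x - y(t))`, `φ(x,0) = φ_t(x,0) = 0`.
The test functions need not vanish near `t = 0`, which encodes both initial conditions. -/
def IsWeakDeltaField (c β : ℝ) (φ : ℝ → ℝ → ℝ) (y : ℝ → ℝ) : Prop :=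
  ∀ ψ : ℝ × ℝ → ℝ, ContDiff ℝ ∞ ψ → HasCompactSupport ψ →
    ∫ t in Ioi (0 : ℝ), ∫ x : ℝ, φ x t *
        (iteratedDeriv 2 (fun s : ℝ => ψ (x, s)) t -
          c ^ 2 * iteratedDeriv 2 (fun z : ℝ => ψ (z, t)) x) =
      β * ∫ t in Ioi (0 : ℝ), ψ (y t, t)

/-- Global solutions `(φ, y)` of the same system with `f = δ`. The field is continuous and solves
the wave equation weakly. It has a kink at `x = y(t)`, so the force `β ∂φ/∂x (y(t), t)` is
understood through the Gaussian approximation of `δ`, as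
`lim_{ε → 0+} β ∂/∂z ∫ φ(x,t) δ_ε(x - z) dx` at `z = y(t)`. -/
structure IsDeltaSolution (m c β v₀ : ℝ) (φ : ℝ → ℝ → ℝ) (y : ℝ → ℝ) : Prop where
  field_continuousOn : ContinuousOn (fun p : ℝ × ℝ => φ p.1 p.2) (univ ×ˢ Ici 0)
  field_zero : ∀ x : ℝ, φ x 0 = 0
  wave : IsWeakDeltaField c β φ y
  trajectory : IsTrajectory v₀ y
  newton : ∀ t : ℝ, 0 < t → ∃ F : ℝ → ℝ,
    (∀ ε : ℝ, 0 < ε → HasForce β (gaussianDelta ε) (fun x : ℝ => φ x t) (y t) (F ε)) ∧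
      Tendsto F (𝓝[>] 0) (𝓝 (m * iteratedDeriv 2 y t))

/-- `sup_{t ≥ 0} |y'(t)| < c`. -/
def UniformlySubsonic (c : ℝ) (y : ℝ → ℝ) : Prop :=
  ∃ K : ℝ, K < c ∧ ∀ t : ℝ, 0 ≤ t → |velocity y t| ≤ K

end PointParticle

end

/-!
By d'Alembert's formula the field is `β / (2 c)` times the retarded potential of the trajectory,
so it can be eliminated: Newton's law becomes an equation `v t = v₀ + ∫₀ᵗ a v` for the velocity
whose right-hand side depends on `v` causally. The two Gaussians, in the source and in the force,
combine into a single one of width `√2 σ`, hence `a` is Lipschitz, and Picard iteration and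
Grönwall's inequality give part 1.

In the limit of a point source the memory disappears. Along a trajectory of speed at most `K < c`
each family of characteristics crosses the particle at relative speed at least `c - K`, so the
self-force sees only the present velocity and tends to `-β² / (2 c) * v / (c² - v²)`. The resulting
autonomous equation has monotone, exponentially decaying solutions. Integrated in time, the error
made with a Gaussian of width `σ` is `O(σ)`; Grönwall's inequality, together with a continuation
argument that keeps the smeared velocity below `K`, gives convergence at rate `O(σ)`.

Weak solutions of the wave equation with zero data vanish because, in characteristic coordinates, a
product of two smooth ramps supported in the backward light cone of a point is mapped by the wave
operator to a nonnegative bump concentrated at the apex.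
-/

noncomputable section

namespace PointParticle

/-! ### The Gaussian density -/

theorem gaussianDelta_pos {σ : ℝ} (hσ : 0 < σ) (x : ℝ) : 0 < gaussianDelta σ x := by
  unfold gaussianDelta; positivity

theorem gaussianDelta_neg (σ x : ℝ) : gaussianDelta σ (-x) = gaussianDelta σ x := by
  simp only [gaussianDelta, neg_sq]

theorem gaussianDelta_zero (σ : ℝ) : gaussianDelta σ 0 = 1 / (σ * √(2 * Real.pi)) := by
  simp [gaussianDelta]

theorem gaussianDelta_contDiff (σ : ℝ) {n : ℕ∞} : ContDiff ℝ n (gaussianDelta σ) := by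
  unfold gaussianDelta
  fun_prop

@[fun_prop]
theorem gaussianDelta_continuous (σ : ℝ) : Continuous (gaussianDelta σ) :=
  (gaussianDelta_contDiff σ (n := 0)).continuous

theorem gaussianDelta_eq_gaussianPDFReal {σ : ℝ} (hσ : 0 < σ) :
    gaussianDelta σ = ProbabilityTheory.gaussianPDFReal 0 (σ ^ 2).toNNReal := by
  funext x
  rw [gaussianDelta, ProbabilityTheory.gaussianPDFReal, Real.coe_toNNReal _ (sq_nonneg σ), sub_zero,
    one_div, mul_comm (2 * Real.pi), Real.sqrt_mul (sq_nonneg σ), Real.sqrt_sq hσ.le]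

theorem gaussianDelta_integrable {σ : ℝ} (hσ : 0 < σ) : Integrable (gaussianDelta σ) := by
  rw [gaussianDelta_eq_gaussianPDFReal hσ]
  exact ProbabilityTheory.integrable_gaussianPDFReal 0 _

theorem integral_gaussianDelta {σ : ℝ} (hσ : 0 < σ) : ∫ x, gaussianDelta σ x = 1 := by
  rw [gaussianDelta_eq_gaussianPDFReal hσ]
  exact ProbabilityTheory.integral_gaussianPDFReal_eq_one 0 (by simpa using hσ.ne')

theorem integral_gaussianDelta_Ioi {σ : ℝ} (hσ : 0 < σ) :
    ∫ x in Ioi 0, gaussianDelta σ x = 1 / 2 := by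
  have h := integral_comp_abs (f := gaussianDelta σ)
  simp only [gaussianDelta, sq_abs] at h ⊢
  have h1 : ∫ x, 1 / (σ * √(2 * Real.pi)) * Real.exp (-x ^ 2 / (2 * σ ^ 2)) = 1 :=
    integral_gaussianDelta hσ
  linarith

theorem gaussianDelta_le_zero {σ : ℝ} (hσ : 0 < σ) (x : ℝ) :
    gaussianDelta σ x ≤ gaussianDelta σ 0 := by
  unfold gaussianDelta
  gcongr ?_ * Real.exp (?_ / _)
  nlinarith [sq_nonneg x]

theorem abs_gaussianDelta_le {σ : ℝ} (hσ : 0 < σ) (x : ℝ) :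
    |gaussianDelta σ x| ≤ gaussianDelta σ 0 := by
  rw [abs_of_pos (gaussianDelta_pos hσ x)]
  exact gaussianDelta_le_zero hσ x

theorem one_le_mul_gaussianDelta_zero {σ : ℝ} (hσ : 0 < σ) : 1 ≤ 4 * σ * gaussianDelta σ 0 := by
  have hp4 : √(2 * Real.pi) ≤ 4 := by
    rw [Real.sqrt_le_left (by norm_num)]; linarith [Real.pi_le_four]
  rw [gaussianDelta_zero, mul_one_div, one_le_div (by positivity), mul_comm 4 σ]
  gcongr

theorem gaussianDelta_mul_gaussianDelta (σ x y : ℝ) :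
    gaussianDelta σ x * gaussianDelta σ y =
      (1 / (σ * √(2 * Real.pi))) ^ 2 * Real.exp (-(x ^ 2 + y ^ 2) / (2 * σ ^ 2)) := by
  rw [gaussianDelta, gaussianDelta, mul_mul_mul_comm, ← Real.exp_add, ← sq, ← add_div, neg_add]

theorem gaussianDelta_add_mul_zero_le {σ x r : ℝ} (hx : 0 ≤ x) (hr : 0 ≤ r) :
    gaussianDelta σ (x + r) * gaussianDelta σ 0 ≤ gaussianDelta σ r * gaussianDelta σ x := by
  rw [gaussianDelta_mul_gaussianDelta, gaussianDelta_mul_gaussianDelta]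
  gcongr _ * Real.exp (-?_ / _)
  nlinarith [mul_nonneg hx hr]

theorem gaussianDelta_hasDerivAt {σ : ℝ} (hσ : 0 < σ) (x : ℝ) :
    HasDerivAt (gaussianDelta σ) (-(x / σ ^ 2) * gaussianDelta σ x) x := by
  have h : HasDerivAt (fun x : ℝ => -x ^ 2 / (2 * σ ^ 2)) (-(2 * x) / (2 * σ ^ 2)) x := by
    simpa using ((hasDerivAt_id x).pow 2).neg.div_const (2 * σ ^ 2)
  refine (h.exp.const_mul (1 / (σ * √(2 * Real.pi)))).congr_deriv ?_
  unfold gaussianDelta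
  field_simp

theorem abs_mul_exp_neg_sq_le_half (u : ℝ) : |u| * Real.exp (-u ^ 2) ≤ 1 / 2 := by
  have hu : |u| ≤ 1 / 2 * Real.exp (u ^ 2) := by
    nlinarith [Real.add_one_le_exp (u ^ 2), sq_nonneg (|u| - 1), sq_abs u]
  rwa [Real.exp_neg, ← div_eq_mul_inv, div_le_iff₀ (Real.exp_pos _)]

theorem gaussianDelta_eq_mul_sqrt_two_mul {σ : ℝ} (hσ : 0 < σ) (x : ℝ) :
    gaussianDelta σ x =
      √2 * Real.exp (-(x / (2 * σ)) ^ 2) * gaussianDelta (√2 * σ) x := by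
  have h2 : (√2) ^ 2 = 2 := Real.sq_sqrt (by norm_num)
  have hexp : -x ^ 2 / (2 * σ ^ 2) =
      -(x / (2 * σ)) ^ 2 + -x ^ 2 / (2 * (√2 * σ) ^ 2) := by
    rw [mul_pow, h2]
    field_simp
    ring
  unfold gaussianDelta
  rw [hexp, Real.exp_add]
  field_simp

theorem abs_mul_gaussianDelta_le {σ : ℝ} (hσ : 0 < σ) (x : ℝ) :
    |x| * gaussianDelta σ x ≤ 2 * σ * gaussianDelta (√2 * σ) x := by
  have hg := (gaussianDelta_pos (by positivity : 0 < √2 * σ) x).le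
  have hmoment := abs_mul_exp_neg_sq_le_half (x / (2 * σ))
  rw [abs_div, abs_of_pos (by positivity : 0 < 2 * σ), div_mul_eq_mul_div,
    div_le_iff₀ (by positivity)] at hmoment
  have hs2 : √2 ≤ 2 := by rw [Real.sqrt_le_left] <;> norm_num
  calc |x| * gaussianDelta σ x
      = √2 * (|x| * Real.exp (-(x / (2 * σ)) ^ 2)) * gaussianDelta (√2 * σ) x := by
        rw [gaussianDelta_eq_mul_sqrt_two_mul hσ]; ring
    _ ≤ 2 * (1 / 2 * (2 * σ)) * gaussianDelta (√2 * σ) x := by gcongr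
    _ = 2 * σ * gaussianDelta (√2 * σ) x := by ring

theorem abs_mul_gaussianDelta_le_one {σ : ℝ} (hσ : 0 < σ) (x : ℝ) :
    |x| * gaussianDelta σ x ≤ 1 := by
  have hp : 1 ≤ √Real.pi := Real.one_le_sqrt.2 (by linarith [Real.pi_gt_three])
  have h2 : √2 * √2 = 2 := Real.mul_self_sqrt (by norm_num)
  have hs : 0 < √2 * σ := by positivity
  calc |x| * gaussianDelta σ x
      ≤ 2 * σ * gaussianDelta (√2 * σ) x := abs_mul_gaussianDelta_le hσ x
    _ ≤ 2 * σ * gaussianDelta (√2 * σ) 0 := by gcongr; exact gaussianDelta_le_zero hs x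
    _ = 1 / √Real.pi := by
        rw [gaussianDelta_zero, Real.sqrt_mul (by norm_num)]
        field_simp
        linear_combination -h2
    _ ≤ 1 := (div_le_one (by positivity)).2 hp

theorem abs_deriv_gaussianDelta_le {σ : ℝ} (hσ : 0 < σ) (x : ℝ) :
    |-(x / σ ^ 2) * gaussianDelta σ x| ≤ 1 / σ ^ 2 := by
  rw [abs_mul, abs_neg, abs_div, abs_of_pos (gaussianDelta_pos hσ x), abs_sq, div_mul_eq_mul_div]
  gcongr
  exact abs_mul_gaussianDelta_le_one hσ x

theorem gaussianDelta_lipschitzWith {σ : ℝ} (hσ : 0 < σ) :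
    LipschitzWith (1 / σ ^ 2).toNNReal (gaussianDelta σ) :=
  LipschitzWith.of_dist_le' fun x y => convex_univ.norm_image_sub_le_of_norm_hasDerivWithin_le
    (fun z _ => (gaussianDelta_hasDerivAt hσ z).hasDerivWithinAt)
    (fun z _ => abs_deriv_gaussianDelta_le hσ z) (mem_univ y) (mem_univ x)

theorem tendsto_mul_gaussianDelta {x : ℝ} (hx : x ≠ 0) :
    Tendsto (fun ε => ε * gaussianDelta ε x) (𝓝[>] 0) (𝓝 0) := by
  have hlim : Tendsto (fun ε : ℝ => ε * (1 / |x|)) (𝓝[>] 0) (𝓝 0) := by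
    simpa using ((continuous_id.mul_const (1 / |x|)).tendsto 0).mono_left nhdsWithin_le_nhds
  refine squeeze_zero' ?_ ?_ hlim <;> filter_upwards [self_mem_nhdsWithin] with ε hε
  · exact mul_nonneg (le_of_lt hε) (gaussianDelta_pos hε x).le
  · refine mul_le_mul_of_nonneg_left ?_ (le_of_lt hε)
    rw [le_div_iff₀ (abs_pos.2 hx), mul_comm]
    exact abs_mul_gaussianDelta_le_one hε x

theorem gaussianDelta_add_mul_gaussianDelta {σ : ℝ} (hσ : 0 < σ) (x w : ℝ) :
    gaussianDelta σ (x + w) * gaussianDelta σ x =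
      gaussianDelta (√2 * σ) w * gaussianDelta (σ / √2) (x + w / 2) := by
  have h2 : (√2) ^ 2 = 2 := Real.sq_sqrt (by norm_num)
  rw [gaussianDelta_mul_gaussianDelta, gaussianDelta, gaussianDelta, mul_mul_mul_comm,
    ← Real.exp_add]
  congr 2
  · field_simp
  · rw [mul_pow, div_pow, h2]
    field_simp
    ring

theorem integral_gaussianDelta_mul {σ : ℝ} (hσ : 0 < σ) (w : ℝ) :
    ∫ x, gaussianDelta σ (x + w) * gaussianDelta σ x = gaussianDelta (√2 * σ) w := by
  simp_rw [gaussianDelta_add_mul_gaussianDelta hσ]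
  rw [integral_const_mul, integral_add_right_eq_self (gaussianDelta (σ / √2)),
    integral_gaussianDelta (by positivity), mul_one]

/-! ### Primitives of the Gaussian and of the delta function -/

/-- The odd primitive of the Gaussian density of standard deviation `σ`. -/
def smoothStep (σ r : ℝ) : ℝ := ∫ x in (0 : ℝ)..r, gaussianDelta σ x

/-- The odd primitive `sign / 2` of the delta function, the limit of `smoothStep σ` as
`σ → 0+`. -/
def sharpStep (r : ℝ) : ℝ := Real.sign r / 2

theorem smoothStep_hasDerivAt (σ r : ℝ) : HasDerivAt (smoothStep σ) (gaussianDelta σ r) r :=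
  (gaussianDelta_continuous σ).integral_hasStrictDerivAt 0 r |>.hasDerivAt

@[fun_prop]
theorem smoothStep_continuous (σ : ℝ) : Continuous (smoothStep σ) :=
  continuous_iff_continuousAt.2 fun r => (smoothStep_hasDerivAt σ r).continuousAt

theorem smoothStep_zero (σ : ℝ) : smoothStep σ 0 = 0 := intervalIntegral.integral_same

theorem smoothStep_neg (σ r : ℝ) : smoothStep σ (-r) = -smoothStep σ r := by
  have h := intervalIntegral.integral_comp_neg (a := 0) (b := r) (gaussianDelta σ)
  simp only [gaussianDelta_neg, neg_zero] at h
  rw [smoothStep, smoothStep, h, intervalIntegral.integral_symm]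

theorem smoothStep_mono {σ : ℝ} (hσ : 0 < σ) : Monotone (smoothStep σ) :=
  monotone_of_hasDerivAt_nonneg (smoothStep_hasDerivAt σ) fun r => (gaussianDelta_pos hσ r).le

theorem half_sub_smoothStep {σ : ℝ} (hσ : 0 < σ) (r : ℝ) :
    1 / 2 - smoothStep σ r = ∫ x in Ioi r, gaussianDelta σ x := by
  have hi := gaussianDelta_integrable hσ
  rw [smoothStep, ← integral_gaussianDelta_Ioi hσ,
    ← intervalIntegral.integral_Ioi_sub_Ioi' hi.integrableOn hi.integrableOn, sub_sub_cancel]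

theorem integral_comp_add_right_Ioi (f : ℝ → ℝ) (a r : ℝ) :
    ∫ x in Ioi a, f (x + r) = ∫ x in Ioi (a + r), f x := by
  rw [← (measurePreserving_add_right volume r).setIntegral_preimage_emb
    (measurableEmbedding_addRight r) f (Ioi (a + r)), preimage_add_const_Ioi, add_sub_cancel_right]

theorem smoothStep_le_half {σ : ℝ} (hσ : 0 < σ) (r : ℝ) : smoothStep σ r ≤ 1 / 2 := by
  rw [← sub_nonneg, half_sub_smoothStep hσ]
  exact integral_nonneg fun x => (gaussianDelta_pos hσ x).le

theorem abs_smoothStep_le {σ : ℝ} (hσ : 0 < σ) (r : ℝ) : |smoothStep σ r| ≤ 1 / 2 := by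
  have h := smoothStep_le_half hσ (-r)
  rw [smoothStep_neg] at h
  exact abs_le'.2 ⟨smoothStep_le_half hσ r, h⟩

theorem half_sub_smoothStep_le {σ r : ℝ} (hσ : 0 < σ) (hr : 0 ≤ r) :
    1 / 2 - smoothStep σ r ≤ 2 * σ * gaussianDelta σ r := by
  have hi := gaussianDelta_integrable hσ
  have h0 := gaussianDelta_pos hσ 0
  have hr0 := gaussianDelta_pos hσ r
  have htail : (1 / 2 - smoothStep σ r) * gaussianDelta σ 0 ≤ gaussianDelta σ r * (1 / 2) := by
    rw [half_sub_smoothStep hσ, ← zero_add r, ← integral_comp_add_right_Ioi, zero_add,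
      ← integral_mul_const, ← integral_gaussianDelta_Ioi hσ, ← integral_const_mul]
    exact setIntegral_mono_on ((hi.comp_add_right r).mul_const _).integrableOn
      (hi.const_mul _).integrableOn measurableSet_Ioi
      fun x hx => gaussianDelta_add_mul_zero_le (le_of_lt hx) hr
  rw [← mul_le_mul_iff_left₀ h0]
  calc (1 / 2 - smoothStep σ r) * gaussianDelta σ 0
      ≤ gaussianDelta σ r * (1 / 2) := htail
    _ ≤ gaussianDelta σ r * (1 / 2 * (4 * σ * gaussianDelta σ 0)) := by
        gcongr
        linarith [one_le_mul_gaussianDelta_zero hσ]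
    _ = 2 * σ * gaussianDelta σ r * gaussianDelta σ 0 := by ring

theorem sharpStep_neg (r : ℝ) : sharpStep (-r) = -sharpStep r := by
  rw [sharpStep, sharpStep, Real.sign_neg, neg_div]

theorem sharpStep_of_pos {r : ℝ} (hr : 0 < r) : sharpStep r = 1 / 2 := by
  rw [sharpStep, Real.sign_of_pos hr]

theorem sharpStep_of_neg {r : ℝ} (hr : r < 0) : sharpStep r = -1 / 2 := by
  rw [sharpStep, Real.sign_of_neg hr]

theorem abs_sharpStep_le (r : ℝ) : |sharpStep r| ≤ 1 / 2 := by
  rcases Real.sign_apply_eq r with h | h | h <;> simp [sharpStep, h, abs_div]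

@[fun_prop]
theorem sharpStep_measurable : Measurable sharpStep := by
  unfold sharpStep Real.sign
  exact (Measurable.ite measurableSet_Iio measurable_const
    (Measurable.ite measurableSet_Ioi measurable_const measurable_const)).div_const 2

theorem sharpStep_ae_eq_indicator :
    sharpStep =ᵐ[volume] fun x => (Ioi 0).indicator (fun _ => 1) x - 1 / 2 := by
  filter_upwards [measure_eq_zero_iff_ae_notMem.1 (measure_singleton (0 : ℝ))] with x hx
  rcases lt_or_gt_of_ne hx with h | h
  · rw [sharpStep_of_neg h, indicator_of_notMem (notMem_Ioi.2 h.le)]; norm_num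
  · rw [sharpStep_of_pos h, indicator_of_mem (mem_Ioi.2 h)]; norm_num

theorem abs_smoothStep_sub_sharpStep_le {σ : ℝ} (hσ : 0 < σ) (r : ℝ) :
    |smoothStep σ r - sharpStep r| ≤ 2 * σ * gaussianDelta σ r := by
  have of_pos : ∀ r : ℝ, 0 < r → |smoothStep σ r - sharpStep r| ≤ 2 * σ * gaussianDelta σ r := by
    intro r hr
    rw [sharpStep_of_pos hr, abs_sub_comm, abs_of_nonneg (by linarith [smoothStep_le_half hσ r])]
    exact half_sub_smoothStep_le hσ hr.le
  rcases lt_trichotomy r 0 with hr | rfl | hr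
  · have h := of_pos (-r) (neg_pos.2 hr)
    rwa [smoothStep_neg, sharpStep_neg, gaussianDelta_neg, neg_sub_neg, abs_sub_comm] at h
  · rw [smoothStep_zero, sharpStep, Real.sign_zero, zero_div, sub_zero, abs_zero]
    exact mul_nonneg (by positivity) (gaussianDelta_pos hσ 0).le
  · exact of_pos r hr

theorem integral_sharpStep_mul {σ : ℝ} (hσ : 0 < σ) (w : ℝ) :
    ∫ x, sharpStep x * gaussianDelta σ (x - w) = smoothStep σ w := by
  have hi := (gaussianDelta_integrable hσ).comp_sub_right w
  calc ∫ x, sharpStep x * gaussianDelta σ (x - w)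
      = ∫ x, ((Ioi 0).indicator (fun x => gaussianDelta σ (x - w)) x
          - 1 / 2 * gaussianDelta σ (x - w)) := by
        refine integral_congr_ae (sharpStep_ae_eq_indicator.mono fun x hx => ?_)
        simp only [hx, sub_mul, indicator_apply, ite_mul, one_mul, zero_mul]
    _ = (∫ x in Ioi (-w), gaussianDelta σ x) - 1 / 2 * 1 := by
        rw [integral_sub (hi.indicator measurableSet_Ioi) (hi.const_mul _),
          integral_indicator measurableSet_Ioi, integral_const_mul,
          integral_sub_right_eq_self (μ := volume) (gaussianDelta σ), integral_gaussianDelta hσ]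
        simp only [sub_eq_add_neg, integral_comp_add_right_Ioi (gaussianDelta σ), zero_add]
    _ = smoothStep σ w := by rw [← half_sub_smoothStep hσ, smoothStep_neg]; ring

/-! ### Smearing a kernel -/

theorem hasDerivAt_integral_mul_translate {K k f : ℝ → ℝ} {C M : ℝ}
    (hK : ∀ x, HasDerivAt K (k x) x) (hKC : ∀ x, |K x| ≤ C) (hk : Continuous k)
    (hkM : ∀ x, |k x| ≤ M) (hf : Integrable f) (w : ℝ) :
    HasDerivAt (fun w => ∫ x, K x * f (x - w)) (∫ x, k (x + w) * f x) w := by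
  have hshift : (fun w => ∫ x, K x * f (x - w)) = fun w => ∫ x, K (x + w) * f x := by
    funext w
    rw [← integral_add_right_eq_self _ w]
    simp only [add_sub_cancel_right]
  have hKc : Continuous K := continuous_iff_continuousAt.2 fun x => (hK x).continuousAt
  have hKf : ∀ w, Integrable fun x => K (x + w) * f x := fun w =>
    hf.bdd_mul (by fun_prop : Continuous fun x => K (x + w)).aestronglyMeasurable
      (Eventually.of_forall fun x => hKC (x + w))
  rw [hshift]
  refine (hasDerivAt_integral_of_dominated_loc_of_deriv_le (bound := fun x => M * |f x|)
    (F' := fun w x => k (x + w) * f x) univ_mem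
    (Eventually.of_forall fun w => (hKf w).aestronglyMeasurable) (hKf w) ?_
    (Eventually.of_forall fun x w _ => ?_) (hf.abs.const_mul M)
    (Eventually.of_forall fun x w _ => ((hK (x + w)).comp_const_add x w).mul_const (f x))).2
  · exact (by fun_prop : Continuous fun x => k (x + w)).aestronglyMeasurable.mul
      hf.aestronglyMeasurable
  · rw [Real.norm_eq_abs, abs_mul]
    gcongr
    exact hkM (x + w)

theorem hasDerivAt_integral_smoothStep_mul {σ : ℝ} (hσ : 0 < σ) (w : ℝ) :
    HasDerivAt (fun w => ∫ x, smoothStep σ x * gaussianDelta σ (x - w))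
      (gaussianDelta (√2 * σ) w) w := by
  rw [← integral_gaussianDelta_mul hσ]
  exact hasDerivAt_integral_mul_translate (smoothStep_hasDerivAt σ) (abs_smoothStep_le hσ)
    (gaussianDelta_continuous σ) (abs_gaussianDelta_le hσ) (gaussianDelta_integrable hσ) w

theorem hasDerivAt_integral_sharpStep_mul {σ : ℝ} (hσ : 0 < σ) (w : ℝ) :
    HasDerivAt (fun w => ∫ x, sharpStep x * gaussianDelta σ (x - w)) (gaussianDelta σ w) w := by
  simp only [integral_sharpStep_mul hσ]
  exact smoothStep_hasDerivAt σ w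

/-! ### Characteristic integrals and the field of a moving source -/

/-- The contribution to the field of one family of characteristics: the integral up to time `t`
of the kernel `K` centred at `p s`. -/
def charIntegral (K p : ℝ → ℝ) (u t : ℝ) : ℝ := ∫ s in (0 : ℝ)..t, K (u - p s)

/-- With `K` a primitive of the smearing function, `2 c / β` times the field of the source moving
along `y`; with `K` the (doubly smeared) kernel itself, `2 c / β` times the spatial slope of that
field, which gives the self-force. -/
def retardedField (K : ℝ → ℝ) (c : ℝ) (y : ℝ → ℝ) (x t : ℝ) : ℝ :=
  ∫ s in (0 : ℝ)..t, (K (x - y s + c * (t - s)) - K (x - y s - c * (t - s)))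

theorem retardedField_zero (K : ℝ → ℝ) (c : ℝ) (y : ℝ → ℝ) (x : ℝ) :
    retardedField K c y x 0 = 0 :=
  intervalIntegral.integral_same

theorem retardedField_congr {K : ℝ → ℝ} {c : ℝ} {y₁ y₂ : ℝ → ℝ} {t : ℝ} (ht : 0 ≤ t)
    (h : ∀ s ∈ Icc 0 t, y₁ s = y₂ s) (x : ℝ) :
    retardedField K c y₁ x t = retardedField K c y₂ x t := by
  refine intervalIntegral.integral_congr fun s hs => ?_
  rw [uIcc_of_le ht] at hs
  simp only [h s hs]

theorem charIntegral_add (K p : ℝ → ℝ) (u b t : ℝ) :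
    charIntegral K p (u + b) t = charIntegral K (fun s => p s - b) u t := by
  simp only [charIntegral, sub_sub_eq_add_sub]

theorem charIntegral_sub (K p : ℝ → ℝ) (u b t : ℝ) :
    charIntegral K p (u - b) t = charIntegral K (fun s => p s + b) u t := by
  simpa only [← sub_eq_add_neg, sub_neg_eq_add] using charIntegral_add K p u (-b) t

theorem intervalIntegrable_comp_of_bounded {K p : ℝ → ℝ} {C : ℝ} (hKm : Measurable K)
    (hK : ∀ x, |K x| ≤ C) (hp : Continuous p) (a b : ℝ) :
    IntervalIntegrable (fun s => K (p s)) volume a b :=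
  (intervalIntegrable_const (c := C)).mono_fun (hKm.comp hp.measurable).aestronglyMeasurable
    (Eventually.of_forall fun s => (hK (p s)).trans (le_abs_self C))

theorem retardedField_eq_charIntegral {K y : ℝ → ℝ} {c x t : ℝ}
    (hadv : IntervalIntegrable (fun s => K (x + c * t - (y s + c * s))) volume 0 t)
    (hret : IntervalIntegrable (fun s => K (x - c * t - (y s - c * s))) volume 0 t) :
    retardedField K c y x t = charIntegral K (fun s => y s + c * s) (x + c * t) t -
      charIntegral K (fun s => y s - c * s) (x - c * t) t := by
  rw [charIntegral, charIntegral, ← intervalIntegral.integral_sub hadv hret, retardedField]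
  refine intervalIntegral.integral_congr fun s _ => ?_
  ring_nf

theorem retardedField_eq_charIntegral_of_continuous {K y : ℝ → ℝ} (hK : Continuous K)
    (hy : Continuous y) (c x t : ℝ) :
    retardedField K c y x t = charIntegral K (fun s => y s + c * s) (x + c * t) t -
      charIntegral K (fun s => y s - c * s) (x - c * t) t :=
  retardedField_eq_charIntegral
    (Continuous.intervalIntegrable (by fun_prop) _ _)
    (Continuous.intervalIntegrable (by fun_prop) _ _)

theorem charIntegral_continuous {K p : ℝ → ℝ} (hK : Continuous K) (hp : Continuous p) :
    Continuous fun q : ℝ × ℝ => charIntegral K p q.1 q.2 :=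
  intervalIntegral.continuous_parametric_intervalIntegral_of_continuous (μ := volume)
    (f := fun (q : ℝ × ℝ) s => K (q.1 - p s)) (by fun_prop) continuous_snd

theorem retardedField_continuous {K y : ℝ → ℝ} (hK : Continuous K) (hy : Continuous y) (c : ℝ) :
    Continuous fun q : ℝ × ℝ => retardedField K c y q.1 q.2 :=
  intervalIntegral.continuous_parametric_intervalIntegral_of_continuous (μ := volume)
    (f := fun (q : ℝ × ℝ) s =>
      K (q.1 - y s + c * (q.2 - s)) - K (q.1 - y s - c * (q.2 - s))) (by fun_prop) continuous_snd

theorem charIntegral_hasDerivAt {K k p : ℝ → ℝ} {M : ℝ} (hK : ∀ w, HasDerivAt K (k w) w)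
    (hk : Continuous k) (hM : ∀ w, |k w| ≤ M) (hp : Continuous p) (t u : ℝ) :
    HasDerivAt (fun u => charIntegral K p u t) (charIntegral k p u t) u := by
  have hKc : Continuous K := continuous_iff_continuousAt.2 fun w => (hK w).continuousAt
  refine (intervalIntegral.hasDerivAt_integral_of_dominated_loc_of_deriv_le
    (F' := fun u s => k (u - p s)) (bound := fun _ => M) univ_mem
    (Eventually.of_forall fun w => ?_) (Continuous.intervalIntegrable (by fun_prop) _ _) ?_
    (Eventually.of_forall fun s _ w _ => hM _) intervalIntegrable_const
    (Eventually.of_forall fun s _ w _ => (hK (w - p s)).comp_sub_const w (p s))).2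
  · exact (by fun_prop : Continuous fun s => K (w - p s)).aestronglyMeasurable
  · exact (by fun_prop : Continuous fun s => k (u - p s)).aestronglyMeasurable

/-! ### The force exerted by the field of a moving source -/

theorem HasForce.const_mul {β η F : ℝ} {f u : ℝ → ℝ} (h : HasForce β f u η F) (a : ℝ) :
    HasForce β f (fun x => a * u x) η (a * F) := by
  refine ⟨fun z => ?_, ?_⟩
  · simpa only [mul_assoc] using (h.1 z).const_mul a
  · simpa only [mul_assoc, integral_const_mul, mul_left_comm a β] using h.2.const_mul a

theorem HasForce.sub {β η F G : ℝ} {f u v : ℝ → ℝ} (hu : HasForce β f u η F)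
    (hv : HasForce β f v η G) : HasForce β f (fun x => u x - v x) η (F - G) := by
  refine ⟨fun z => ?_, ?_⟩
  · simp only [sub_mul]
    exact (hu.1 z).sub (hv.1 z)
  · refine (hu.2.sub hv.2).congr_of_eventuallyEq (Eventually.of_forall fun z => ?_)
    simp only [sub_mul, integral_sub (hu.1 z) (hv.1 z), mul_sub, Pi.sub_apply]

theorem integral_translate_mul (K f : ℝ → ℝ) (a z : ℝ) :
    ∫ x, K (x - a) * f (x - z) = ∫ x, K x * f (x - (z - a)) := by
  rw [← integral_sub_right_eq_self (fun x => K x * f (x - (z - a))) a]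
  simp only [sub_sub_sub_cancel_right]

section

variable {K f p : ℝ → ℝ} {C : ℝ}

theorem integrable_prod_bounded_mul (hKm : Measurable K) (hK : ∀ x, |K x| ≤ C)
    (hf : Integrable f) (hp : Continuous p) (z t : ℝ) :
    Integrable (fun q : ℝ × ℝ => K (q.1 - p q.2) * f (q.1 - z))
      (volume.prod (volume.restrict (Ioc 0 t))) := by
  have hfst : Integrable (fun q : ℝ × ℝ => f (q.1 - z))
      (volume.prod (volume.restrict (Ioc 0 t))) := by
    simpa only [mul_one] using
      (hf.comp_sub_right z).mul_prod (integrable_const (μ := volume.restrict (Ioc 0 t)) (1 : ℝ))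
  exact hfst.bdd_mul
    (hKm.comp (measurable_fst.sub (hp.measurable.comp measurable_snd))).aestronglyMeasurable
    (Eventually.of_forall fun q => hK _)

theorem charIntegral_mul {t : ℝ} (ht : 0 ≤ t) (a u : ℝ) :
    charIntegral K p u t * a = ∫ s in Ioc 0 t, K (u - p s) * a := by
  rw [charIntegral, intervalIntegral.integral_of_le ht, integral_mul_const]

theorem integrable_charIntegral_mul (hKm : Measurable K) (hK : ∀ x, |K x| ≤ C)
    (hf : Integrable f) (hp : Continuous p) {t : ℝ} (ht : 0 ≤ t) (z : ℝ) :
    Integrable fun x => charIntegral K p x t * f (x - z) := by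
  simp only [charIntegral_mul ht]
  exact (integrable_prod_bounded_mul hKm hK hf hp z t).integral_prod_left

theorem integral_charIntegral_mul (hKm : Measurable K) (hK : ∀ x, |K x| ≤ C)
    (hf : Integrable f) (hp : Continuous p) {t : ℝ} (ht : 0 ≤ t) (z : ℝ) :
    ∫ x, charIntegral K p x t * f (x - z) =
      charIntegral (fun w => ∫ x, K x * f (x - w)) p z t := by
  simp only [charIntegral_mul ht]
  rw [integral_integral_swap (integrable_prod_bounded_mul hKm hK hf hp z t), charIntegral,
    intervalIntegral.integral_of_le ht]
  simp only [integral_translate_mul]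

variable {k : ℝ → ℝ} {M : ℝ}

theorem hasForce_charIntegral (hKm : Measurable K) (hK : ∀ x, |K x| ≤ C) (hf : Integrable f)
    (hL : ∀ w, HasDerivAt (fun w => ∫ x, K x * f (x - w)) (k w) w) (hk : Continuous k)
    (hM : ∀ w, |k w| ≤ M) (hp : Continuous p) (β η : ℝ) {t : ℝ} (ht : 0 ≤ t) :
    HasForce β f (fun x => charIntegral K p x t) η (β * charIntegral k p η t) := by
  refine ⟨integrable_charIntegral_mul hKm hK hf hp ht, ?_⟩
  simp only [integral_charIntegral_mul hKm hK hf hp ht]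
  exact (charIntegral_hasDerivAt hL hk hM hp t η).const_mul β

theorem hasForce_retardedField (hKm : Measurable K) (hK : ∀ x, |K x| ≤ C) (hf : Integrable f)
    (hL : ∀ w, HasDerivAt (fun w => ∫ x, K x * f (x - w)) (k w) w) (hk : Continuous k)
    (hM : ∀ w, |k w| ≤ M) {y : ℝ → ℝ} (hy : Continuous y) (c β a η : ℝ) {t : ℝ} (ht : 0 ≤ t) :
    HasForce β f (fun x => a * retardedField K c y x t) η (β * a * retardedField k c y η t) := by
  have hforce : ∀ p, Continuous p →
      HasForce β f (fun x => charIntegral K p x t) η (β * charIntegral k p η t) :=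
    fun p hp => hasForce_charIntegral hKm hK hf hL hk hM hp β η ht
  have hfield : ∀ x, retardedField K c y x t =
      charIntegral K (fun s => y s + c * s - c * t) x t -
        charIntegral K (fun s => y s - c * s + c * t) x t := fun x => by
    rw [← charIntegral_add, ← charIntegral_sub]
    exact retardedField_eq_charIntegral
      (intervalIntegrable_comp_of_bounded hKm hK (by fun_prop) _ _)
      (intervalIntegrable_comp_of_bounded hKm hK (by fun_prop) _ _)
  have h := ((hforce (fun s => y s + c * s - c * t) (by fun_prop)).sub
    (hforce (fun s => y s - c * s + c * t) (by fun_prop))).const_mul a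
  rw [← charIntegral_add, ← charIntegral_sub, ← mul_sub,
    ← retardedField_eq_charIntegral_of_continuous hk hy, ← mul_assoc, mul_comm a] at h
  simpa only [hfield] using h

end

theorem hasForce_smoothStep {σ : ℝ} (hσ : 0 < σ) {y : ℝ → ℝ} (hy : Continuous y) (c β a η : ℝ)
    {t : ℝ} (ht : 0 ≤ t) :
    HasForce β (gaussianDelta σ) (fun x => a * retardedField (smoothStep σ) c y x t) η
      (β * a * retardedField (gaussianDelta (√2 * σ)) c y η t) :=
  hasForce_retardedField (smoothStep_continuous σ).measurable (abs_smoothStep_le hσ)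
    (gaussianDelta_integrable hσ) (hasDerivAt_integral_smoothStep_mul hσ)
    (gaussianDelta_continuous _) (abs_gaussianDelta_le (by positivity)) hy c β a η ht

theorem hasForce_sharpStep {ε : ℝ} (hε : 0 < ε) {y : ℝ → ℝ} (hy : Continuous y) (c β a η : ℝ)
    {t : ℝ} (ht : 0 ≤ t) :
    HasForce β (gaussianDelta ε) (fun x => a * retardedField sharpStep c y x t) η
      (β * a * retardedField (gaussianDelta ε) c y η t) :=
  hasForce_retardedField sharpStep_measurable abs_sharpStep_le (gaussianDelta_integrable hε)
    (hasDerivAt_integral_sharpStep_mul hε) (gaussianDelta_continuous _) (abs_gaussianDelta_le hε)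
    hy c β a η ht

/-! ### D'Alembert's formula -/

theorem integral_triangle_swap {J : ℝ → ℝ → ℝ} (hJ : Continuous (Function.uncurry J)) {T : ℝ}
    (hT : 0 ≤ T) :
    ∫ t in (0 : ℝ)..T, ∫ s in (0 : ℝ)..t, J s t = ∫ s in (0 : ℝ)..T, ∫ t in s..T, J s t := by
  set μ : Measure ℝ := volume.restrict (Ioc 0 T)
  have hleft : ∫ t in (0 : ℝ)..T, ∫ s in (0 : ℝ)..t, J s t =
      ∫ t, (∫ s, (Iic t).indicator (fun s => J s t) s ∂μ) ∂μ := by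
    rw [intervalIntegral.integral_of_le hT]
    refine setIntegral_congr_fun measurableSet_Ioc fun t ht => ?_
    rw [intervalIntegral.integral_of_le ht.1.le, setIntegral_indicator measurableSet_Iic,
      Ioc_inter_Iic, min_eq_right ht.2]
  have hright : ∫ s in (0 : ℝ)..T, ∫ t in s..T, J s t =
      ∫ s, (∫ t, (Iic t).indicator (fun s => J s t) s ∂μ) ∂μ := by
    rw [intervalIntegral.integral_of_le hT]
    refine setIntegral_congr_fun measurableSet_Ioc fun s hs => ?_
    have hset : Icc s T = Ioc 0 T ∩ Ici s := by
      ext t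
      simp only [mem_Icc, mem_inter_iff, mem_Ioc, mem_Ici]
      exact ⟨fun h => ⟨⟨hs.1.trans_le h.1, h.2⟩, h.1⟩, fun h => ⟨h.2, h.1.2⟩⟩
    rw [intervalIntegral.integral_of_le hs.2, ← integral_Icc_eq_integral_Ioc, hset,
      ← setIntegral_indicator measurableSet_Ici]
    simp only [indicator_apply, mem_Ici, mem_Iic, μ]
  have hsquare : Integrable (fun q : ℝ × ℝ => J q.2 q.1) (μ.prod μ) := by
    rw [Measure.prod_restrict]
    exact (ContinuousOn.integrableOn_compact (isCompact_Icc.prod isCompact_Icc)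
      (hJ.comp continuous_swap).continuousOn).mono_set
        (prod_mono Ioc_subset_Icc_self Ioc_subset_Icc_self)
  rw [hleft, hright]
  refine integral_integral_swap ((hsquare.indicator
    (measurableSet_le measurable_snd measurable_fst)).congr (Eventually.of_forall fun q => ?_))
  simp only [indicator_apply, mem_ofPred_eq, mem_Iic, Function.uncurry]

theorem hasDerivAt_line (x a t : ℝ) :
    HasDerivAt (fun t : ℝ => (x + a * t, t)) (a, (1 : ℝ)) t := by
  simpa using (((hasDerivAt_id t).const_mul a).const_add x).prodMk (hasDerivAt_id t)

theorem iteratedDeriv_two_comp_line {E : Type*} [NormedAddCommGroup E] [NormedSpace ℝ E]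
    {U : E → ℝ} {p e : E} {γ : ℝ → E} {r : ℝ} (hγ : ∀ s, HasDerivAt γ e s) (hγr : γ r = p)
    (hU : ContDiffAt ℝ 2 U p) :
    iteratedDeriv 2 (fun s => U (γ s)) r = fderiv ℝ (fderiv ℝ U) p e e := by
  subst hγr
  have hdiff : ∀ᶠ q in 𝓝 (γ r), DifferentiableAt ℝ U q := by
    filter_upwards [hU.eventually (by simp)] with q hq using hq.differentiableAt (by simp)
  have hderiv : deriv (fun s => U (γ s)) =ᶠ[𝓝 r] fun s => fderiv ℝ U (γ s) e := by
    filter_upwards [(hγ r).continuousAt.eventually hdiff] with s hs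
    exact (hs.hasFDerivAt.comp_hasDerivAt s (hγ s)).deriv
  have hfderiv : DifferentiableAt ℝ (fderiv ℝ U) (γ r) :=
    (hU.fderiv_right (m := 1) (by norm_num)).differentiableAt (by simp)
  rw [iteratedDeriv_succ, iteratedDeriv_one, hderiv.deriv_eq]
  exact ((hfderiv.hasFDerivAt.comp_hasDerivAt r (hγ r)).clm_apply
    (hasDerivAt_const r e)).deriv.trans (by simp)

theorem uniqueDiffOn_halfPlane : UniqueDiffOn ℝ ((univ : Set ℝ) ×ˢ Ici (0 : ℝ)) :=
  uniqueDiffOn_univ.prod (uniqueDiffOn_Ici 0)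

theorem halfPlane_mem_nhds {p : ℝ × ℝ} (hp : 0 < p.2) :
    (univ : Set ℝ) ×ˢ Ici (0 : ℝ) ∈ 𝓝 p :=
  prod_mem_nhds univ_mem (Ici_mem_nhds hp)

/-- The derivative `u_t + c u_x` of `u` along the outgoing characteristic through `p`, one-sided
at time zero. -/
def outgoingDeriv (c : ℝ) (u : ℝ → ℝ → ℝ) (p : ℝ × ℝ) : ℝ :=
  fderivWithin ℝ (fun p : ℝ × ℝ => u p.1 p.2) (univ ×ˢ Ici 0) p (c, 1)

section DAlembert

variable {u F : ℝ → ℝ → ℝ}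

theorem outgoingDeriv_eq_fderiv (c : ℝ) (u : ℝ → ℝ → ℝ) {p : ℝ × ℝ} (hp : 0 < p.2) :
    outgoingDeriv c u p = fderiv ℝ (fun p : ℝ × ℝ => u p.1 p.2) p (c, 1) := by
  rw [outgoingDeriv, fderivWithin_of_mem_nhds (halfPlane_mem_nhds hp)]

theorem outgoingDeriv_continuousOn
    (hu : ContDiffOn ℝ 2 (fun p : ℝ × ℝ => u p.1 p.2) (univ ×ˢ Ici 0)) (c : ℝ) :
    ContinuousOn (outgoingDeriv c u) (univ ×ˢ Ici 0) :=
  (hu.continuousOn_fderivWithin uniqueDiffOn_halfPlane (by norm_num)).clm_apply continuousOn_const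

theorem outgoingDeriv_of_zero_data
    (hu : ContDiffOn ℝ 2 (fun p : ℝ × ℝ => u p.1 p.2) (univ ×ˢ Ici 0))
    (h0 : ∀ x, u x 0 = 0) (h1 : ∀ x, derivWithin (fun s => u x s) (Ici 0) 0 = 0) (c x : ℝ) :
    outgoingDeriv c u (x, 0) = 0 := by
  have hd := (hu.differentiableOn (by simp) (x, 0) (by simp)).hasFDerivWithinAt
  have ht : fderivWithin ℝ (fun p : ℝ × ℝ => u p.1 p.2) (univ ×ˢ Ici 0) (x, 0) (0, 1) = 0 := by
    refine Eq.trans ?_ (h1 x)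
    exact ((hd.comp_hasDerivWithinAt (0 : ℝ)
      ((hasDerivAt_const (0 : ℝ) x).prodMk (hasDerivAt_id (0 : ℝ))).hasDerivWithinAt
      (fun s hs => by simpa using hs)).derivWithin (uniqueDiffOn_Ici 0 0 self_mem_Ici)).symm
  have hx : fderivWithin ℝ (fun p : ℝ × ℝ => u p.1 p.2) (univ ×ˢ Ici 0) (x, 0) (1, 0) = 0 := by
    have hγ : HasDerivWithinAt (fun z : ℝ => (z, (0 : ℝ))) (1, 0) univ x :=
      ((hasDerivAt_id x).prodMk (hasDerivAt_const x (0 : ℝ))).hasDerivWithinAt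
    have h := hasDerivWithinAt_univ.1 (hd.comp_hasDerivWithinAt x hγ fun s _ => by simp)
    exact (h.congr_of_eventuallyEq (Eventually.of_forall fun z => (h0 z).symm)).unique
      (hasDerivAt_const x (0 : ℝ))
  have hsplit : ((c, 1) : ℝ × ℝ) = c • (1, 0) + (0, 1) := by simp
  rw [outgoingDeriv, hsplit, map_add, map_smul, ht, hx, smul_zero, add_zero]

theorem fderiv_fderiv_eq_wave {c x t : ℝ}
    (hu : ContDiffAt ℝ 2 (fun p : ℝ × ℝ => u p.1 p.2) (x, t)) :
    fderiv ℝ (fderiv ℝ fun p : ℝ × ℝ => u p.1 p.2) (x, t) (-c, 1) (c, 1) =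
      iteratedDeriv 2 (fun s => u x s) t - c ^ 2 * iteratedDeriv 2 (fun z => u z t) x := by
  have hxx := iteratedDeriv_two_comp_line (γ := fun z => (z, t))
    (fun s => (hasDerivAt_id s).prodMk (hasDerivAt_const s t)) rfl hu
  have htt := iteratedDeriv_two_comp_line (γ := fun s => (x, s))
    (fun s => (hasDerivAt_const s x).prodMk (hasDerivAt_id s)) rfl hu
  have hsymm := (hu.isSymmSndFDerivAt (by simp)).eq (1, 0) (0, 1)
  have hin : ((-c, 1) : ℝ × ℝ) = (-c) • (1, 0) + (0, 1) := by simp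
  have hout : ((c, 1) : ℝ × ℝ) = c • (1, 0) + (0, 1) := by simp
  rw [hxx, htt]
  simp only [hin, hout, map_add, map_smul, add_apply, smul_apply, smul_eq_mul]
  linear_combination -c * hsymm

theorem hasDerivAt_outgoingDeriv {c : ℝ}
    (hu : ContDiffOn ℝ 2 (fun p : ℝ × ℝ => u p.1 p.2) (univ ×ˢ Ici 0))
    (hwave : ∀ x t : ℝ, 0 < t → iteratedDeriv 2 (fun s : ℝ => u x s) t =
      c ^ 2 * iteratedDeriv 2 (fun z : ℝ => u z t) x + F x t)
    (x : ℝ) {t : ℝ} (ht : 0 < t) :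
    HasDerivAt (fun t => outgoingDeriv c u (x - c * t, t)) (F (x - c * t) t) t := by
  have hp : ContDiffAt ℝ 2 (fun p : ℝ × ℝ => u p.1 p.2) (x - c * t, t) :=
    hu.contDiffAt (halfPlane_mem_nhds ht)
  have hd := ((hp.fderiv_right (m := 1) (by norm_num)).differentiableAt (by simp)).hasFDerivAt
  have hγ : HasDerivAt (fun t : ℝ => (x - c * t, t)) (-c, (1 : ℝ)) t := by
    simpa only [neg_mul, ← sub_eq_add_neg] using hasDerivAt_line x (-c) t
  have h := (HasFDerivAt.comp_hasDerivAt (f := fun t : ℝ => (x - c * t, t)) t hd hγ).clm_apply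
    (hasDerivAt_const t (c, (1 : ℝ)))
  have hev : (fun t => outgoingDeriv c u (x - c * t, t)) =ᶠ[𝓝 t]
      fun t => fderiv ℝ (fun p : ℝ × ℝ => u p.1 p.2) (x - c * t, t) (c, 1) := by
    filter_upwards [lt_mem_nhds ht] with s hs using outgoingDeriv_eq_fderiv c u hs
  refine (h.congr_of_eventuallyEq hev).congr_deriv ?_
  rw [map_zero, add_zero, fderiv_fderiv_eq_wave hp, hwave _ t ht, add_sub_cancel_left]

theorem outgoingDeriv_eq_integral {c : ℝ} (hF : Continuous (Function.uncurry F))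
    (hu : ContDiffOn ℝ 2 (fun p : ℝ × ℝ => u p.1 p.2) (univ ×ˢ Ici 0))
    (h0 : ∀ x, u x 0 = 0) (h1 : ∀ x, derivWithin (fun s => u x s) (Ici 0) 0 = 0)
    (hwave : ∀ x t : ℝ, 0 < t → iteratedDeriv 2 (fun s : ℝ => u x s) t =
      c ^ 2 * iteratedDeriv 2 (fun z : ℝ => u z t) x + F x t) (x : ℝ) {t : ℝ} (ht : 0 ≤ t) :
    outgoingDeriv c u (x - c * t, t) = ∫ s in (0 : ℝ)..t, F (x - c * s) s := by
  have hint : Continuous fun s => F (x - c * s) s :=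
    hF.comp (by fun_prop : Continuous fun s => (x - c * s, s))
  rw [intervalIntegral.integral_eq_sub_of_hasDerivAt_of_le ht
    ((outgoingDeriv_continuousOn hu c).comp (f := fun s => (x - c * s, s)) (by fun_prop)
      fun s hs => ⟨mem_univ _, hs.1⟩)
    (fun s hs => hasDerivAt_outgoingDeriv hu hwave x hs.1) (hint.intervalIntegrable _ _)]
  simp only [Function.comp_apply, mul_zero, sub_zero, outgoingDeriv_of_zero_data hu h0 h1]

theorem eq_integral_outgoingDeriv
    (hu : ContDiffOn ℝ 2 (fun p : ℝ × ℝ => u p.1 p.2) (univ ×ˢ Ici 0)) (h0 : ∀ x, u x 0 = 0)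
    (c x : ℝ) {t : ℝ} (ht : 0 ≤ t) :
    u (x + c * t) t = ∫ s in (0 : ℝ)..t, outgoingDeriv c u (x + c * s, s) := by
  have hmaps : MapsTo (fun s : ℝ => (x + c * s, s)) (Icc 0 t) (univ ×ˢ Ici 0) :=
    fun s hs => ⟨mem_univ _, hs.1⟩
  have hderiv : ∀ s ∈ Ioo 0 t, HasDerivAt ((fun p : ℝ × ℝ => u p.1 p.2) ∘ fun s => (x + c * s, s))
      (outgoingDeriv c u (x + c * s, s)) s := fun s hs => by
    rw [outgoingDeriv_eq_fderiv c u hs.1]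
    exact HasFDerivAt.comp_hasDerivAt (f := fun s => (x + c * s, s)) s
      ((hu.contDiffAt (halfPlane_mem_nhds hs.1)).differentiableAt (by simp)).hasFDerivAt
      (hasDerivAt_line x c s)
  rw [intervalIntegral.integral_eq_sub_of_hasDerivAt_of_le ht
    (hu.continuousOn.comp (by fun_prop) hmaps) hderiv
    (((outgoingDeriv_continuousOn hu c).comp (by fun_prop) hmaps).intervalIntegrable_of_Icc ht)]
  simp only [Function.comp_apply, h0, sub_zero]

theorem dAlembert {c : ℝ} (hc : 0 < c) (hF : Continuous (Function.uncurry F))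
    (hu : ContDiffOn ℝ 2 (fun p : ℝ × ℝ => u p.1 p.2) (univ ×ˢ Ici 0))
    (h0 : ∀ x, u x 0 = 0) (h1 : ∀ x, derivWithin (fun s => u x s) (Ici 0) 0 = 0)
    (hwave : ∀ x t : ℝ, 0 < t → iteratedDeriv 2 (fun s : ℝ => u x s) t =
      c ^ 2 * iteratedDeriv 2 (fun z : ℝ => u z t) x + F x t) (x : ℝ) {t : ℝ} (ht : 0 ≤ t) :
    u x t = 1 / (2 * c) *
      ∫ s in (0 : ℝ)..t, ∫ ξ in (x - c * (t - s))..(x + c * (t - s)), F ξ s := by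
  have hcont : Continuous (Function.uncurry fun s τ => F (x - c * t + 2 * c * τ - c * s) s) :=
    hF.comp (by fun_prop : Continuous fun q : ℝ × ℝ =>
      (x - c * t + 2 * c * q.2 - c * q.1, q.1))
  calc u x t = ∫ τ in (0 : ℝ)..t, outgoingDeriv c u (x - c * t + c * τ, τ) := by
        rw [← eq_integral_outgoingDeriv hu h0 c _ ht, sub_add_cancel]
    _ = ∫ τ in (0 : ℝ)..t, ∫ s in (0 : ℝ)..τ, F (x - c * t + 2 * c * τ - c * s) s := by
        refine intervalIntegral.integral_congr fun τ hτ => ?_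
        rw [uIcc_of_le ht] at hτ
        rw [show x - c * t + c * τ = (x - c * t + 2 * c * τ) - c * τ by ring]
        exact outgoingDeriv_eq_integral hF hu h0 h1 hwave _ hτ.1
    _ = ∫ s in (0 : ℝ)..t, ∫ τ in s..t, F (x - c * t + 2 * c * τ - c * s) s :=
        integral_triangle_swap hcont ht
    _ = ∫ s in (0 : ℝ)..t,
          1 / (2 * c) * ∫ ξ in (x - c * (t - s))..(x + c * (t - s)), F ξ s := by
        refine intervalIntegral.integral_congr fun s _ => ?_
        have hsub : ∀ τ, x - c * t + 2 * c * τ - c * s = 2 * c * τ + (x - c * t - c * s) :=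
          fun τ => by ring
        simp only [hsub]
        rw [intervalIntegral.integral_comp_mul_add (fun ξ => F ξ s) (by positivity), smul_eq_mul,
          one_div]
        congr 2 <;> ring
    _ = 1 / (2 * c) *
          ∫ s in (0 : ℝ)..t, ∫ ξ in (x - c * (t - s))..(x + c * (t - s)), F ξ s :=
        intervalIntegral.integral_const_mul _ _

end DAlembert

/-! ### The field of a smeared source is a classical solution -/

section

variable {K k p : ℝ → ℝ} {M : ℝ}

theorem charIntegral_hasFDerivAt (hK : ∀ w, HasDerivAt K (k w) w) (hk : Continuous k)
    (hM : ∀ w, |k w| ≤ M) (hp : Continuous p) (q : ℝ × ℝ) :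
    HasFDerivAt (fun q : ℝ × ℝ => charIntegral K p q.1 q.2)
      (charIntegral k p q.1 q.2 • ContinuousLinearMap.fst ℝ ℝ ℝ +
        K (q.1 - p q.2) • ContinuousLinearMap.snd ℝ ℝ ℝ) q := by
  have hKc : Continuous K := continuous_iff_continuousAt.2 fun w => (hK w).continuousAt
  have h := hasStrictFDerivAt_uncurry_coprod (𝕜 := ℝ) (u := q) (f := charIntegral K p)
    (f₁ := fun u t => charIntegral k p u t • ContinuousLinearMap.id ℝ ℝ)
    (f₂ := fun u t => K (u - p t) • ContinuousLinearMap.id ℝ ℝ)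
    (Eventually.of_forall fun v => ?_) (Eventually.of_forall fun v => ?_)
    ((charIntegral_continuous hk hp).smul continuous_const).continuousAt
    ((by fun_prop : Continuous fun v : ℝ × ℝ => K (v.1 - p v.2)).smul
      continuous_const).continuousAt
  · refine h.hasFDerivAt.congr_fderiv ?_
    ext <;> simp [Function.HasUncurry.uncurry]
  · refine (charIntegral_hasDerivAt hK hk hM hp v.2 v.1).hasFDerivAt.congr_fderiv ?_
    ext
    simp [Function.HasUncurry.uncurry]
  · refine ((by fun_prop : Continuous fun s => K (v.1 - p s)).integral_hasStrictDerivAt 0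
      v.2).hasDerivAt.hasFDerivAt.congr_fderiv ?_
    ext
    simp [Function.HasUncurry.uncurry]

theorem charIntegral_fderiv (hK : ∀ w, HasDerivAt K (k w) w) (hk : Continuous k)
    (hM : ∀ w, |k w| ≤ M) (hp : Continuous p) :
    fderiv ℝ (fun q : ℝ × ℝ => charIntegral K p q.1 q.2) = fun q =>
      charIntegral k p q.1 q.2 • ContinuousLinearMap.fst ℝ ℝ ℝ +
        K (q.1 - p q.2) • ContinuousLinearMap.snd ℝ ℝ ℝ :=
  funext fun q => (charIntegral_hasFDerivAt hK hk hM hp q).fderiv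

theorem charIntegral_contDiff_one (hK : ∀ w, HasDerivAt K (k w) w) (hk : Continuous k)
    (hM : ∀ w, |k w| ≤ M) (hp : Continuous p) :
    ContDiff ℝ 1 fun q : ℝ × ℝ => charIntegral K p q.1 q.2 := by
  have hKc : Continuous K := continuous_iff_continuousAt.2 fun w => (hK w).continuousAt
  rw [contDiff_one_iff_fderiv, charIntegral_fderiv hK hk hM hp]
  exact ⟨fun q => (charIntegral_hasFDerivAt hK hk hM hp q).differentiableAt,
    ((charIntegral_continuous hk hp).smul continuous_const).add
      ((by fun_prop : Continuous fun v : ℝ × ℝ => K (v.1 - p v.2)).smul continuous_const)⟩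

theorem charIntegral_contDiff_two {k' : ℝ → ℝ} {M' : ℝ} (hK : ∀ w, HasDerivAt K (k w) w)
    (hM : ∀ w, |k w| ≤ M) (hk : ∀ w, HasDerivAt k (k' w) w) (hk' : Continuous k')
    (hM' : ∀ w, |k' w| ≤ M') (hp : ContDiff ℝ 1 p) :
    ContDiff ℝ 2 fun q : ℝ × ℝ => charIntegral K p q.1 q.2 := by
  have hkc : Continuous k := continuous_iff_continuousAt.2 fun w => (hk w).continuousAt
  have hK1 : ContDiff ℝ 1 K := contDiff_one_iff_deriv.2
    ⟨fun w => (hK w).differentiableAt, by rwa [funext fun w => (hK w).deriv]⟩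
  have h1 := charIntegral_contDiff_one hk hk' hM' hp.continuous
  have h2 : ContDiff ℝ 1 fun v : ℝ × ℝ => K (v.1 - p v.2) := by fun_prop
  rw [show (2 : ℕ∞ω) = 1 + 1 by norm_num, contDiff_succ_iff_fderiv,
    charIntegral_fderiv hK hkc hM hp.continuous]
  exact ⟨fun q => (charIntegral_hasFDerivAt hK hkc hM hp.continuous q).differentiableAt,
    by simp, (h1.smul contDiff_const).add (h2.smul contDiff_const)⟩

theorem charIntegral_hasDerivAt_line (hK : ∀ w, HasDerivAt K (k w) w) (hk : Continuous k)
    (hM : ∀ w, |k w| ≤ M) (hp : Continuous p) (x a t : ℝ) :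
    HasDerivAt (fun t => charIntegral K p (x + a * t) t)
      (a * charIntegral k p (x + a * t) t + K (x + a * t - p t)) t := by
  refine (HasFDerivAt.comp_hasDerivAt (f := fun t : ℝ => (x + a * t, t)) t
    (charIntegral_hasFDerivAt hK hk hM hp (x + a * t, t)) (hasDerivAt_line x a t)).congr_deriv ?_
  simp [mul_comm]

variable {y : ℝ → ℝ}

theorem retardedField_hasDerivAt_space (hK : ∀ w, HasDerivAt K (k w) w) (hk : Continuous k)
    (hM : ∀ w, |k w| ≤ M) (hy : Continuous y) (c x t : ℝ) :
    HasDerivAt (fun x => retardedField K c y x t) (retardedField k c y x t) x := by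
  have hKc : Continuous K := continuous_iff_continuousAt.2 fun w => (hK w).continuousAt
  simp only [retardedField_eq_charIntegral_of_continuous hKc hy,
    retardedField_eq_charIntegral_of_continuous hk hy]
  exact ((charIntegral_hasDerivAt hK hk hM (by fun_prop) t _).comp_add_const x (c * t)).sub
    ((charIntegral_hasDerivAt hK hk hM (by fun_prop) t _).comp_sub_const x (c * t))

theorem retardedField_hasDerivAt_time (hK : ∀ w, HasDerivAt K (k w) w) (hk : Continuous k)
    (hM : ∀ w, |k w| ≤ M) (hy : Continuous y) (c x t : ℝ) :
    HasDerivAt (fun t => retardedField K c y x t)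
      (c * (charIntegral k (fun s => y s + c * s) (x + c * t) t +
        charIntegral k (fun s => y s - c * s) (x + -c * t) t)) t := by
  have hKc : Continuous K := continuous_iff_continuousAt.2 fun w => (hK w).continuousAt
  have hadv := charIntegral_hasDerivAt_line hK hk hM (p := fun s => y s + c * s) (by fun_prop) x c t
  have hret := charIntegral_hasDerivAt_line hK hk hM (p := fun s => y s - c * s) (by fun_prop) x
    (-c) t
  simp only [retardedField_eq_charIntegral_of_continuous hKc hy, sub_eq_add_neg x, ← neg_mul]
  refine (hadv.sub hret).congr_deriv ?_
  rw [show x + c * t - (y t + c * t) = x + -c * t - (y t - c * t) by ring]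
  ring

theorem retardedField_wave {k' : ℝ → ℝ} {M' : ℝ} (hK : ∀ w, HasDerivAt K (k w) w)
    (hM : ∀ w, |k w| ≤ M) (hk : ∀ w, HasDerivAt k (k' w) w) (hk' : Continuous k')
    (hM' : ∀ w, |k' w| ≤ M') (hy : Continuous y) (c x t : ℝ) :
    iteratedDeriv 2 (fun s => retardedField K c y x s) t =
      c ^ 2 * iteratedDeriv 2 (fun z => retardedField K c y z t) x + 2 * c * k (x - y t) := by
  have hkc : Continuous k := continuous_iff_continuousAt.2 fun w => (hk w).continuousAt
  have hadv := charIntegral_hasDerivAt_line hk hk' hM' (p := fun s => y s + c * s)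
    (by fun_prop) x c t
  have hret := charIntegral_hasDerivAt_line hk hk' hM' (p := fun s => y s - c * s)
    (by fun_prop) x (-c) t
  rw [iteratedDeriv_succ, iteratedDeriv_one, iteratedDeriv_succ, iteratedDeriv_one,
    funext fun s => (retardedField_hasDerivAt_time hK hkc hM hy c x s).deriv,
    funext fun z => (retardedField_hasDerivAt_space hK hkc hM hy c z t).deriv,
    (retardedField_hasDerivAt_space hk hk' hM' hy c x t).deriv,
    retardedField_eq_charIntegral_of_continuous hk' hy]
  refine ((hadv.add hret).const_mul c).deriv.trans ?_
  rw [show x + c * t - (y t + c * t) = x - y t by ring,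
    show x + -c * t - (y t - c * t) = x - y t by ring, show x + -c * t = x - c * t by ring]
  ring

theorem retardedField_contDiff_two {k' : ℝ → ℝ} {M' : ℝ} (hK : ∀ w, HasDerivAt K (k w) w)
    (hM : ∀ w, |k w| ≤ M) (hk : ∀ w, HasDerivAt k (k' w) w) (hk' : Continuous k')
    (hM' : ∀ w, |k' w| ≤ M') (hy : ContDiff ℝ 1 y) (c : ℝ) :
    ContDiff ℝ 2 fun q : ℝ × ℝ => retardedField K c y q.1 q.2 := by
  have hKc : Continuous K := continuous_iff_continuousAt.2 fun w => (hK w).continuousAt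
  have h : ∀ p : ℝ → ℝ, ContDiff ℝ 1 p →
      ContDiff ℝ 2 fun q : ℝ × ℝ => charIntegral K p q.1 q.2 :=
    fun p hp => charIntegral_contDiff_two hK hM hk hk' hM' hp
  simp only [retardedField_eq_charIntegral_of_continuous hKc hy.continuous]
  exact ((h _ (by fun_prop)).comp (by fun_prop : ContDiff ℝ 2 fun q : ℝ × ℝ =>
    (q.1 + c * q.2, q.2))).sub ((h _ (by fun_prop)).comp (by fun_prop : ContDiff ℝ 2
    fun q : ℝ × ℝ => (q.1 - c * q.2, q.2)))

end

section

variable {σ : ℝ} {y : ℝ → ℝ}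

theorem retardedField_smoothStep_contDiff_two (hσ : 0 < σ) (hy : ContDiff ℝ 1 y) (c : ℝ) :
    ContDiff ℝ 2 fun q : ℝ × ℝ => retardedField (smoothStep σ) c y q.1 q.2 :=
  retardedField_contDiff_two (smoothStep_hasDerivAt σ) (abs_gaussianDelta_le hσ)
    (gaussianDelta_hasDerivAt hσ) (by fun_prop) (abs_deriv_gaussianDelta_le hσ) hy c

theorem retardedField_smoothStep_wave (hσ : 0 < σ) (hy : Continuous y) (c x t : ℝ) :
    iteratedDeriv 2 (fun s => retardedField (smoothStep σ) c y x s) t =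
      c ^ 2 * iteratedDeriv 2 (fun z => retardedField (smoothStep σ) c y z t) x +
        2 * c * gaussianDelta σ (x - y t) :=
  retardedField_wave (smoothStep_hasDerivAt σ) (abs_gaussianDelta_le hσ)
    (gaussianDelta_hasDerivAt hσ) (by fun_prop) (abs_deriv_gaussianDelta_le hσ) hy c x t

theorem retardedField_smoothStep_hasDerivAt_time_zero (hσ : 0 < σ) (hy : Continuous y)
    (c x : ℝ) : HasDerivAt (fun t => retardedField (smoothStep σ) c y x t) 0 0 := by
  simpa [charIntegral] using retardedField_hasDerivAt_time (smoothStep_hasDerivAt σ)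
    (gaussianDelta_continuous σ) (abs_gaussianDelta_le hσ) hy c x 0

end

theorem integral_gaussianDelta_sub (σ y a b : ℝ) :
    ∫ ξ in a..b, gaussianDelta σ (ξ - y) = smoothStep σ (b - y) - smoothStep σ (a - y) := by
  rw [intervalIntegral.integral_comp_sub_right (gaussianDelta σ)]
  exact intervalIntegral.integral_eq_sub_of_hasDerivAt (fun r _ => smoothStep_hasDerivAt σ r)
    ((gaussianDelta_continuous σ).intervalIntegrable _ _)

theorem continuous_comp_max {f : ℝ → ℝ} (hf : ContinuousOn f (Ici 0)) :
    Continuous fun t => f (max t 0) :=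
  hf.comp_continuous (by fun_prop) fun t => by simp

theorem IsSmoothSolution.field_eq {m c β v₀ σ : ℝ} (hc : 0 < c)
    {φ : ℝ → ℝ → ℝ} {y : ℝ → ℝ} (h : IsSmoothSolution m c β v₀ (gaussianDelta σ) φ y)
    (x : ℝ) {t : ℝ} (ht : 0 ≤ t) :
    φ x t = β / (2 * c) * retardedField (smoothStep σ) c y x t := by
  have hy : Continuous fun t => y (max t 0) :=
    continuous_comp_max h.trajectory.contDiffOn.continuousOn
  have hy_eq : ∀ s, 0 ≤ s → y (max s 0) = y s := fun s hs => by rw [max_eq_left hs]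
  have hF : Continuous (Function.uncurry fun x t => β * gaussianDelta σ (x - y (max t 0))) :=
    continuous_const.mul ((gaussianDelta_continuous σ).comp
      (continuous_fst.sub (hy.comp continuous_snd)))
  rw [dAlembert hc hF h.field_contDiffOn h.field_zero h.field_deriv_zero
    (fun x t ht => by simpa only [hy_eq t ht.le] using h.wave x t ht) x ht]
  simp only [intervalIntegral.integral_const_mul, integral_gaussianDelta_sub]
  rw [← mul_assoc, one_div_mul_eq_div, ← retardedField_congr ht (fun s hs => hy_eq s hs.1),
    retardedField]
  simp only [sub_right_comm x, add_sub_right_comm]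

/-! ### Causal integral equations -/

/-- The values of `a v` on `[0, T]` depend on `v` in a `C`-Lipschitz way, and `a v t` depends only
on the values of `v` on `[0, t]`. -/
def CausalLipschitzUpTo (a : (ℝ → ℝ) → ℝ → ℝ) (T C : ℝ) : Prop :=
  ∀ v w, Continuous v → Continuous w → ∀ t ∈ Icc 0 T, ∀ A : ℝ,
    (∀ s ∈ Icc 0 t, |v s - w s| ≤ A) → |a v t - a w t| ≤ C * A

/-- The right-hand sides `a` for which the causal integral equation `v t = v₀ + ∫₀ᵗ a v` is
globally well posed: they preserve continuity and are causally Lipschitz on bounded intervals. -/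
structure CausalLipschitz (a : (ℝ → ℝ) → ℝ → ℝ) : Prop where
  continuous : ∀ v, Continuous v → Continuous (a v)
  lipschitz : ∀ T : ℝ, ∃ C : ℝ, 0 ≤ C ∧ CausalLipschitzUpTo a T C

theorem integral_exp_mul_le {l : ℝ} (hl : 0 < l) (t : ℝ) :
    ∫ s in (0 : ℝ)..t, Real.exp (l * s) ≤ Real.exp (l * t) / l := by
  rw [intervalIntegral.integral_comp_mul_left _ hl.ne', integral_exp, mul_zero, Real.exp_zero,
    smul_eq_mul, ← div_eq_inv_mul]
  gcongr
  linarith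

theorem abs_integral_le_of_le_exp {f : ℝ → ℝ} {B l t : ℝ} (hl : 0 < l) (ht : 0 ≤ t) (hB : 0 ≤ B)
    (h : ∀ s ∈ Icc 0 t, |f s| ≤ B * Real.exp (l * s)) :
    |∫ s in (0 : ℝ)..t, f s| ≤ B * (Real.exp (l * t) / l) :=
  calc ‖∫ s in (0 : ℝ)..t, f s‖ ≤ ∫ s in (0 : ℝ)..t, B * Real.exp (l * s) :=
        intervalIntegral.norm_integral_le_of_norm_le ht
          (Eventually.of_forall fun s hs => h s ⟨hs.1.le, hs.2⟩)
          ((by fun_prop : Continuous fun s => B * Real.exp (l * s)).intervalIntegrable _ _)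
    _ ≤ B * (Real.exp (l * t) / l) := by
        rw [intervalIntegral.integral_const_mul]
        gcongr
        exact integral_exp_mul_le hl t

-- Apply `h` with the smallest `A` for which `d s ≤ A * exp (l * s)`: for `l > 2 * C` it says
-- `A ≤ ε + A / 2`.
theorem le_two_mul_exp_of_weighted_bound {d : ℝ → ℝ} {T ε C : ℝ} (hd : ContinuousOn d (Icc 0 T))
    (hε : 0 ≤ ε) (hC : 0 ≤ C)
    (h : ∀ A l : ℝ, 0 ≤ A → 0 < l → (∀ s ∈ Icc 0 T, d s ≤ A * Real.exp (l * s)) →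
      ∀ t ∈ Icc 0 T, d t ≤ ε + C * A * (Real.exp (l * t) / l)) :
    ∀ t ∈ Icc 0 T, d t ≤ 2 * ε * Real.exp ((2 * C + 1) * t) := by
  intro t ht
  set l := 2 * C + 1
  have hl : 0 < l := by positivity
  have hexp : ∀ s, Real.exp (l * s) * Real.exp (-(l * s)) = 1 := fun s => by simp [← Real.exp_add]
  obtain ⟨t₀, ht₀, hmax⟩ := isCompact_Icc.exists_isMaxOn ⟨t, ht⟩
    (hd.mul (by fun_prop : ContinuousOn (fun s => Real.exp (-(l * s))) (Icc 0 T)))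
  set A := d t₀ * Real.exp (-(l * t₀))
  have hdA : ∀ s ∈ Icc 0 T, d s ≤ A * Real.exp (l * s) := fun s hs =>
    calc d s = d s * Real.exp (-(l * s)) * Real.exp (l * s) := by
          rw [mul_assoc, mul_comm (Real.exp _), hexp, mul_one]
      _ ≤ A * Real.exp (l * s) := by
          gcongr
          exact hmax hs
  have hA : A ≤ 2 * ε := by
    rcases le_total A 0 with hA0 | hA0
    · linarith
    have hself : A ≤ ε + A / 2 :=
      calc A ≤ (ε + C * A * (Real.exp (l * t₀) / l)) * Real.exp (-(l * t₀)) := by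
            exact mul_le_mul_of_nonneg_right (h A l hA0 hl hdA t₀ ht₀) (Real.exp_pos _).le
        _ = ε * Real.exp (-(l * t₀)) + C / l * A := by
            linear_combination (C * A / l) * hexp t₀
        _ ≤ ε * 1 + 1 / 2 * A := by
            gcongr ε * ?_ + ?_ * A
            · exact Real.exp_le_one_iff.2 (neg_nonpos.2 (mul_nonneg hl.le ht₀.1))
            · rw [div_le_div_iff₀ hl two_pos]
              linarith
        _ = ε + A / 2 := by ring
    linarith
  exact (hdA t ht).trans (by gcongr)

theorem exists_continuous_of_dist_le_geometric {u : ℕ → ℝ → ℝ} (hu : ∀ n, Continuous (u n))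
    (h : ∀ T, ∃ B, ∀ n, ∀ t ∈ Icc 0 T, dist (u n t) (u (n + 1) t) ≤ B / 2 / 2 ^ n) :
    ∃ v : ℝ → ℝ, Continuous v ∧
      ∀ T, ∃ B, ∀ n, ∀ t ∈ Icc 0 T, dist (u n t) (v t) ≤ B / 2 ^ n := by
  choose B hB using h
  have hlim : ∀ t, ∃ L, Tendsto (fun n => u n (max t 0)) atTop (𝓝 L) := fun t =>
    cauchySeq_tendsto_of_complete
      (cauchySeq_of_le_geometric_two fun n => hB (max t 0) n _ ⟨le_max_right _ _, le_rfl⟩)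
  choose v hv using hlim
  have hdist : ∀ T n t, max t 0 ≤ T → dist (u n (max t 0)) (v t) ≤ B T / 2 ^ n := fun T n t ht =>
    dist_le_of_le_geometric_two_of_tendsto (fun n => hB T n _ ⟨le_max_right _ _, ht⟩) (hv t) n
  refine ⟨v, ?_, fun T => ⟨B T, fun n t ht => ?_⟩⟩
  · refine TendstoLocallyUniformly.continuous (F := fun n t => u n (max t 0)) (p := atTop) ?_
      (Frequently.of_forall fun n => (hu n).comp (by fun_prop))
    rw [Metric.tendstoLocallyUniformly_iff]
    intro ε hε t
    have hgeo : Tendsto (fun n : ℕ => B (max (t + 1) 0) / 2 ^ n) atTop (𝓝 0) :=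
      tendsto_const_nhds.div_atTop (tendsto_pow_atTop_atTop_of_one_lt one_lt_two)
    refine ⟨Iio (t + 1), Iio_mem_nhds (lt_add_one t), ?_⟩
    filter_upwards [hgeo.eventually (gt_mem_nhds hε)] with n hn s hs
    rw [dist_comm]
    exact (hdist _ n s (max_le_max_right 0 (le_of_lt hs))).trans_lt hn
  · simpa only [max_eq_left ht.1] using hdist T n t (max_le ht.2 (ht.1.trans ht.2))

/-- Picard iterates of the causal integral equation `v t = v₀ + ∫₀ᵗ a v`. -/
def picardIterate (a : (ℝ → ℝ) → ℝ → ℝ) (v₀ : ℝ) : ℕ → ℝ → ℝ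
  | 0 => fun _ => v₀
  | n + 1 => fun t => v₀ + ∫ s in (0 : ℝ)..t, a (picardIterate a v₀ n) s

theorem continuous_primitive {f : ℝ → ℝ} (hf : Continuous f) :
    Continuous fun t => ∫ s in (0 : ℝ)..t, f s :=
  intervalIntegral.continuous_primitive (fun _ _ => hf.intervalIntegrable _ _) 0

namespace CausalLipschitz

variable {a : (ℝ → ℝ) → ℝ → ℝ} {v w : ℝ → ℝ}

theorem integral_sub (ha : CausalLipschitz a) (hv : Continuous v) (hw : Continuous w) (t : ℝ) :
    ∫ s in (0 : ℝ)..t, (a v s - a w s) =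
      (∫ s in (0 : ℝ)..t, a v s) - ∫ s in (0 : ℝ)..t, a w s :=
  intervalIntegral.integral_sub ((ha.continuous v hv).intervalIntegrable _ _)
    ((ha.continuous w hw).intervalIntegrable _ _)

theorem abs_integral_sub_le (ha : CausalLipschitz a) {T C : ℝ} (hC0 : 0 ≤ C)
    (hC : CausalLipschitzUpTo a T C) (hv : Continuous v) (hw : Continuous w) {A l : ℝ}
    (hA : 0 ≤ A) (hl : 0 < l) (h : ∀ s ∈ Icc 0 T, |v s - w s| ≤ A * Real.exp (l * s)) {t : ℝ}
    (ht : t ∈ Icc 0 T) :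
    |(∫ s in (0 : ℝ)..t, a v s) - ∫ s in (0 : ℝ)..t, a w s| ≤
      C * A * (Real.exp (l * t) / l) := by
  rw [← ha.integral_sub hv hw]
  refine abs_integral_le_of_le_exp hl ht.1 (by positivity) fun s hs => ?_
  rw [mul_assoc]
  refine hC v w hv hw s ⟨hs.1, hs.2.trans ht.2⟩ _ fun r hr => ?_
  exact (h r ⟨hr.1, hr.2.trans (hs.2.trans ht.2)⟩).trans (by gcongr; exact hr.2)

theorem unique (ha : CausalLipschitz a) {v₀ : ℝ} (hv : Continuous v) (hw : Continuous w)
    (hve : ∀ t, 0 ≤ t → v t = v₀ + ∫ s in (0 : ℝ)..t, a v s)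
    (hwe : ∀ t, 0 ≤ t → w t = v₀ + ∫ s in (0 : ℝ)..t, a w s) {t : ℝ} (ht : 0 ≤ t) :
    v t = w t := by
  obtain ⟨C, hC0, hC⟩ := ha.lipschitz t
  have hbound := le_two_mul_exp_of_weighted_bound (d := fun s => |v s - w s|) (T := t) (ε := 0)
    (by fun_prop) le_rfl hC0 (fun A l hA hl h s hs => by
      rw [hve s hs.1, hwe s hs.1, add_sub_add_left_eq_sub, zero_add]
      exact ha.abs_integral_sub_le hC0 hC hv hw hA hl h hs) t ⟨ht, le_rfl⟩
  rw [mul_zero, zero_mul] at hbound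
  exact sub_eq_zero.1 (abs_nonpos_iff.1 hbound)

theorem picardIterate_continuous (ha : CausalLipschitz a) (v₀ : ℝ) (n : ℕ) :
    Continuous (picardIterate a v₀ n) := by
  induction n with
  | zero => exact continuous_const
  | succ n ih => exact continuous_const.add (continuous_primitive (ha.continuous _ ih))

-- In the norm weighted by `exp (-l * t)` with `l > 2 * C`, the Picard map halves distances.
theorem abs_picardIterate_succ_sub_le (ha : CausalLipschitz a) {v₀ T C A : ℝ} (hC0 : 0 ≤ C)
    (hC : CausalLipschitzUpTo a T C) (hA0 : 0 ≤ A)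
    (hA : ∀ t ∈ Icc 0 T, |picardIterate a v₀ 1 t - picardIterate a v₀ 0 t| ≤ A) (n : ℕ) :
    ∀ t ∈ Icc 0 T, |picardIterate a v₀ (n + 1) t - picardIterate a v₀ n t| ≤
      A / 2 ^ n * Real.exp ((2 * C + 1) * t) := by
  have hl : 0 < 2 * C + 1 := by positivity
  induction n with
  | zero =>
    intro t ht
    rw [pow_zero, div_one]
    exact (hA t ht).trans
      (le_mul_of_one_le_right hA0 (Real.one_le_exp (mul_nonneg hl.le ht.1)))
  | succ n ih =>
    intro t ht
    calc |picardIterate a v₀ (n + 1 + 1) t - picardIterate a v₀ (n + 1) t|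
        = |(∫ s in (0 : ℝ)..t, a (picardIterate a v₀ (n + 1)) s) -
            ∫ s in (0 : ℝ)..t, a (picardIterate a v₀ n) s| :=
          congrArg abs (add_sub_add_left_eq_sub _ _ _)
      _ ≤ C * (A / 2 ^ n) * (Real.exp ((2 * C + 1) * t) / (2 * C + 1)) :=
          ha.abs_integral_sub_le hC0 hC (ha.picardIterate_continuous v₀ (n + 1))
            (ha.picardIterate_continuous v₀ n) (by positivity) hl ih ht
      _ = C / (2 * C + 1) * (A / 2 ^ n * Real.exp ((2 * C + 1) * t)) := by ring
      _ ≤ 1 / 2 * (A / 2 ^ n * Real.exp ((2 * C + 1) * t)) := by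
          gcongr ?_ * _
          rw [div_le_div_iff₀ hl two_pos]
          linarith
      _ = A / 2 ^ (n + 1) * Real.exp ((2 * C + 1) * t) := by ring

theorem exists_picardIterate_dist_le (ha : CausalLipschitz a) (v₀ T : ℝ) :
    ∃ B : ℝ, ∀ n, ∀ t ∈ Icc 0 T,
      dist (picardIterate a v₀ n t) (picardIterate a v₀ (n + 1) t) ≤ B / 2 / 2 ^ n := by
  obtain ⟨C, hC0, hC⟩ := ha.lipschitz T
  obtain ⟨A, hA⟩ := isCompact_Icc.exists_bound_of_continuousOn (s := Icc 0 T)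
    ((ha.picardIterate_continuous v₀ 1).sub (ha.picardIterate_continuous v₀ 0)).continuousOn
  refine ⟨2 * |A| * Real.exp ((2 * C + 1) * T), fun n t ht => ?_⟩
  rw [dist_comm, Real.dist_eq]
  calc _ ≤ |A| / 2 ^ n * Real.exp ((2 * C + 1) * t) :=
        ha.abs_picardIterate_succ_sub_le hC0 hC (abs_nonneg A)
          (fun t ht => (hA t ht).trans (le_abs_self A)) n t ht
    _ ≤ |A| / 2 ^ n * Real.exp ((2 * C + 1) * T) := by
        gcongr
        exact ht.2
    _ = 2 * |A| * Real.exp ((2 * C + 1) * T) / 2 / 2 ^ n := by ring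

theorem tendsto_integral (ha : CausalLipschitz a) {u : ℕ → ℝ → ℝ} (hu : ∀ n, Continuous (u n))
    (hv : Continuous v) {t B : ℝ} (ht : 0 ≤ t)
    (h : ∀ n, ∀ s ∈ Icc 0 t, dist (u n s) (v s) ≤ B / 2 ^ n) :
    Tendsto (fun n => ∫ s in (0 : ℝ)..t, a (u n) s) atTop (𝓝 (∫ s in (0 : ℝ)..t, a v s)) := by
  obtain ⟨C, -, hC⟩ := ha.lipschitz t
  rw [tendsto_iff_dist_tendsto_zero]
  refine squeeze_zero (g := fun n : ℕ => C * (B / 2 ^ n) * |t - 0|) (fun _ => dist_nonneg)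
    (fun n => ?_) ?_
  · rw [Real.dist_eq, ← ha.integral_sub (hu n) hv]
    refine intervalIntegral.norm_integral_le_of_norm_le_const
      (f := fun s => a (u n) s - a v s) fun s hs => ?_
    rw [uIoc_of_le ht] at hs
    exact hC _ _ (hu n) hv s ⟨hs.1.le, hs.2⟩ _ fun r hr => h n r ⟨hr.1, hr.2.trans hs.2⟩
  · have hgeo : Tendsto (fun n : ℕ => B / 2 ^ n) atTop (𝓝 0) :=
      tendsto_const_nhds.div_atTop (tendsto_pow_atTop_atTop_of_one_lt one_lt_two)
    simpa using (hgeo.const_mul C).mul_const |t - 0|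

theorem exists_solution (ha : CausalLipschitz a) (v₀ : ℝ) :
    ∃ v : ℝ → ℝ, Continuous v ∧ ∀ t, 0 ≤ t → v t = v₀ + ∫ s in (0 : ℝ)..t, a v s := by
  have hcont := ha.picardIterate_continuous v₀
  obtain ⟨v, hv, hdist⟩ := exists_continuous_of_dist_le_geometric hcont
    (ha.exists_picardIterate_dist_le v₀)
  refine ⟨v, hv, fun t ht => ?_⟩
  obtain ⟨B, hB⟩ := hdist t
  have hlim : Tendsto (fun n => picardIterate a v₀ n t) atTop (𝓝 (v t)) :=
    tendsto_iff_dist_tendsto_zero.2 (squeeze_zero (fun _ => dist_nonneg)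
      (fun n => hB n t ⟨ht, le_rfl⟩)
      (tendsto_const_nhds.div_atTop (tendsto_pow_atTop_atTop_of_one_lt one_lt_two)))
  exact tendsto_nhds_unique (hlim.comp (tendsto_add_atTop_nat 1))
    ((ha.tendsto_integral hcont hv ht hB).const_add v₀)

end CausalLipschitz

/-! ### Trajectories and their velocities -/

/-- The trajectory that starts at the origin at time `0` and has velocity `v`. -/
def position (v : ℝ → ℝ) (t : ℝ) : ℝ := ∫ s in (0 : ℝ)..t, v s

section

variable {v w : ℝ → ℝ}

theorem position_hasDerivAt (hv : Continuous v) (t : ℝ) : HasDerivAt (position v) (v t) t :=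
  (hv.integral_hasStrictDerivAt 0 t).hasDerivAt

theorem position_continuous (hv : Continuous v) : Continuous (position v) :=
  continuous_primitive hv

theorem position_contDiff (hv : Continuous v) : ContDiff ℝ 1 (position v) :=
  contDiff_one_iff_deriv.2 ⟨fun t => (position_hasDerivAt hv t).differentiableAt, by
    rwa [funext fun t => (position_hasDerivAt hv t).deriv]⟩

theorem position_congr {t : ℝ} (ht : 0 ≤ t) (h : ∀ s ∈ Icc 0 t, v s = w s) :
    position v t = position w t :=
  intervalIntegral.integral_congr fun s hs => h s (by rwa [uIcc_of_le ht] at hs)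

theorem abs_position_sub_le (hv : Continuous v) (hw : Continuous w) {t A : ℝ}
    (ht : 0 ≤ t) (h : ∀ s ∈ Icc 0 t, |v s - w s| ≤ A) :
    |position v t - position w t| ≤ A * t := by
  rw [position, position, ← intervalIntegral.integral_sub (hv.intervalIntegrable _ _)
    (hw.intervalIntegrable _ _)]
  refine (intervalIntegral.norm_integral_le_of_norm_le_const (C := A)
    (f := fun s => v s - w s) fun s hs => ?_).trans_eq (by rw [sub_zero, abs_of_nonneg ht])
  rw [uIoc_of_le ht] at hs
  exact h s ⟨hs.1.le, hs.2⟩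

theorem velocity_position (hv : Continuous v) {t : ℝ} (ht : 0 ≤ t) :
    velocity (position v) t = v t :=
  (position_hasDerivAt hv t).hasDerivWithinAt.derivWithin (uniqueDiffOn_Ici 0 t ht)

variable {a : ℝ → ℝ} {v₀ : ℝ}

theorem iteratedDeriv_two_position (hv : Continuous v) (ha : Continuous a)
    (hva : ∀ t, 0 ≤ t → v t = v₀ + ∫ s in (0 : ℝ)..t, a s) {t : ℝ} (ht : 0 < t) :
    iteratedDeriv 2 (position v) t = a t := by
  have hv_eq : v =ᶠ[𝓝 t] fun t => v₀ + position a t := by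
    filter_upwards [lt_mem_nhds ht] with s hs using hva s hs.le
  rw [iteratedDeriv_succ, iteratedDeriv_one, funext fun t => (position_hasDerivAt hv t).deriv,
    hv_eq.deriv_eq, ((position_hasDerivAt ha t).const_add v₀).deriv]

theorem isTrajectory_position (hv : Continuous v) (ha : Continuous a)
    (hva : ∀ t, 0 ≤ t → v t = v₀ + ∫ s in (0 : ℝ)..t, a s) : IsTrajectory v₀ (position v) where
  contDiffOn := by
    rw [show (2 : ℕ∞ω) = 1 + 1 by norm_num, contDiffOn_succ_iff_derivWithin (uniqueDiffOn_Ici 0)]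
    exact ⟨fun t _ => (position_hasDerivAt hv t).differentiableAt.differentiableWithinAt, by simp,
      (contDiff_const.add (position_contDiff ha)).contDiffOn.congr
        fun t ht => (velocity_position hv ht).trans (hva t ht)⟩
  position_zero := intervalIntegral.integral_same
  velocity_zero := by
    rw [velocity_position hv le_rfl, hva 0 le_rfl, intervalIntegral.integral_same, add_zero]

end

/-- The velocity of a trajectory on `[0, ∞)`, extended by its initial value to negative times, so
that it is continuous on `ℝ`. -/
def extendedVelocity (y : ℝ → ℝ) (t : ℝ) : ℝ := velocity y (max t 0)

theorem extendedVelocity_of_nonneg (y : ℝ → ℝ) {t : ℝ} (ht : 0 ≤ t) :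
    extendedVelocity y t = velocity y t := by
  rw [extendedVelocity, max_eq_left ht]

namespace IsTrajectory

variable {v₀ : ℝ} {y : ℝ → ℝ}

theorem velocity_contDiffOn (h : IsTrajectory v₀ y) : ContDiffOn ℝ 1 (velocity y) (Ici 0) := by
  have hy := h.contDiffOn
  rw [show (2 : ℕ∞ω) = 1 + 1 by norm_num,
    contDiffOn_succ_iff_derivWithin (uniqueDiffOn_Ici 0)] at hy
  exact hy.2.2

theorem extendedVelocity_continuous (h : IsTrajectory v₀ y) : Continuous (extendedVelocity y) :=
  continuous_comp_max h.velocity_contDiffOn.continuousOn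

theorem hasDerivAt (h : IsTrajectory v₀ y) {t : ℝ} (ht : 0 < t) :
    HasDerivAt y (velocity y t) t :=
  ((h.contDiffOn.differentiableOn (by norm_num)) t ht.le).hasDerivWithinAt.hasDerivAt
    (Ici_mem_nhds ht)

theorem hasDerivAt_velocity (h : IsTrajectory v₀ y) {t : ℝ} (ht : 0 < t) :
    HasDerivAt (velocity y) (iteratedDeriv 2 y t) t := by
  have hdiff := ((h.velocity_contDiffOn.differentiableOn (by norm_num)) t
    ht.le).differentiableAt (Ici_mem_nhds ht)
  refine hdiff.hasDerivAt.congr_deriv ?_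
  rw [iteratedDeriv_succ, iteratedDeriv_one]
  refine EventuallyEq.deriv_eq ?_
  filter_upwards [lt_mem_nhds ht] with s hs using (h.hasDerivAt hs).deriv.symm

theorem eq_position (h : IsTrajectory v₀ y) {t : ℝ} (ht : 0 ≤ t) :
    y t = position (extendedVelocity y) t := by
  rw [position_congr ht fun s hs => extendedVelocity_of_nonneg y hs.1, position,
    intervalIntegral.integral_eq_sub_of_hasDerivAt_of_le ht
      (h.contDiffOn.continuousOn.mono Icc_subset_Ici_self) (fun s hs => h.hasDerivAt hs.1)
      ((h.velocity_contDiffOn.continuousOn.mono Icc_subset_Ici_self).intervalIntegrable_of_Icc ht),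
    h.position_zero, sub_zero]

theorem velocity_eq_integral {a : ℝ → ℝ} (h : IsTrajectory v₀ y)
    (ha : ContinuousOn a (Ici 0)) (hya : ∀ t, 0 < t → iteratedDeriv 2 y t = a t) {t : ℝ}
    (ht : 0 ≤ t) : velocity y t = v₀ + ∫ s in (0 : ℝ)..t, a s := by
  rw [intervalIntegral.integral_eq_sub_of_hasDerivAt_of_le ht
      (h.velocity_contDiffOn.continuousOn.mono Icc_subset_Ici_self)
      (fun s hs => (h.hasDerivAt_velocity hs.1).congr_deriv (hya s hs.1))
      ((ha.mono Icc_subset_Ici_self).intervalIntegrable_of_Icc ht),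
    h.velocity_zero, add_sub_cancel]

end IsTrajectory

/-! ### The smeared system -/

/-- The acceleration at time `t` of a particle with velocity `v` under the field that it has itself
emitted, for the force kernel `g` and the coupling `b`. -/
def selfAcceleration (b c : ℝ) (g : ℝ → ℝ) (v : ℝ → ℝ) (t : ℝ) : ℝ :=
  b * retardedField g c (position v) (position v t) t

theorem abs_retardedField_sub_le {g : ℝ → ℝ} {L : NNReal} (hg : LipschitzWith L g) {y z : ℝ → ℝ}
    (hy : Continuous y) (hz : Continuous z) (c : ℝ) {t D η ζ : ℝ} (ht : 0 ≤ t)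
    (h : ∀ s ∈ Icc 0 t, |(η - y s) - (ζ - z s)| ≤ D) :
    |retardedField g c y η t - retardedField g c z ζ t| ≤ 2 * L * D * t := by
  have hgc := hg.continuous
  rw [retardedField, retardedField, ← intervalIntegral.integral_sub
    ((by fun_prop : Continuous _).intervalIntegrable _ _)
    ((by fun_prop : Continuous _).intervalIntegrable _ _)]
  refine (intervalIntegral.norm_integral_le_of_norm_le_const (C := 2 * L * D)
    (f := fun s => (g (η - y s + c * (t - s)) - g (η - y s - c * (t - s))) -
      (g (ζ - z s + c * (t - s)) - g (ζ - z s - c * (t - s)))) fun s hs => ?_).trans_eq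
    (by rw [sub_zero, abs_of_nonneg ht])
  rw [uIoc_of_le ht] at hs
  have hshift : ∀ r, |g (η - y s + r) - g (ζ - z s + r)| ≤ L * D := fun r =>
    (hg.dist_le_mul _ _).trans (by
      rw [Real.dist_eq, add_sub_add_right_eq_sub]
      gcongr
      exact h s ⟨hs.1.le, hs.2⟩)
  rw [Real.norm_eq_abs, sub_sub_sub_comm]
  refine (abs_sub _ _).trans ?_
  have hadv := hshift (c * (t - s))
  have hret := hshift (-(c * (t - s)))
  simp only [← sub_eq_add_neg] at hret
  linarith

theorem selfAcceleration_causalLipschitz (b c : ℝ) {g : ℝ → ℝ} {L : NNReal}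
    (hg : LipschitzWith L g) : CausalLipschitz (selfAcceleration b c g) where
  continuous v hv := continuous_const.mul ((retardedField_continuous hg.continuous
    (position_continuous hv) c).comp ((position_continuous hv).prodMk continuous_id))
  lipschitz T := by
    refine ⟨|b| * (4 * L * T ^ 2), by positivity, fun v w hv hw t ht A hA => ?_⟩
    have hA0 : 0 ≤ A := (abs_nonneg _).trans (hA 0 ⟨le_rfl, ht.1⟩)
    have hpos : ∀ s ∈ Icc 0 t, |position v s - position w s| ≤ A * t := fun s hs =>
      (abs_position_sub_le hv hw hs.1 fun r hr => hA r ⟨hr.1, hr.2.trans hs.2⟩).trans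
        (by gcongr; exact hs.2)
    rw [selfAcceleration, selfAcceleration, ← mul_sub, abs_mul, mul_assoc]
    gcongr
    calc _ ≤ 2 * L * (2 * (A * t)) * t := by
          refine abs_retardedField_sub_le hg (position_continuous hv) (position_continuous hw) c
            ht.1 fun s hs => ?_
          rw [sub_sub_sub_comm, two_mul]
          exact (abs_sub _ _).trans (add_le_add (hpos t ⟨ht.1, le_rfl⟩) (hpos s hs))
      _ = 4 * L * t ^ 2 * A := by ring
      _ ≤ 4 * L * T ^ 2 * A := by
          have := ht.1
          gcongr
          exact ht.2

theorem selfAcceleration_gaussianDelta_causalLipschitz (b c : ℝ) {ε : ℝ} (hε : 0 < ε) :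
    CausalLipschitz (selfAcceleration b c (gaussianDelta ε)) :=
  selfAcceleration_causalLipschitz b c (gaussianDelta_lipschitzWith hε)

namespace IsSmoothSolution

variable {m c β v₀ σ : ℝ} {φ φ₁ φ₂ : ℝ → ℝ → ℝ} {y y₁ y₂ : ℝ → ℝ}

theorem newton_eq (hm : 0 < m) (hc : 0 < c) (hσ : 0 < σ)
    (h : IsSmoothSolution m c β v₀ (gaussianDelta σ) φ y) {t : ℝ} (ht : 0 < t) :
    iteratedDeriv 2 y t = selfAcceleration (β ^ 2 / (2 * c * m)) c
      (gaussianDelta (√2 * σ)) (extendedVelocity y) t := by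
  have hfield : (fun x => φ x t) = fun x =>
      β / (2 * c) * retardedField (smoothStep σ) c (position (extendedVelocity y)) x t := by
    funext x
    rw [h.field_eq hc x ht.le,
      retardedField_congr ht.le (fun s hs => h.trajectory.eq_position hs.1)]
  have hforce := h.newton t ht
  rw [hfield] at hforce
  have hforce_eq := hforce.2.unique (hasForce_smoothStep hσ
    (position_continuous h.trajectory.extendedVelocity_continuous) c β _ (y t) ht.le).2
  rw [selfAcceleration, ← h.trajectory.eq_position ht.le]
  field_simp at hforce_eq ⊢
  linarith

theorem velocity_eq (hm : 0 < m) (hc : 0 < c) (hσ : 0 < σ)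
    (h : IsSmoothSolution m c β v₀ (gaussianDelta σ) φ y) {t : ℝ} (ht : 0 ≤ t) :
    extendedVelocity y t = v₀ + ∫ s in (0 : ℝ)..t, selfAcceleration (β ^ 2 / (2 * c * m)) c
      (gaussianDelta (√2 * σ)) (extendedVelocity y) s := by
  rw [extendedVelocity_of_nonneg y ht]
  exact h.trajectory.velocity_eq_integral ((selfAcceleration_gaussianDelta_causalLipschitz _ c
    (by positivity)).continuous _ h.trajectory.extendedVelocity_continuous).continuousOn
      (fun t ht => h.newton_eq hm hc hσ ht) ht

theorem unique (hm : 0 < m) (hc : 0 < c) (hσ : 0 < σ)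
    (h₁ : IsSmoothSolution m c β v₀ (gaussianDelta σ) φ₁ y₁)
    (h₂ : IsSmoothSolution m c β v₀ (gaussianDelta σ) φ₂ y₂) {t : ℝ} (ht : 0 ≤ t) :
    y₁ t = y₂ t ∧ ∀ x, φ₁ x t = φ₂ x t := by
  have hvel : ∀ t, 0 ≤ t → extendedVelocity y₁ t = extendedVelocity y₂ t := fun t ht =>
    (selfAcceleration_gaussianDelta_causalLipschitz _ c (by positivity)).unique
      h₁.trajectory.extendedVelocity_continuous h₂.trajectory.extendedVelocity_continuous
      (fun t ht => h₁.velocity_eq hm hc hσ ht) (fun t ht => h₂.velocity_eq hm hc hσ ht) ht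
  have hy : ∀ t, 0 ≤ t → y₁ t = y₂ t := fun t ht => by
    rw [h₁.trajectory.eq_position ht, h₂.trajectory.eq_position ht]
    exact position_congr ht fun s hs => hvel s hs.1
  refine ⟨hy t ht, fun x => ?_⟩
  rw [h₁.field_eq hc x ht, h₂.field_eq hc x ht, retardedField_congr ht fun s hs => hy s hs.1]

end IsSmoothSolution

theorem isSmoothSolution_retardedField {m c β v₀ σ : ℝ} (hm : 0 < m) (hc : 0 < c) (hσ : 0 < σ)
    {v : ℝ → ℝ} (hv : Continuous v) (hve : ∀ t, 0 ≤ t → v t = v₀ + ∫ s in (0 : ℝ)..t,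
      selfAcceleration (β ^ 2 / (2 * c * m)) c (gaussianDelta (√2 * σ)) v s) :
    IsSmoothSolution m c β v₀ (gaussianDelta σ)
      (fun x t => β / (2 * c) * retardedField (smoothStep σ) c (position v) x t)
      (position v) := by
  have hac := (selfAcceleration_gaussianDelta_causalLipschitz (β ^ 2 / (2 * c * m)) c
    (by positivity : 0 < √2 * σ)).continuous v hv
  have hy := position_continuous hv
  have hC2 := retardedField_smoothStep_contDiff_two hσ (position_contDiff hv) c
  refine ⟨(contDiff_const.mul hC2).contDiffOn, fun x => by simp [retardedField_zero],
    fun x => ?_, fun x t _ => ?_, isTrajectory_position hv hac hve, fun t ht => ?_⟩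
  · rw [((retardedField_smoothStep_hasDerivAt_time_zero hσ hy c x).const_mul
      (β / (2 * c))).hasDerivWithinAt.derivWithin (uniqueDiffOn_Ici 0 0 self_mem_Ici), mul_zero]
  · have htime : ContDiff ℝ 2 fun s => retardedField (smoothStep σ) c (position v) x s :=
      hC2.comp (by fun_prop : ContDiff ℝ 2 fun s : ℝ => (x, s))
    have hspace : ContDiff ℝ 2 fun z => retardedField (smoothStep σ) c (position v) z t :=
      hC2.comp (by fun_prop : ContDiff ℝ 2 fun z : ℝ => (z, t))
    rw [iteratedDeriv_const_mul _ htime.contDiffAt, iteratedDeriv_const_mul _ hspace.contDiffAt,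
      retardedField_smoothStep_wave hσ hy]
    field_simp
  · rw [iteratedDeriv_two_position hv hac hve ht]
    convert hasForce_smoothStep hσ hy c β (β / (2 * c)) (position v t) ht.le using 1
    rw [selfAcceleration]
    field_simp

theorem exists_isSmoothSolution {m c : ℝ} (β v₀ : ℝ) {σ : ℝ} (hm : 0 < m) (hc : 0 < c)
    (hσ : 0 < σ) : ∃ (φ : ℝ → ℝ → ℝ) (y : ℝ → ℝ),
      IsSmoothSolution m c β v₀ (gaussianDelta σ) φ y := by
  obtain ⟨v, hv, hve⟩ := (selfAcceleration_gaussianDelta_causalLipschitz (β ^ 2 / (2 * c * m)) c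
    (by positivity : 0 < √2 * σ)).exists_solution v₀
  exact ⟨_, _, isSmoothSolution_retardedField hm hc hσ hv hve⟩

/-! ### Estimates along subsonic trajectories -/

section Subsonic

variable {k k' : ℝ → ℝ} {δ t : ℝ}

theorem integral_comp_le_of_deriv_ge (hk : ∀ s, HasDerivAt k (k' s) s) (hk' : Continuous k')
    (hδ : 0 < δ) (ht : 0 ≤ t) (hge : ∀ s ∈ Icc 0 t, δ ≤ k' s) {f F : ℝ → ℝ} (hf : Continuous f)
    (hf0 : ∀ r, 0 ≤ f r) (hF : ∀ r, HasDerivAt F (f r) r) :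
    ∫ s in (0 : ℝ)..t, f (k s) ≤ (F (k t) - F (k 0)) / δ := by
  have hkc : Continuous k := continuous_iff_continuousAt.2 fun s => (hk s).continuousAt
  have hftc : ∫ s in (0 : ℝ)..t, f (k s) * k' s = F (k t) - F (k 0) :=
    intervalIntegral.integral_eq_sub_of_hasDerivAt (f := fun s => F (k s))
      (fun s _ => (hF (k s)).comp s (hk s)) (Continuous.intervalIntegrable (by fun_prop) _ _)
  rw [← hftc, le_div_iff₀ hδ, ← intervalIntegral.integral_mul_const]
  exact intervalIntegral.integral_mono_on ht (Continuous.intervalIntegrable (by fun_prop) _ _)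
    (Continuous.intervalIntegrable (by fun_prop) _ _)
    fun s hs => mul_le_mul_of_nonneg_left (hge s hs) (hf0 _)

theorem integral_gaussianDelta_comp_le (hk : ∀ s, HasDerivAt k (k' s) s) (hk' : Continuous k')
    (hδ : 0 < δ) (ht : 0 ≤ t) (hge : ∀ s ∈ Icc 0 t, δ ≤ k' s) {σ : ℝ} (hσ : 0 < σ) :
    ∫ s in (0 : ℝ)..t, gaussianDelta σ (k s) ≤ 1 / δ := by
  refine (integral_comp_le_of_deriv_ge hk hk' hδ ht hge (gaussianDelta_continuous σ)
    (fun r => (gaussianDelta_pos hσ r).le) (smoothStep_hasDerivAt σ)).trans ?_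
  gcongr
  linarith [(abs_le.1 (abs_smoothStep_le hσ (k t))).2, (abs_le.1 (abs_smoothStep_le hσ (k 0))).1]

theorem abs_integral_smoothStep_sub_integral_sharpStep_le (hk : ∀ s, HasDerivAt k (k' s) s)
    (hk' : Continuous k') (hδ : 0 < δ) (ht : 0 ≤ t) (hge : ∀ s ∈ Icc 0 t, δ ≤ k' s) {σ : ℝ}
    (hσ : 0 < σ) :
    |(∫ s in (0 : ℝ)..t, smoothStep σ (k s)) - ∫ s in (0 : ℝ)..t, sharpStep (k s)| ≤
      2 * σ / δ := by
  have hkc : Continuous k := continuous_iff_continuousAt.2 fun s => (hk s).continuousAt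
  rw [← intervalIntegral.integral_sub (Continuous.intervalIntegrable (by fun_prop) _ _)
    (intervalIntegrable_comp_of_bounded sharpStep_measurable abs_sharpStep_le hkc _ _),
    ← Real.norm_eq_abs]
  calc ‖∫ s in (0 : ℝ)..t, (smoothStep σ (k s) - sharpStep (k s))‖
      ≤ ∫ s in (0 : ℝ)..t, 2 * σ * gaussianDelta σ (k s) :=
        intervalIntegral.norm_integral_le_of_norm_le ht
          (Eventually.of_forall fun s _ => abs_smoothStep_sub_sharpStep_le hσ (k s))
          (Continuous.intervalIntegrable (by fun_prop) _ _)
    _ = 2 * σ * ∫ s in (0 : ℝ)..t, gaussianDelta σ (k s) :=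
        intervalIntegral.integral_const_mul _ _
    _ ≤ 2 * σ * (1 / δ) := by
        gcongr
        exact integral_gaussianDelta_comp_le hk hk' hδ ht hge hσ
    _ = 2 * σ / δ := mul_one_div _ _

theorem abs_integral_smoothStep_sub_add_le {σ ε : ℝ} (hσ : 0 < σ) (hε : 0 ≤ ε) (r : ℝ) :
    |∫ x in (r - ε)..(r + ε), smoothStep σ x| ≤ ε := by
  have h := intervalIntegral.norm_integral_le_of_norm_le_const (a := r - ε) (b := r + ε)
    (f := smoothStep σ) (C := 1 / 2) fun s _ => abs_smoothStep_le hσ s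
  rw [add_sub_sub_cancel, abs_of_nonneg (by positivity), Real.norm_eq_abs] at h
  linarith

theorem integral_smoothStep_band_le (hk : ∀ s, HasDerivAt k (k' s) s) (hk' : Continuous k')
    (hδ : 0 < δ) (ht : 0 ≤ t) (hge : ∀ s ∈ Icc 0 t, δ ≤ k' s) {σ ε : ℝ} (hσ : 0 < σ)
    (hε : 0 ≤ ε) :
    ∫ s in (0 : ℝ)..t, (smoothStep σ (k s + ε) - smoothStep σ (k s - ε)) ≤ 2 * ε / δ := by
  have hG := smoothStep_continuous σ
  have hP (r : ℝ) : HasDerivAt (fun r => ∫ x in (0 : ℝ)..r, smoothStep σ x) (smoothStep σ r) r :=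
    (hG.integral_hasStrictDerivAt 0 r).hasDerivAt
  have hband (r : ℝ) : HasDerivAt (fun r => ∫ x in (r - ε)..(r + ε), smoothStep σ x)
      (smoothStep σ (r + ε) - smoothStep σ (r - ε)) r := by
    refine (((hP _).comp_add_const r ε).sub ((hP _).comp_sub_const r ε)).congr_of_eventuallyEq ?_
    exact Eventually.of_forall fun r => (intervalIntegral.integral_interval_sub_left
      (hG.intervalIntegrable _ _) (hG.intervalIntegrable _ _)).symm
  refine (integral_comp_le_of_deriv_ge hk hk' hδ ht hge (by fun_prop)
    (fun r => sub_nonneg.2 (smoothStep_mono hσ (by linarith))) hband).trans ?_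
  gcongr
  linarith [(abs_le.1 (abs_integral_smoothStep_sub_add_le hσ hε (k t))).2,
    (abs_le.1 (abs_integral_smoothStep_sub_add_le hσ hε (k 0))).1]

theorem abs_smoothStep_sub_le {σ : ℝ} (hσ : 0 < σ) {r r' ε : ℝ} (h : |r' - r| ≤ ε) :
    |smoothStep σ r' - smoothStep σ r| ≤ smoothStep σ (r + ε) - smoothStep σ (r - ε) := by
  have hmono := smoothStep_mono hσ
  have hε : 0 ≤ ε := (abs_nonneg _).trans h
  obtain ⟨hl, hu⟩ := abs_le.1 h
  exact abs_sub_le_of_le_of_le (hmono (by linarith)) (hmono (by linarith))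
    (hmono (by linarith)) (hmono (by linarith))

theorem abs_integral_smoothStep_comp_sub_le (hk : ∀ s, HasDerivAt k (k' s) s)
    (hk' : Continuous k') (hδ : 0 < δ) (ht : 0 ≤ t) (hge : ∀ s ∈ Icc 0 t, δ ≤ k' s) {σ ε : ℝ}
    (hσ : 0 < σ) {κ : ℝ → ℝ} (hκ : Continuous κ) (hε : ∀ s ∈ Icc 0 t, |κ s - k s| ≤ ε) :
    |(∫ s in (0 : ℝ)..t, smoothStep σ (κ s)) - ∫ s in (0 : ℝ)..t, smoothStep σ (k s)| ≤
      2 * ε / δ := by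
  have hkc : Continuous k := continuous_iff_continuousAt.2 fun s => (hk s).continuousAt
  have hε0 : 0 ≤ ε := (abs_nonneg _).trans (hε 0 ⟨le_rfl, ht⟩)
  rw [← intervalIntegral.integral_sub (Continuous.intervalIntegrable (by fun_prop) _ _)
    (Continuous.intervalIntegrable (by fun_prop) _ _)]
  refine le_trans ?_ (integral_smoothStep_band_le hk hk' hδ ht hge hσ hε0)
  exact intervalIntegral.norm_integral_le_of_norm_le
    (f := fun s => smoothStep σ (κ s) - smoothStep σ (k s)) ht
    (Eventually.of_forall fun s hs => abs_smoothStep_sub_le hσ (hε s (Ioc_subset_Icc_self hs)))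
    (Continuous.intervalIntegrable (by fun_prop) _ _)

theorem mul_sub_le_neg_of_deriv_ge (hk : ∀ s, HasDerivAt k (k' s) s)
    (hge : ∀ s ∈ Icc 0 t, δ ≤ k' s) (hkt : k t = 0) {s : ℝ} (hs : s ∈ Icc 0 t) :
    δ * (t - s) ≤ -k s := by
  have hkc : Continuous k := continuous_iff_continuousAt.2 fun s => (hk s).continuousAt
  have h := (convex_Icc 0 t).mul_sub_le_image_sub_of_le_deriv hkc.continuousOn
    (fun r _ => (hk r).differentiableAt.differentiableWithinAt)
    (fun r hr => (hge r (interior_subset hr)).trans_eq (hk r).deriv.symm) s hs t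
    ⟨hs.1.trans hs.2, le_rfl⟩ hs.2
  rwa [hkt, zero_sub] at h

theorem abs_integral_gaussianDelta_comp_mul_le (hk : ∀ s, HasDerivAt k (k' s) s)
    (hk' : Continuous k') (hδ : 0 < δ) (ht : 0 ≤ t) (hge : ∀ s ∈ Icc 0 t, δ ≤ k' s)
    (hkt : k t = 0) {A : ℝ} (hA0 : 0 ≤ A) {f : ℝ → ℝ} (hA : ∀ s ∈ Icc 0 t, |f s| ≤ A * (t - s))
    {ε : ℝ} (hε : 0 < ε) :
    |∫ s in (0 : ℝ)..t, gaussianDelta ε (k s) * f s| ≤ 2 * ε * A / δ ^ 2 := by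
  have hkc : Continuous k := continuous_iff_continuousAt.2 fun s => (hk s).continuousAt
  have hpt : ∀ s ∈ Ioc 0 t, ‖gaussianDelta ε (k s) * f s‖ ≤
      2 * ε * A / δ * gaussianDelta (√2 * ε) (k s) := by
    intro s hs
    have hs' := Ioc_subset_Icc_self hs
    have hg := (gaussianDelta_pos hε (k s)).le
    have hdist : t - s ≤ |k s| / δ := by
      rw [le_div_iff₀' hδ]
      exact (mul_sub_le_neg_of_deriv_ge hk hge hkt hs').trans (neg_le_abs _)
    rw [Real.norm_eq_abs, abs_mul, abs_of_nonneg hg]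
    calc gaussianDelta ε (k s) * |f s|
        ≤ gaussianDelta ε (k s) * (A * (|k s| / δ)) := by
          gcongr
          exact (hA s hs').trans (by gcongr)
      _ = A / δ * (|k s| * gaussianDelta ε (k s)) := by ring
      _ ≤ A / δ * (2 * ε * gaussianDelta (√2 * ε) (k s)) :=
          mul_le_mul_of_nonneg_left (abs_mul_gaussianDelta_le hε (k s)) (by positivity)
      _ = 2 * ε * A / δ * gaussianDelta (√2 * ε) (k s) := by ring
  rw [← Real.norm_eq_abs]
  calc ‖∫ s in (0 : ℝ)..t, gaussianDelta ε (k s) * f s‖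
      ≤ ∫ s in (0 : ℝ)..t, 2 * ε * A / δ * gaussianDelta (√2 * ε) (k s) :=
        intervalIntegral.norm_integral_le_of_norm_le ht (Eventually.of_forall hpt)
          (Continuous.intervalIntegrable (by fun_prop) _ _)
    _ = 2 * ε * A / δ * ∫ s in (0 : ℝ)..t, gaussianDelta (√2 * ε) (k s) :=
        intervalIntegral.integral_const_mul _ _
    _ ≤ 2 * ε * A / δ * (1 / δ) := by
        gcongr
        exact integral_gaussianDelta_comp_le hk hk' hδ ht hge (by positivity)
    _ = 2 * ε * A / δ ^ 2 := by field_simp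

theorem mul_integral_gaussianDelta_comp (hk : ∀ s, HasDerivAt k (k' s) s) (hk' : Continuous k')
    (hkt : k t = 0) (ε : ℝ) :
    k' t * ∫ s in (0 : ℝ)..t, gaussianDelta ε (k s) =
      (∫ s in (0 : ℝ)..t, gaussianDelta ε (k s) * (k' t - k' s)) + smoothStep ε (-k 0) := by
  have hkc : Continuous k := continuous_iff_continuousAt.2 fun s => (hk s).continuousAt
  have hftc : ∫ s in (0 : ℝ)..t, gaussianDelta ε (k s) * k' s = smoothStep ε (-k 0) := by
    rw [smoothStep_neg, ← zero_sub, ← smoothStep_zero ε, ← hkt]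
    exact intervalIntegral.integral_eq_sub_of_hasDerivAt (f := fun s => smoothStep ε (k s))
      (fun s _ => (smoothStep_hasDerivAt ε (k s)).comp s (hk s))
      (Continuous.intervalIntegrable (by fun_prop) _ _)
  rw [← hftc, ← intervalIntegral.integral_const_mul, ← intervalIntegral.integral_add
    (Continuous.intervalIntegrable (by fun_prop) _ _)
    (Continuous.intervalIntegrable (by fun_prop) _ _)]
  congr 1
  ring_nf

theorem abs_integral_gaussianDelta_comp_sub_le (hk : ∀ s, HasDerivAt k (k' s) s)
    (hk' : Continuous k') (hδ : 0 < δ) (ht : 0 ≤ t) (hge : ∀ s ∈ Icc 0 t, δ ≤ k' s)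
    (hkt : k t = 0) {A : ℝ} (hA0 : 0 ≤ A) (hA : ∀ s ∈ Icc 0 t, |k' t - k' s| ≤ A * (t - s))
    {ε : ℝ} (hε : 0 < ε) :
    |(∫ s in (0 : ℝ)..t, gaussianDelta ε (k s)) - 1 / (2 * k' t)| ≤
      2 * ε / δ * (A / δ ^ 2 + gaussianDelta ε (k 0)) := by
  have hk't : δ ≤ k' t := hge t ⟨ht, le_rfl⟩
  have hk't0 : 0 < k' t := hδ.trans_le hk't
  have hg := gaussianDelta_pos hε (k 0)
  have hmean := abs_integral_gaussianDelta_comp_mul_le hk hk' hδ ht hge hkt hA0 hA hε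
  have htail : |smoothStep ε (-k 0) - 1 / 2| ≤ 2 * ε * gaussianDelta ε (k 0) := by
    have hk0 := mul_sub_le_neg_of_deriv_ge hk hge hkt (left_mem_Icc.2 ht)
    rw [abs_sub_comm, abs_of_nonneg (sub_nonneg.2 (smoothStep_le_half hε _)),
      ← gaussianDelta_neg ε (k 0)]
    exact half_sub_smoothStep_le hε ((mul_nonneg hδ.le (by linarith)).trans hk0)
  rw [show (∫ s in (0 : ℝ)..t, gaussianDelta ε (k s)) - 1 / (2 * k' t) =
      (k' t * (∫ s in (0 : ℝ)..t, gaussianDelta ε (k s)) - 1 / 2) / k' t by field_simp,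
    mul_integral_gaussianDelta_comp hk hk' hkt, add_sub_assoc, abs_div, abs_of_pos hk't0]
  calc _ ≤ (2 * ε * A / δ ^ 2 + 2 * ε * gaussianDelta ε (k 0)) / δ := by
        gcongr
        exact (abs_add_le _ _).trans (add_le_add hmean htail)
    _ = _ := by ring

end Subsonic

theorem retardedField_gaussianDelta_eq {y : ℝ → ℝ} (hy : Continuous y) (σ c x t : ℝ) :
    retardedField (gaussianDelta σ) c y x t =
      (∫ s in (0 : ℝ)..t, gaussianDelta σ (-(x - y s + c * (t - s)))) -
        ∫ s in (0 : ℝ)..t, gaussianDelta σ (x - y s - c * (t - s)) := by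
  rw [← intervalIntegral.integral_sub (Continuous.intervalIntegrable (by fun_prop) _ _)
    (Continuous.intervalIntegrable (by fun_prop) _ _)]
  simp only [gaussianDelta_neg, retardedField]

theorem retardedField_eq_of_odd {K y : ℝ → ℝ} {C : ℝ} (hKm : Measurable K)
    (hKC : ∀ r, |K r| ≤ C) (hodd : ∀ r, K (-r) = -K r) (hy : Continuous y) (c x t : ℝ) :
    retardedField K c y x t = -((∫ s in (0 : ℝ)..t, K (-(x - y s + c * (t - s)))) +
      ∫ s in (0 : ℝ)..t, K (x - y s - c * (t - s))) := by
  rw [← intervalIntegral.integral_add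
    (intervalIntegrable_comp_of_bounded hKm hKC (by fun_prop) _ _)
    (intervalIntegrable_comp_of_bounded hKm hKC (by fun_prop) _ _), retardedField,
    ← intervalIntegral.integral_neg]
  simp only [hodd (_ + _)]
  simp only [neg_add, neg_neg, ← sub_eq_add_neg]

section Trajectory

variable {v : ℝ → ℝ} {c K t : ℝ}

theorem position_zero (v : ℝ → ℝ) : position v 0 = 0 := intervalIntegral.integral_same

theorem hasDerivAt_retarded_add (hv : Continuous v) (c x t s : ℝ) :
    HasDerivAt (fun s => -(x - position v s + c * (t - s))) (c + v s) s :=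
  (((position_hasDerivAt hv s).const_sub x).add
    (((hasDerivAt_id s).const_sub t).const_mul c)).neg.congr_deriv (by ring)

theorem hasDerivAt_retarded_sub (hv : Continuous v) (c x t s : ℝ) :
    HasDerivAt (fun s => x - position v s - c * (t - s)) (c - v s) s :=
  (((position_hasDerivAt hv s).const_sub x).sub
    (((hasDerivAt_id s).const_sub t).const_mul c)).congr_deriv (by ring)

theorem sub_le_add_of_abs_le (hK : ∀ s ∈ Icc 0 t, |v s| ≤ K) (c : ℝ) :
    ∀ s ∈ Icc 0 t, c - K ≤ c + v s := fun s hs => by linarith [neg_abs_le (v s), hK s hs]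

theorem sub_le_sub_of_abs_le (hK : ∀ s ∈ Icc 0 t, |v s| ≤ K) (c : ℝ) :
    ∀ s ∈ Icc 0 t, c - K ≤ c - v s := fun s hs => by linarith [le_abs_self (v s), hK s hs]

theorem integral_gaussianDelta_retarded_add_le (hv : Continuous v) (hKc : K < c) (ht : 0 ≤ t)
    (hK : ∀ s ∈ Icc 0 t, |v s| ≤ K) {σ : ℝ} (hσ : 0 < σ) (x r : ℝ) :
    ∫ s in (0 : ℝ)..t, gaussianDelta σ (-(x - position v s + c * (r - s))) ≤ 1 / (c - K) :=
  integral_gaussianDelta_comp_le (hasDerivAt_retarded_add hv c x r) (by fun_prop)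
    (sub_pos.2 hKc) ht (sub_le_add_of_abs_le hK c) hσ

theorem integral_gaussianDelta_retarded_sub_le (hv : Continuous v) (hKc : K < c) (ht : 0 ≤ t)
    (hK : ∀ s ∈ Icc 0 t, |v s| ≤ K) {σ : ℝ} (hσ : 0 < σ) (x r : ℝ) :
    ∫ s in (0 : ℝ)..t, gaussianDelta σ (x - position v s - c * (r - s)) ≤ 1 / (c - K) :=
  integral_gaussianDelta_comp_le (hasDerivAt_retarded_sub hv c x r) (by fun_prop)
    (sub_pos.2 hKc) ht (sub_le_sub_of_abs_le hK c) hσ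

theorem abs_retardedField_gaussianDelta_le (hv : Continuous v) (hKc : K < c) (ht : 0 ≤ t)
    (hK : ∀ s ∈ Icc 0 t, |v s| ≤ K) {σ : ℝ} (hσ : 0 < σ) (x : ℝ) :
    |retardedField (gaussianDelta σ) c (position v) x t| ≤ 1 / (c - K) := by
  rw [retardedField_gaussianDelta_eq (position_continuous hv)]
  refine abs_sub_le_of_nonneg_of_le ?_ (integral_gaussianDelta_retarded_add_le hv hKc ht hK hσ x t)
    ?_ (integral_gaussianDelta_retarded_sub_le hv hKc ht hK hσ x t) <;>
  exact intervalIntegral.integral_nonneg ht fun s _ => (gaussianDelta_pos hσ _).le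

/-- The slope of the field of a point source at its position, averaged over both sides, in units
of `β / (2 c)`. -/
def meanSlope (c v : ℝ) : ℝ := 1 / (2 * (c + v)) - 1 / (2 * (c - v))

theorem abs_retardedField_sub_meanSlope_le (hv : Continuous v) (hKc : K < c) (ht : 0 ≤ t)
    (hK : ∀ s ∈ Icc 0 t, |v s| ≤ K) {A : ℝ} (hA : ∀ s ∈ Icc 0 t, |v t - v s| ≤ A * (t - s))
    (hA0 : 0 ≤ A) {ε : ℝ} (hε : 0 < ε) :
    |retardedField (gaussianDelta ε) c (position v) (position v t) t - meanSlope c (v t)| ≤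
      2 * ε / (c - K) * (2 * A / (c - K) ^ 2 + gaussianDelta ε (position v t + c * t) +
        gaussianDelta ε (position v t - c * t)) := by
  have hadd := abs_integral_gaussianDelta_comp_sub_le
    (hasDerivAt_retarded_add hv c (position v t) t) (by fun_prop) (sub_pos.2 hKc) ht
    (sub_le_add_of_abs_le hK c) (by ring) hA0 (by simpa using hA) hε
  have hsub := abs_integral_gaussianDelta_comp_sub_le
    (hasDerivAt_retarded_sub hv c (position v t) t) (by fun_prop) (sub_pos.2 hKc) ht
    (sub_le_sub_of_abs_le hK c) (by ring) hA0 (by simpa [abs_sub_comm] using hA) hε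
  simp only [position_zero, sub_zero, gaussianDelta_neg ε (position v t + c * t)] at hadd hsub
  rw [retardedField_gaussianDelta_eq (position_continuous hv), meanSlope, sub_sub_sub_comm]
  refine (abs_sub _ _).trans ((add_le_add hadd hsub).trans_eq ?_)
  ring

theorem abs_retardedField_smoothStep_sub_sharpStep_le (hv : Continuous v) (hKc : K < c)
    (ht : 0 ≤ t) (hK : ∀ s ∈ Icc 0 t, |v s| ≤ K) {σ : ℝ} (hσ : 0 < σ) (x : ℝ) :
    |retardedField (smoothStep σ) c (position v) x t - retardedField sharpStep c (position v) x t|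
      ≤ 4 * σ / (c - K) := by
  have hp := position_continuous hv
  have hadd := abs_integral_smoothStep_sub_integral_sharpStep_le
    (hasDerivAt_retarded_add hv c x t) (by fun_prop) (sub_pos.2 hKc) ht
    (sub_le_add_of_abs_le hK c) hσ
  have hsub := abs_integral_smoothStep_sub_integral_sharpStep_le
    (hasDerivAt_retarded_sub hv c x t) (by fun_prop) (sub_pos.2 hKc) ht
    (sub_le_sub_of_abs_le hK c) hσ
  rw [retardedField_eq_of_odd (smoothStep_continuous σ).measurable (abs_smoothStep_le hσ)
      (smoothStep_neg σ) hp,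
    retardedField_eq_of_odd sharpStep_measurable abs_sharpStep_le sharpStep_neg hp,
    neg_sub_neg, abs_sub_comm, add_sub_add_comm]
  refine (abs_add_le _ _).trans ((add_le_add hadd hsub).trans_eq ?_)
  ring

theorem abs_retardedField_smoothStep_sub_le (hv : Continuous v) (hKc : K < c) (ht : 0 ≤ t)
    (hK : ∀ s ∈ Icc 0 t, |v s| ≤ K) {σ : ℝ} (hσ : 0 < σ) {y : ℝ → ℝ} (hy : Continuous y) {ε : ℝ}
    (hε : ∀ s ∈ Icc 0 t, |y s - position v s| ≤ ε) (x : ℝ) :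
    |retardedField (smoothStep σ) c y x t - retardedField (smoothStep σ) c (position v) x t|
      ≤ 4 * ε / (c - K) := by
  have hstep := (smoothStep_continuous σ).measurable
  have hadd := abs_integral_smoothStep_comp_sub_le (hasDerivAt_retarded_add hv c x t)
    (by fun_prop) (sub_pos.2 hKc) ht (sub_le_add_of_abs_le hK c) hσ (ε := ε)
    (κ := fun s => -(x - y s + c * (t - s))) (by fun_prop)
    (fun s hs => by convert hε s hs using 2; ring)
  have hsub := abs_integral_smoothStep_comp_sub_le (hasDerivAt_retarded_sub hv c x t)
    (by fun_prop) (sub_pos.2 hKc) ht (sub_le_sub_of_abs_le hK c) hσ (ε := ε)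
    (κ := fun s => x - y s - c * (t - s)) (by fun_prop)
    (fun s hs => by rw [abs_sub_comm]; convert hε s hs using 2; ring)
  rw [retardedField_eq_of_odd hstep (abs_smoothStep_le hσ) (smoothStep_neg σ) hy,
    retardedField_eq_of_odd hstep (abs_smoothStep_le hσ) (smoothStep_neg σ)
      (position_continuous hv), neg_sub_neg, abs_sub_comm, add_sub_add_comm]
  refine (abs_add_le _ _).trans ((add_le_add hadd hsub).trans_eq ?_)
  ring

end Trajectory

/-! ### The limiting equation of motion -/

theorem meanSlope_eq {c v : ℝ} (h : |v| < c) : meanSlope c v = -v / (c ^ 2 - v ^ 2) := by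
  obtain ⟨h1, h2⟩ := abs_lt.1 h
  have hadd : c + v ≠ 0 := by linarith
  have hsub : c - v ≠ 0 := by linarith
  rw [meanSlope, show c ^ 2 - v ^ 2 = (c + v) * (c - v) by ring]
  field_simp
  ring

theorem sq_sub_sq_pos {c v : ℝ} (h : |v| < c) : 0 < c ^ 2 - v ^ 2 :=
  sub_pos.2 (sq_lt_sq.2 (h.trans_le (le_abs_self c)))

theorem meanSlope_contDiffAt {c v : ℝ} (h : |v| < c) {n : ℕ∞} :
    ContDiffAt ℝ n (meanSlope c) v := by
  obtain ⟨h1, h2⟩ := abs_lt.1 h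
  refine ContDiffAt.sub (f := fun v => 1 / (2 * (c + v))) (g := fun v => 1 / (2 * (c - v)))
    (contDiffAt_const.div (by fun_prop) ?_) (contDiffAt_const.div (by fun_prop) ?_) <;> linarith

theorem continuousOn_meanSlope_comp {c K : ℝ} (hKc : K < c) {v : ℝ → ℝ} {s : Set ℝ}
    (hv : ContinuousOn v s) (hK : ∀ t ∈ s, |v t| ≤ K) :
    ContinuousOn (fun t => meanSlope c (v t)) s := fun t ht =>
  ((meanSlope_contDiffAt ((hK t ht).trans_lt hKc) (n := 0)).continuousAt).comp_continuousWithinAt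
    (hv t ht)

theorem continuous_meanSlope_comp {c K : ℝ} (hKc : K < c) {v : ℝ → ℝ} (hv : Continuous v)
    (hK : ∀ t, |v t| ≤ K) : Continuous fun t => meanSlope c (v t) :=
  continuousOn_univ.1 (continuousOn_meanSlope_comp hKc hv.continuousOn fun t _ => hK t)

theorem abs_one_div_two_mul_sub_le {δ p q : ℝ} (hδ : 0 < δ) (hp : δ ≤ p) (hq : δ ≤ q) :
    |1 / (2 * p) - 1 / (2 * q)| ≤ |p - q| / δ ^ 2 / 2 := by
  have hp0 : 0 < p := hδ.trans_le hp
  have hq0 : 0 < q := hδ.trans_le hq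
  rw [show 1 / (2 * p) - 1 / (2 * q) = (q - p) / (p * q) / 2 by field_simp, abs_div, abs_div,
    abs_sub_comm, abs_of_pos (mul_pos hp0 hq0), abs_two, sq]
  gcongr

theorem abs_meanSlope_sub_le {c K u w : ℝ} (hKc : K < c) (hu : |u| ≤ K) (hw : |w| ≤ K) :
    |meanSlope c u - meanSlope c w| ≤ |u - w| / (c - K) ^ 2 := by
  obtain ⟨u1, u2⟩ := abs_le.1 hu
  obtain ⟨w1, w2⟩ := abs_le.1 hw
  have hadd := abs_one_div_two_mul_sub_le (sub_pos.2 hKc) (by linarith : c - K ≤ c + u)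
    (by linarith : c - K ≤ c + w)
  have hsub := abs_one_div_two_mul_sub_le (sub_pos.2 hKc) (by linarith : c - K ≤ c - u)
    (by linarith : c - K ≤ c - w)
  rw [add_sub_add_left_eq_sub] at hadd
  rw [sub_sub_sub_cancel_left, abs_sub_comm w u] at hsub
  rw [meanSlope, meanSlope, sub_sub_sub_comm]
  exact ((abs_sub _ _).trans (add_le_add hadd hsub)).trans_eq (add_halves _)

theorem abs_sub_le_of_approx_solution {b c K v₀ T ε : ℝ} (hKc : K < c) (hε : 0 ≤ ε)
    {v w : ℝ → ℝ} (hv : Continuous v) (hw : Continuous w)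
    (hvK : ∀ t ∈ Icc 0 T, |v t| ≤ K) (hwK : ∀ t ∈ Icc 0 T, |w t| ≤ K)
    (hve : ∀ t ∈ Icc 0 T, v t = v₀ + ∫ s in (0 : ℝ)..t, b * meanSlope c (v s))
    (hwe : ∀ t ∈ Icc 0 T, |w t - (v₀ + ∫ s in (0 : ℝ)..t, b * meanSlope c (w s))| ≤ ε) :
    ∀ t ∈ Icc 0 T, |w t - v t| ≤ 2 * ε * Real.exp ((2 * (|b| / (c - K) ^ 2) + 1) * t) := by
  have := sub_pos.2 hKc
  refine le_two_mul_exp_of_weighted_bound (by fun_prop) hε (by positivity)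
    fun A l hA hl h t ht => ?_
  have hsub : Icc 0 t ⊆ Icc 0 T := Icc_subset_Icc_right ht.2
  have hint (u : ℝ → ℝ) (hu : Continuous u) (huK : ∀ t ∈ Icc 0 T, |u t| ≤ K) :
      IntervalIntegrable (fun s => b * meanSlope c (u s)) volume 0 t :=
    (continuousOn_const.mul (continuousOn_meanSlope_comp hKc hu.continuousOn
      fun s hs => huK s (hsub hs))).intervalIntegrable_of_Icc ht.1
  have hdiff : |∫ s in (0 : ℝ)..t, (b * meanSlope c (w s) - b * meanSlope c (v s))| ≤
      |b| / (c - K) ^ 2 * A * (Real.exp (l * t) / l) := by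
    refine abs_integral_le_of_le_exp hl ht.1 (by positivity) fun s hs => ?_
    rw [← mul_sub, abs_mul]
    calc |b| * |meanSlope c (w s) - meanSlope c (v s)|
        ≤ |b| * (|w s - v s| / (c - K) ^ 2) := by
          gcongr
          exact abs_meanSlope_sub_le hKc (hwK s (hsub hs)) (hvK s (hsub hs))
      _ ≤ |b| * (A * Real.exp (l * s) / (c - K) ^ 2) := by
          gcongr
          exact h s (hsub hs)
      _ = |b| / (c - K) ^ 2 * A * Real.exp (l * s) := by ring
  rw [intervalIntegral.integral_sub (hint w hw hwK) (hint v hv hvK)] at hdiff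
  calc |w t - v t| = |(w t - (v₀ + ∫ s in (0 : ℝ)..t, b * meanSlope c (w s))) +
        ((∫ s in (0 : ℝ)..t, b * meanSlope c (w s)) -
          ∫ s in (0 : ℝ)..t, b * meanSlope c (v s))| := by rw [hve t ht]; ring_nf
    _ ≤ _ := abs_add_le _ _
    _ ≤ _ := add_le_add (hwe t ht) hdiff

/-- Truncation of `x` to the interval `[-K, K]`, which makes the limiting equation of motion
globally Lipschitz before its solution is known to stay subsonic. -/
def clamp (K x : ℝ) : ℝ := max (-K) (min K x)

@[fun_prop]
theorem clamp_continuous (K : ℝ) : Continuous (clamp K) := by unfold clamp; fun_prop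

theorem abs_clamp_le {K : ℝ} (hK : 0 ≤ K) (x : ℝ) : |clamp K x| ≤ K :=
  abs_le.2 ⟨le_max_left _ _, max_le (by linarith) (min_le_left _ _)⟩

theorem clamp_eq_self {K x : ℝ} (h : |x| ≤ K) : clamp K x = x := by
  rw [clamp, min_eq_right (abs_le.1 h).2, max_eq_right (abs_le.1 h).1]

theorem mul_clamp_nonneg {K : ℝ} (hK : 0 ≤ K) (x : ℝ) : 0 ≤ x * clamp K x := by
  rcases le_total 0 x with h | h
  · exact mul_nonneg h (le_max_of_le_right (le_min hK h))
  · exact mul_nonneg_of_nonpos_of_nonpos h (max_le (by linarith) ((min_le_right _ _).trans h))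

theorem abs_clamp_sub_clamp_le (K x y : ℝ) : |clamp K x - clamp K y| ≤ |x - y| :=
  (abs_max_sub_max_le_max _ _ _ _).trans (max_le (by simp)
    ((abs_min_sub_min_le_max _ _ _ _).trans (max_le (by simp) le_rfl)))

theorem clampedSlope_causalLipschitz (b : ℝ) {c K : ℝ} (hK : 0 ≤ K) (hKc : K < c) :
    CausalLipschitz fun v t => b * meanSlope c (clamp K (v t)) := by
  refine ⟨fun v hv => continuous_const.mul (continuous_meanSlope_comp hKc (by fun_prop)
    fun t => abs_clamp_le hK _), fun T => ⟨|b| / (c - K) ^ 2, by positivity,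
    fun v w _ _ t ht A hA => ?_⟩⟩
  rw [← mul_sub, abs_mul]
  calc |b| * |meanSlope c (clamp K (v t)) - meanSlope c (clamp K (w t))|
      ≤ |b| * (|clamp K (v t) - clamp K (w t)| / (c - K) ^ 2) := by
        gcongr
        exact abs_meanSlope_sub_le hKc (abs_clamp_le hK _) (abs_clamp_le hK _)
    _ ≤ |b| * (A / (c - K) ^ 2) := by
        gcongr
        exact (abs_clamp_sub_clamp_le _ _ _).trans (hA t ⟨ht.1, le_rfl⟩)
    _ = |b| / (c - K) ^ 2 * A := by ring

theorem mul_meanSlope_clamp_nonpos {c K : ℝ} (hK : 0 ≤ K) (hKc : K < c) (x : ℝ) :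
    x * meanSlope c (clamp K x) ≤ 0 := by
  have hlt := (abs_clamp_le hK x).trans_lt hKc
  rw [meanSlope_eq hlt, ← mul_div_assoc, mul_neg, neg_div]
  exact neg_nonpos.2 (div_nonneg (mul_clamp_nonneg hK x) (sq_sub_sq_pos hlt).le)

theorem abs_le_abs_of_mul_deriv_nonpos {v v' : ℝ → ℝ} (hv : Continuous v)
    (hv' : ∀ t, 0 < t → HasDerivAt v (v' t) t) (hsign : ∀ t, 0 < t → v t * v' t ≤ 0) {t : ℝ}
    (ht : 0 ≤ t) : |v t| ≤ |v 0| := by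
  have hanti : AntitoneOn (fun t => v t ^ 2) (Ici 0) := by
    refine antitoneOn_of_hasDerivWithinAt_nonpos (f' := fun t => 2 * (v t * v' t)) (convex_Ici 0)
      (by fun_prop) (fun t ht => ?_) (fun t ht => ?_) <;> rw [interior_Ici] at ht
    · exact (((hv' t ht).pow 2).congr_deriv (by push_cast; ring)).hasDerivWithinAt
    · linarith [hsign t ht]
  exact sq_le_sq.1 (hanti self_mem_Ici ht ht)

/-- `v` is a velocity solving the limiting equation of motion `v' = b * meanSlope c v` on `[0, ∞)`
in integrated form, with speed bounded by the initial speed `|v₀|`. The bound is also required at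
negative times, where the values of `v` are irrelevant. -/
structure IsLimitVelocity (b c v₀ : ℝ) (v : ℝ → ℝ) : Prop where
  continuous : Continuous v
  abs_le : ∀ t, |v t| ≤ |v₀|
  eq_integral : ∀ t, 0 ≤ t → v t = v₀ + ∫ s in (0 : ℝ)..t, b * meanSlope c (v s)

theorem exists_isLimitVelocity {b c v₀ : ℝ} (hb : 0 ≤ b) (hv₀ : |v₀| < c) :
    ∃ v : ℝ → ℝ, IsLimitVelocity b c v₀ v := by
  have hcl := clampedSlope_causalLipschitz b (abs_nonneg v₀) hv₀
  obtain ⟨v, hvc, hv⟩ := hcl.exists_solution v₀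
  have hder : ∀ t, 0 < t → HasDerivAt v (b * meanSlope c (clamp |v₀| (v t))) t := by
    intro t ht
    refine (((hcl.continuous v hvc).integral_hasStrictDerivAt 0 t).hasDerivAt.const_add
      v₀).congr_of_eventuallyEq ?_
    filter_upwards [lt_mem_nhds ht] with s hs using hv s hs.le
  have hbound : ∀ t, 0 ≤ t → |v t| ≤ |v₀| := by
    intro t ht
    have h0 : v 0 = v₀ := by simpa using hv 0 le_rfl
    rw [← h0]
    refine abs_le_abs_of_mul_deriv_nonpos hvc hder (fun s _ => ?_) ht
    rw [mul_left_comm]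
    exact mul_nonpos_of_nonneg_of_nonpos hb
      (mul_meanSlope_clamp_nonpos (abs_nonneg v₀) hv₀ (v s))
  refine ⟨fun t => v (max t 0), hvc.comp (by fun_prop), fun t => hbound _ (le_max_right _ _),
    fun t ht => ?_⟩
  simp only [max_eq_left ht]
  rw [hv t ht]
  congr 1
  refine intervalIntegral.integral_congr fun s hs => ?_
  rw [uIcc_of_le ht] at hs
  simp only [max_eq_left hs.1, clamp_eq_self (hbound s hs.1)]

section LinearDecay

variable {p v : ℝ → ℝ}

theorem eq_mul_exp_neg_integral (hp : Continuous p)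
    (hv : ∀ t, 0 ≤ t → HasDerivWithinAt v (-(p t * v t)) (Ici 0) t) {t : ℝ} (ht : 0 ≤ t) :
    v t = v 0 * Real.exp (-∫ s in (0 : ℝ)..t, p s) := by
  have hvc : ContinuousOn v (Icc 0 t) := fun s hs =>
    (hv s hs.1).continuousWithinAt.mono Icc_subset_Ici_self
  have hP (s : ℝ) : HasDerivAt (fun s => ∫ r in (0 : ℝ)..s, p r) (p s) s :=
    (hp.integral_hasStrictDerivAt 0 s).hasDerivAt
  have hPc : Continuous fun s => ∫ r in (0 : ℝ)..s, p r := continuous_primitive hp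
  have hconst := intervalIntegral.integral_eq_sub_of_hasDerivAt_of_le ht
    (f := fun s => v s * Real.exp (∫ r in (0 : ℝ)..s, p r)) (f' := fun _ => 0)
    (hvc.mul hPc.rexp.continuousOn)
    (fun s hs => (((hv s hs.1.le).hasDerivAt (Ici_mem_nhds hs.1)).mul (hP s).exp).congr_deriv
      (by ring)) (by simp)
  simp only [intervalIntegral.integral_zero, intervalIntegral.integral_same, Real.exp_zero,
    mul_one] at hconst
  rw [← sub_eq_zero.1 hconst.symm, mul_assoc, ← Real.exp_add, add_neg_cancel, Real.exp_zero,
    mul_one]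

theorem monotoneOn_or_antitoneOn_of_linear (hp : Continuous p) (hp0 : ∀ t, 0 ≤ p t)
    (hv : ∀ t, 0 ≤ t → HasDerivWithinAt v (-(p t * v t)) (Ici 0) t) :
    MonotoneOn v (Ici 0) ∨ AntitoneOn v (Ici 0) := by
  have hexp : ∀ s t : ℝ, s ≤ t → Real.exp (-∫ r in (0 : ℝ)..t, p r) ≤
      Real.exp (-∫ r in (0 : ℝ)..s, p r) := by
    intro s t hst
    rw [Real.exp_le_exp, neg_le_neg_iff, ← sub_nonneg, intervalIntegral.integral_interval_sub_left
      (hp.intervalIntegrable _ _) (hp.intervalIntegrable _ _)]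
    exact intervalIntegral.integral_nonneg hst fun r _ => hp0 r
  rcases le_total (v 0) 0 with h0 | h0
  · refine Or.inl fun s hs t ht hst => ?_
    rw [eq_mul_exp_neg_integral hp hv hs, eq_mul_exp_neg_integral hp hv ht]
    exact mul_le_mul_of_nonpos_left (hexp s t hst) h0
  · refine Or.inr fun s hs t ht hst => ?_
    rw [eq_mul_exp_neg_integral hp hv hs, eq_mul_exp_neg_integral hp hv ht]
    exact mul_le_mul_of_nonneg_left (hexp s t hst) h0

theorem abs_le_mul_exp_of_linear (hp : Continuous p) {κ : ℝ} (hκ : ∀ t, κ ≤ p t)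
    (hv : ∀ t, 0 ≤ t → HasDerivWithinAt v (-(p t * v t)) (Ici 0) t) {t : ℝ} (ht : 0 ≤ t) :
    |v t| ≤ |v 0| * Real.exp (-κ * t) := by
  have hint : ∫ _ in (0 : ℝ)..t, κ ≤ ∫ s in (0 : ℝ)..t, p s :=
    intervalIntegral.integral_mono_on ht intervalIntegrable_const (hp.intervalIntegrable _ _)
      fun s _ => hκ s
  rw [intervalIntegral.integral_const, smul_eq_mul] at hint
  rw [eq_mul_exp_neg_integral hp hv ht, abs_mul, Real.abs_exp]
  gcongr
  linarith

end LinearDecay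

namespace IsLimitVelocity

variable {b c v₀ : ℝ} {v : ℝ → ℝ}

theorem continuous_mul_meanSlope (h : IsLimitVelocity b c v₀ v) (hv₀ : |v₀| < c) :
    Continuous fun s => b * meanSlope c (v s) :=
  continuous_const.mul (continuous_meanSlope_comp hv₀ h.continuous h.abs_le)

theorem apply_zero (h : IsLimitVelocity b c v₀ v) : v 0 = v₀ := by
  simpa using h.eq_integral 0 le_rfl

theorem hasDerivWithinAt (h : IsLimitVelocity b c v₀ v) (hv₀ : |v₀| < c) {t : ℝ} (ht : 0 ≤ t) :
    HasDerivWithinAt v (b * meanSlope c (v t)) (Ici 0) t :=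
  (((h.continuous_mul_meanSlope hv₀).integral_hasStrictDerivAt 0 t).hasDerivAt.const_add
    v₀).hasDerivWithinAt.congr (fun s hs => h.eq_integral s hs) (h.eq_integral t ht)

theorem contDiffOn (h : IsLimitVelocity b c v₀ v) (hv₀ : |v₀| < c) :
    ContDiffOn ℝ ∞ v (Ici 0) := by
  have hd := fun t (ht : t ∈ Ici (0 : ℝ)) => h.hasDerivWithinAt hv₀ ht
  rw [contDiffOn_infty]
  intro n
  induction n with
  | zero => exact contDiffOn_zero.2 h.continuous.continuousOn
  | succ n ih =>
    rw [Nat.cast_add, Nat.cast_one, contDiffOn_succ_iff_derivWithin (uniqueDiffOn_Ici 0)]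
    refine ⟨fun t ht => (hd t ht).differentiableWithinAt, by simp, ?_⟩
    refine ContDiffOn.congr (f := fun t => b * meanSlope c (v t)) ?_
      fun t ht => (hd t ht).derivWithin (uniqueDiffOn_Ici 0 t ht)
    exact contDiffOn_const.mul fun t ht => ContDiffAt.comp_contDiffWithinAt t
      (meanSlope_contDiffAt ((h.abs_le t).trans_lt hv₀) (n := n)) (ih t ht)

theorem sq_sub_sq_pos (h : IsLimitVelocity b c v₀ v) (hv₀ : |v₀| < c) (t : ℝ) :
    0 < c ^ 2 - v t ^ 2 :=
  PointParticle.sq_sub_sq_pos ((h.abs_le t).trans_lt hv₀)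

theorem continuous_rate (h : IsLimitVelocity b c v₀ v) (hv₀ : |v₀| < c) :
    Continuous fun t => b / (c ^ 2 - v t ^ 2) :=
  continuous_const.div (by have := h.continuous; fun_prop) fun t => (h.sq_sub_sq_pos hv₀ t).ne'

theorem hasDerivWithinAt_linear (h : IsLimitVelocity b c v₀ v) (hv₀ : |v₀| < c) {t : ℝ}
    (ht : 0 ≤ t) :
    HasDerivWithinAt v (-(b / (c ^ 2 - v t ^ 2) * v t)) (Ici 0) t := by
  convert h.hasDerivWithinAt hv₀ ht using 1
  rw [meanSlope_eq ((h.abs_le t).trans_lt hv₀)]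
  ring

theorem monotoneOn_or_antitoneOn (h : IsLimitVelocity b c v₀ v) (hb : 0 ≤ b) (hv₀ : |v₀| < c) :
    MonotoneOn v (Ici 0) ∨ AntitoneOn v (Ici 0) :=
  monotoneOn_or_antitoneOn_of_linear (h.continuous_rate hv₀)
    (fun t => div_nonneg hb (h.sq_sub_sq_pos hv₀ t).le) fun _ ht => h.hasDerivWithinAt_linear hv₀ ht

theorem abs_le_mul_exp (h : IsLimitVelocity b c v₀ v) (hb : 0 ≤ b) (hv₀ : |v₀| < c) {t : ℝ}
    (ht : 0 ≤ t) : |v t| ≤ |v₀| * Real.exp (-(b / c ^ 2) * t) := by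
  rw [← h.apply_zero]
  refine abs_le_mul_exp_of_linear (h.continuous_rate hv₀) (fun s => ?_)
    (fun s hs => h.hasDerivWithinAt_linear hv₀ hs) ht
  have := h.sq_sub_sq_pos hv₀ s
  gcongr
  linarith [sq_nonneg (v s)]

end IsLimitVelocity

/-! ### The weak field of a point source -/

/-- The wave operator `∂²/∂t² - c² ∂²/∂x²`, in the form in which it acts on test functions in
`IsWeakDeltaField`. -/
def waveOp (c : ℝ) (ψ : ℝ × ℝ → ℝ) (p : ℝ × ℝ) : ℝ :=
  iteratedDeriv 2 (fun s : ℝ => ψ (p.1, s)) p.2 -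
    c ^ 2 * iteratedDeriv 2 (fun z : ℝ => ψ (z, p.2)) p.1

section

variable {ψ : ℝ × ℝ → ℝ} {R T : ℝ}

theorem waveOp_eq_fderiv (hψ : ContDiff ℝ 2 ψ) (c : ℝ) (p : ℝ × ℝ) :
    waveOp c ψ p =
      fderiv ℝ (fderiv ℝ ψ) p (0, 1) (0, 1) - c ^ 2 * fderiv ℝ (fderiv ℝ ψ) p (1, 0) (1, 0) := by
  rw [waveOp, iteratedDeriv_two_comp_line (γ := fun s => (p.1, s))
      (fun s => (hasDerivAt_const s p.1).prodMk (hasDerivAt_id s)) rfl hψ.contDiffAt,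
    iteratedDeriv_two_comp_line (γ := fun z => (z, p.2))
      (fun s => (hasDerivAt_id s).prodMk (hasDerivAt_const s p.2)) rfl hψ.contDiffAt]

theorem waveOp_continuous (hψ : ContDiff ℝ 2 ψ) (c : ℝ) : Continuous (waveOp c ψ) := by
  have hfderiv : ContDiff ℝ 1 (fderiv ℝ ψ) := hψ.fderiv_right (by norm_num)
  have : Continuous (fderiv ℝ (fderiv ℝ ψ)) := hfderiv.continuous_fderiv (by norm_num)
  rw [funext (waveOp_eq_fderiv hψ c)]
  fun_prop

theorem waveOp_eq_zero_of_lt_norm (hψR : ∀ p, R ≤ ‖p‖ → ψ p = 0) (c : ℝ) {p : ℝ × ℝ}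
    (hp : R < ‖p‖) : waveOp c ψ p = 0 := by
  have hψp : ψ =ᶠ[𝓝 p] fun _ => 0 := by
    filter_upwards [continuous_norm.continuousAt.eventually_const_lt hp] with q hq using hψR q hq.le
  have htime : (fun s => ψ (p.1, s)) =ᶠ[𝓝 p.2] fun _ => 0 :=
    hψp.comp_tendsto (by fun_prop : Continuous fun s => (p.1, s)).continuousAt
  have hspace : (fun z => ψ (z, p.2)) =ᶠ[𝓝 p.1] fun _ => 0 :=
    hψp.comp_tendsto (by fun_prop : Continuous fun z => (z, p.2)).continuousAt
  simp [waveOp, htime.iteratedDeriv_eq, hspace.iteratedDeriv_eq]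

/-- Seen backwards in time, `ψ` solves the wave equation with source `waveOp c ψ` and zero data
at time `T`, so d'Alembert's formula applies. -/
theorem integral_waveOp_cone {c : ℝ} (hc : 0 < c) (hψ : ContDiff ℝ 2 ψ)
    (hψR : ∀ x t, R ≤ t → ψ (x, t) = 0) (hRT : R < T) (z : ℝ) {s : ℝ} (hs : s ≤ T) :
    ∫ t in s..T, ∫ ξ in (z - c * (t - s))..(z + c * (t - s)), waveOp c ψ (ξ, t) =
      2 * c * ψ (z, s) := by
  have hbox : Continuous (waveOp c ψ) := waveOp_continuous hψ c
  have hdata (x : ℝ) : derivWithin (fun s => ψ (x, T - s)) (Ici 0) 0 = 0 := by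
    have hzero : (fun s => ψ (x, T - s)) =ᶠ[𝓝 0] fun _ => 0 := by
      filter_upwards [gt_mem_nhds (sub_pos.2 hRT)] with s hs
      exact hψR x _ (by linarith)
    exact ((hasDerivAt_const (0 : ℝ) (0 : ℝ)).congr_of_eventuallyEq
      hzero).hasDerivWithinAt.derivWithin (uniqueDiffOn_Ici 0 0 self_mem_Ici)
  have hwave (x t : ℝ) : iteratedDeriv 2 (fun s => ψ (x, T - s)) t =
      c ^ 2 * iteratedDeriv 2 (fun z => ψ (z, T - t)) x + waveOp c ψ (x, T - t) := by
    simp [waveOp, iteratedDeriv_comp_const_sub 2 (fun s => ψ (x, s)) T]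
  have hformula := dAlembert (u := fun x t => ψ (x, T - t))
    (F := fun x t => waveOp c ψ (x, T - t)) hc (by unfold Function.uncurry; fun_prop)
    (by fun_prop) (fun x => hψR x _ (by linarith)) hdata (fun x t _ => hwave x t) z
    (sub_nonneg.2 hs)
  have hreverse := intervalIntegral.integral_comp_sub_left (a := 0) (b := T - s)
    (fun t => ∫ ξ in (z - c * (t - s))..(z + c * (t - s)), waveOp c ψ (ξ, t)) T
  rw [sub_zero, sub_sub_cancel] at hreverse
  simp only [sub_sub_cancel] at hformula
  rw [hformula, ← hreverse]
  simp only [sub_right_comm T s]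
  field_simp

end

theorem integral_sharpStep_window (f : ℝ → ℝ) {p q : ℝ} (hpq : p ≤ q) :
    ∫ x, (sharpStep (x - p) - sharpStep (x - q)) * f x = ∫ x in p..q, f x := by
  rw [intervalIntegral.integral_of_le hpq, ← integral_indicator measurableSet_Ioc]
  refine integral_congr_ae ?_
  filter_upwards [(Set.toFinite {p, q}).countable.ae_notMem volume] with x hx
  simp only [mem_insert_iff, mem_singleton_iff, not_or] at hx
  rcases lt_or_gt_of_ne hx.1 with hxp | hpx
  · rw [sharpStep_of_neg (by linarith), sharpStep_of_neg (by linarith),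
      indicator_of_notMem fun h => hxp.not_gt h.1, sub_self, zero_mul]
  rw [sharpStep_of_pos (sub_pos.2 hpx)]
  rcases lt_or_gt_of_ne hx.2 with hxq | hqx
  · rw [sharpStep_of_neg (by linarith), indicator_of_mem (mem_Ioc.2 ⟨hpx, hxq.le⟩)]
    ring
  · rw [sharpStep_of_pos (sub_pos.2 hqx), indicator_of_notMem fun h => hqx.not_ge h.2, sub_self,
      zero_mul]

theorem integral_retardedField_sharpStep_mul {f : ℝ → ℝ} (hf : Integrable f) {c : ℝ} (hc : 0 < c)
    {y : ℝ → ℝ} (hy : Continuous y) {t : ℝ} (ht : 0 ≤ t) :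
    ∫ x, retardedField sharpStep c y x t * f x =
      ∫ s in (0 : ℝ)..t, ∫ ξ in (y s - c * (t - s))..(y s + c * (t - s)), f ξ := by
  have hwindow : Integrable (fun q : ℝ × ℝ => (sharpStep (q.1 - (y q.2 - c * (t - q.2))) -
      sharpStep (q.1 - (y q.2 + c * (t - q.2)))) * f q.1)
      (volume.prod (volume.restrict (Ioc 0 t))) := by
    have hint {p : ℝ → ℝ} (hp : Continuous p) := by
      simpa only [sub_zero] using
        integrable_prod_bounded_mul sharpStep_measurable abs_sharpStep_le hf hp 0 t
    simpa only [sub_mul, Pi.sub_def] using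
      (hint (p := fun s => y s - c * (t - s)) (by fun_prop)).sub
        (hint (p := fun s => y s + c * (t - s)) (by fun_prop))
  have hfield (x : ℝ) : retardedField sharpStep c y x t * f x = ∫ s in Ioc 0 t,
      (sharpStep (x - (y s - c * (t - s))) - sharpStep (x - (y s + c * (t - s)))) * f x := by
    rw [integral_mul_const, retardedField, intervalIntegral.integral_of_le ht]
    simp only [sub_add_eq_sub_sub, sub_sub_eq_add_sub, sub_add_eq_add_sub]
  simp_rw [hfield]
  rw [integral_integral_swap hwindow, intervalIntegral.integral_of_le ht]
  refine setIntegral_congr_fun measurableSet_Ioc fun s hs => ?_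
  have : 0 ≤ c * (t - s) := mul_nonneg hc.le (sub_nonneg.2 hs.2)
  exact integral_sharpStep_window f (by linarith)

theorem setIntegral_Ioi_eq_intervalIntegral {E : Type*} [NormedAddCommGroup E] [NormedSpace ℝ E]
    {f : ℝ → E} {a T : ℝ} (hT : a ≤ T) (h : ∀ t, T < t → f t = 0) :
    ∫ t in Ioi a, f t = ∫ t in a..T, f t := by
  rw [intervalIntegral.integral_of_le hT]
  exact setIntegral_eq_of_subset_of_forall_sdiff_eq_zero measurableSet_Ioi Ioc_subset_Ioi_self
    fun t ht => h t (not_le.1 fun hle => ht.2 ⟨ht.1, hle⟩)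

theorem continuous_intervalIntegral_of_continuous_bounds {X E : Type*} [TopologicalSpace X]
    [NormedAddCommGroup E] [NormedSpace ℝ E] {f : X → ℝ → E}
    (hf : Continuous (Function.uncurry f)) {a b : X → ℝ} (ha : Continuous a) (hb : Continuous b) :
    Continuous fun q => ∫ ξ in a q..b q, f q ξ := by
  have hint (q : X) (r : ℝ) : IntervalIntegrable (f q) volume 0 r :=
    (by fun_prop : Continuous (f q)).intervalIntegrable _ _
  simp only [← fun q => intervalIntegral.integral_interval_sub_left (hint q (b q)) (hint q (a q))]
  exact (intervalIntegral.continuous_parametric_intervalIntegral_of_continuous hf hb).sub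
    (intervalIntegral.continuous_parametric_intervalIntegral_of_continuous hf ha)

theorem integral_retardedField_mul_eq_integral_cone {G : ℝ × ℝ → ℝ} (hG : Continuous G) {T : ℝ}
    (hT : 0 ≤ T) (hGT : ∀ p, T ≤ ‖p‖ → G p = 0) {c : ℝ} (hc : 0 < c) {y : ℝ → ℝ}
    (hy : Continuous y) :
    ∫ t in Ioi (0 : ℝ), ∫ x, retardedField sharpStep c y x t * G (x, t) =
      ∫ s in (0 : ℝ)..T, ∫ t in s..T,
        ∫ ξ in (y s - c * (t - s))..(y s + c * (t - s)), G (ξ, t) := by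
  have hslice (t : ℝ) : Integrable fun x => G (x, t) := by
    refine (by fun_prop : Continuous fun x => G (x, t)).integrable_of_hasCompactSupport
      (HasCompactSupport.intro (isCompact_closedBall 0 T) fun x hx => hGT _ ?_)
    rw [mem_closedBall_zero_iff, not_le] at hx
    exact hx.le.trans (norm_fst_le (x, t))
  have hcone : Continuous (Function.uncurry fun s t =>
      ∫ ξ in (y s - c * (t - s))..(y s + c * (t - s)), G (ξ, t)) :=
    continuous_intervalIntegral_of_continuous_bounds (f := fun (q : ℝ × ℝ) ξ => G (ξ, q.2))
      (by unfold Function.uncurry; fun_prop) (by fun_prop) (by fun_prop)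
  rw [← integral_triangle_swap hcone hT, ← setIntegral_Ioi_eq_intervalIntegral hT fun t ht => ?_]
  · exact setIntegral_congr_fun measurableSet_Ioi fun t ht =>
      integral_retardedField_sharpStep_mul (hslice t) hc hy (le_of_lt ht)
  · have hGt (ξ : ℝ) : G (ξ, t) = 0 :=
      hGT _ (ht.le.trans ((le_abs_self t).trans (norm_snd_le (ξ, t))))
    simp [hGt]

theorem isWeakDeltaField_retardedField {c : ℝ} (hc : 0 < c) (β : ℝ) {y : ℝ → ℝ}
    (hy : Continuous y) :
    IsWeakDeltaField c β (fun x t => β / (2 * c) * retardedField sharpStep c y x t) y := by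
  intro ψ hψ hcs
  replace hψ : ContDiff ℝ 2 ψ := hψ.of_le ENat.LEInfty.out
  obtain ⟨R, hR, hψR⟩ := hcs.exists_pos_le_norm
  have hRT : R < R + 1 := lt_add_one R
  have hT : 0 ≤ R + 1 := by positivity
  have hψt (x t : ℝ) (ht : R ≤ t) : ψ (x, t) = 0 :=
    hψR _ (ht.trans ((le_abs_self t).trans (norm_snd_le (x, t))))
  calc ∫ t in Ioi (0 : ℝ), ∫ x, β / (2 * c) * retardedField sharpStep c y x t * waveOp c ψ (x, t)
      = β / (2 * c) * ∫ t in Ioi (0 : ℝ), ∫ x,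
          retardedField sharpStep c y x t * waveOp c ψ (x, t) := by
        simp only [mul_assoc, integral_const_mul]
    _ = β / (2 * c) * ∫ s in (0 : ℝ)..(R + 1), 2 * c * ψ (y s, s) := by
        rw [integral_retardedField_mul_eq_integral_cone (waveOp_continuous hψ c) hT
          (fun p hp => waveOp_eq_zero_of_lt_norm hψR c (hRT.trans_le hp)) hc hy]
        congr 1
        refine intervalIntegral.integral_congr fun s hs => ?_
        rw [uIcc_of_le hT] at hs
        exact integral_waveOp_cone hc hψ hψt hRT (y s) hs.2
    _ = β * ∫ t in Ioi (0 : ℝ), ψ (y t, t) := by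
        rw [intervalIntegral.integral_const_mul, setIntegral_Ioi_eq_intervalIntegral hT
          fun t ht => hψt _ t (hRT.trans ht).le]
        field_simp

/-! ### Uniqueness of weak fields -/

theorem iteratedDeriv_two_mul_affine {A B : ℝ → ℝ} (hA : ContDiff ℝ 2 A) (hB : ContDiff ℝ 2 B)
    (p q a b s : ℝ) :
    iteratedDeriv 2 (fun s => A (p + a * s) * B (q + b * s)) s =
      a ^ 2 * (deriv (deriv A) (p + a * s) * B (q + b * s)) +
      2 * a * b * (deriv A (p + a * s) * deriv B (q + b * s)) +
      b ^ 2 * (A (p + a * s) * deriv (deriv B) (q + b * s)) := by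
  have hcomp {f : ℝ → ℝ} (hf : Differentiable ℝ f) (p a s : ℝ) :
      HasDerivAt (fun s => f (p + a * s)) (deriv f (p + a * s) * a) s :=
    (hf (p + a * s)).hasDerivAt.comp s
      (by simpa using ((hasDerivAt_id s).const_mul a).const_add p)
  have hA₁ : Differentiable ℝ A := hA.differentiable (by norm_num)
  have hB₁ : Differentiable ℝ B := hB.differentiable (by norm_num)
  have hderiv : deriv (fun s => A (p + a * s) * B (q + b * s)) = fun s =>
      deriv A (p + a * s) * a * B (q + b * s) + A (p + a * s) * (deriv B (q + b * s) * b) :=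
    funext fun s => ((hcomp hA₁ p a s).mul (hcomp hB₁ q b s)).deriv
  rw [iteratedDeriv_succ, iteratedDeriv_one, hderiv]
  refine (((((hcomp hA.differentiable_deriv_two p a s).mul_const a).mul (hcomp hB₁ q b s)).add
    ((hcomp hA₁ p a s).mul ((hcomp hB.differentiable_deriv_two q b s).mul_const b))).deriv).trans ?_
  ring

/-- A smooth ramp from `0` to `1`, constant outside `[0, r]`. -/
def smoothRamp (r x : ℝ) : ℝ := Real.smoothTransition (x / r)

section

variable {r x : ℝ}

@[fun_prop]
theorem smoothRamp_contDiff (r : ℝ) {n : ℕ∞} : ContDiff ℝ n (smoothRamp r) :=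
  Real.smoothTransition.contDiff.comp (contDiff_id.div_const r)

theorem smoothRamp_of_nonpos (hr : 0 < r) (hx : x ≤ 0) : smoothRamp r x = 0 :=
  Real.smoothTransition.zero_of_nonpos (div_nonpos_of_nonpos_of_nonneg hx hr.le)

theorem smoothRamp_of_le (hr : 0 < r) (hx : r ≤ x) : smoothRamp r x = 1 :=
  Real.smoothTransition.one_of_one_le ((one_le_div hr).2 hx)

theorem smoothRamp_deriv_nonneg (hr : 0 < r) (x : ℝ) : 0 ≤ deriv (smoothRamp r) x :=
  (Real.smoothTransition.monotone.comp (monotone_div_right_of_nonneg hr.le)).deriv_nonneg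

theorem smoothRamp_deriv_support (hr : 0 < r) (h : deriv (smoothRamp r) x ≠ 0) : x ∈ Icc 0 r := by
  by_contra hx
  rw [mem_Icc, not_and_or, not_le, not_le] at hx
  obtain ⟨a, ha⟩ : ∃ a, smoothRamp r =ᶠ[𝓝 x] fun _ => a := by
    rcases hx with hx | hx
    · exact ⟨0, (gt_mem_nhds hx).mono fun z hz => smoothRamp_of_nonpos hr hz.le⟩
    · exact ⟨1, (lt_mem_nhds hx).mono fun z hz => smoothRamp_of_le hr hz.le⟩
  exact h (by rw [ha.deriv_eq, deriv_const])

theorem exists_smoothRamp_deriv_ne_zero (hr : 0 < r) : ∃ x, deriv (smoothRamp r) x ≠ 0 := by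
  obtain ⟨x, -, hx⟩ := exists_deriv_eq_slope (smoothRamp r) hr
    (smoothRamp_contDiff r (n := 0)).continuous.continuousOn
    ((smoothRamp_contDiff r (n := 1)).differentiable (by norm_num)).differentiableOn
  rw [smoothRamp_of_nonpos hr le_rfl, smoothRamp_of_le hr le_rfl, sub_zero, sub_zero] at hx
  exact ⟨x, hx ▸ (one_div_pos.2 hr).ne'⟩

end

/-- A test function living on the backward light cone with apex `(x₀, t₀)`: a product of ramps in
the two characteristic coordinates measured from the apex, cut off at negative times. -/
def coneTest (c x₀ t₀ r : ℝ) (p : ℝ × ℝ) : ℝ :=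
  Real.smoothTransition (p.2 + 2) *
    (smoothRamp r (x₀ + c * t₀ - (p.1 + c * p.2)) * smoothRamp r (p.1 - c * p.2 - (x₀ - c * t₀)))

/-- The image of `coneTest` under the wave operator at positive times: a nonnegative bump
concentrated near the apex. -/
def coneBump (c x₀ t₀ r : ℝ) (p : ℝ × ℝ) : ℝ :=
  4 * c ^ 2 * (deriv (smoothRamp r) (x₀ + c * t₀ - (p.1 + c * p.2)) *
    deriv (smoothRamp r) (p.1 - c * p.2 - (x₀ - c * t₀)))

section

variable {c x₀ t₀ r : ℝ}

theorem coneTest_contDiff (c x₀ t₀ r : ℝ) : ContDiff ℝ ∞ (coneTest c x₀ t₀ r) := by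
  have : ContDiff ℝ ∞ (smoothRamp r) := smoothRamp_contDiff r
  have : ContDiff ℝ ∞ Real.smoothTransition := Real.smoothTransition.contDiff
  unfold coneTest
  fun_prop

theorem coneTest_hasCompactSupport (hc : 0 < c) (hr : 0 < r) :
    HasCompactSupport (coneTest c x₀ t₀ r) := by
  refine HasCompactSupport.intro
    (K := Icc (x₀ - c * (t₀ + 2)) (x₀ + c * (t₀ + 2)) ×ˢ Icc (-2) t₀)
    (isCompact_Icc.prod isCompact_Icc) fun p hp => ?_
  by_contra hne
  have hcutoff : -2 < p.2 := by
    by_contra h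
    exact hne (by rw [coneTest, Real.smoothTransition.zero_of_nonpos (by linarith), zero_mul])
  have hadv : p.1 + c * p.2 < x₀ + c * t₀ := by
    by_contra h
    exact hne (by rw [coneTest, smoothRamp_of_nonpos hr (by linarith), zero_mul, mul_zero])
  have hret : x₀ - c * t₀ < p.1 - c * p.2 := by
    by_contra h
    exact hne (by
      rw [coneTest, smoothRamp_of_nonpos (x := p.1 - _ - _) hr (by linarith), mul_zero, mul_zero])
  refine hp ⟨⟨?_, ?_⟩, hcutoff.le, ?_⟩ <;> nlinarith

theorem waveOp_coneTest (c x₀ t₀ r x : ℝ) {t : ℝ} (ht : 0 < t) :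
    waveOp c (coneTest c x₀ t₀ r) (x, t) = coneBump c x₀ t₀ r (x, t) := by
  have hramp : ContDiff ℝ 2 (smoothRamp r) := smoothRamp_contDiff r
  have hone {s : ℝ} (hs : 0 < s) : Real.smoothTransition (s + 2) = 1 :=
    Real.smoothTransition.one_of_one_le (by linarith)
  have htime : (fun s => coneTest c x₀ t₀ r (x, s)) =ᶠ[𝓝 t] fun s =>
      smoothRamp r (x₀ + c * t₀ - x + -c * s) * smoothRamp r (x - (x₀ - c * t₀) + -c * s) := by
    filter_upwards [lt_mem_nhds ht] with s hs
    simp only [coneTest, hone hs, one_mul]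
    ring_nf
  have hspace : (fun z => coneTest c x₀ t₀ r (z, t)) = fun z =>
      smoothRamp r (x₀ + c * t₀ - c * t + -1 * z) *
        smoothRamp r (-(c * t) - (x₀ - c * t₀) + 1 * z) := by
    funext z
    simp only [coneTest, hone ht, one_mul]
    ring_nf
  simp only [waveOp]
  rw [htime.iteratedDeriv_eq, hspace, iteratedDeriv_two_mul_affine hramp hramp,
    iteratedDeriv_two_mul_affine hramp hramp, coneBump]
  ring_nf

theorem coneBump_continuous (c x₀ t₀ r : ℝ) : Continuous (coneBump c x₀ t₀ r) := by
  have : Continuous (deriv (smoothRamp r)) :=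
    (smoothRamp_contDiff r (n := 1)).continuous_deriv (by norm_num)
  unfold coneBump
  fun_prop

theorem coneBump_nonneg (hr : 0 < r) (p : ℝ × ℝ) : 0 ≤ coneBump c x₀ t₀ r p :=
  mul_nonneg (by positivity)
    (mul_nonneg (smoothRamp_deriv_nonneg hr _) (smoothRamp_deriv_nonneg hr _))

theorem coneBump_support (hc : 0 < c) (hr : 0 < r) :
    Function.support (coneBump c x₀ t₀ r) ⊆ Icc (x₀ - r) (x₀ + r) ×ˢ Icc (t₀ - r / c) t₀ := by
  intro p hp
  rw [Function.mem_support, coneBump] at hp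
  have hadv := smoothRamp_deriv_support hr (left_ne_zero_of_mul (right_ne_zero_of_mul hp))
  have hret := smoothRamp_deriv_support hr (right_ne_zero_of_mul (right_ne_zero_of_mul hp))
  refine ⟨⟨by linarith [hadv.2, hret.1], by linarith [hadv.1, hret.2]⟩, ?_, ?_⟩
  · rw [sub_le_comm, le_div_iff₀ hc]
    linarith [hadv.2, hret.2]
  · nlinarith [hadv.1, hret.1]

theorem coneBump_hasCompactSupport (hc : 0 < c) (hr : 0 < r) :
    HasCompactSupport (coneBump c x₀ t₀ r) :=
  HasCompactSupport.intro (isCompact_Icc.prod isCompact_Icc) fun _ hp =>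
    Function.notMem_support.1 fun h => hp (coneBump_support hc hr h)

theorem exists_coneBump_ne_zero (hc : 0 < c) (hr : 0 < r) : ∃ p, coneBump c x₀ t₀ r p ≠ 0 := by
  obtain ⟨s, hs⟩ := exists_smoothRamp_deriv_ne_zero hr
  refine ⟨(x₀, t₀ - s / c), ?_⟩
  have hadv : x₀ + c * t₀ - (x₀ + c * (t₀ - s / c)) = s := by field_simp; ring
  have hret : x₀ - c * (t₀ - s / c) - (x₀ - c * t₀) = s := by field_simp; ring
  simp only [coneBump, hadv, hret]
  positivity

end

theorem IsWeakDeltaField.integral_mul_coneBump {c β x₀ t₀ r : ℝ} {φ : ℝ → ℝ → ℝ} {y : ℝ → ℝ}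
    (h : IsWeakDeltaField c β φ y) (hφ : Continuous fun p : ℝ × ℝ => φ p.1 (max p.2 0))
    (hc : 0 < c) (hr : 0 < r) (hrt : r < c * t₀) :
    ∫ p : ℝ × ℝ, φ p.1 (max p.2 0) * coneBump c x₀ t₀ r p =
      β * ∫ t in Ioi (0 : ℝ), coneTest c x₀ t₀ r (y t, t) := by
  have hint : Integrable fun p : ℝ × ℝ => φ p.1 (max p.2 0) * coneBump c x₀ t₀ r p :=
    (hφ.mul (coneBump_continuous c x₀ t₀ r)).integrable_of_hasCompactSupport
      (coneBump_hasCompactSupport hc hr).mul_left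
  have hpos {x t : ℝ} (ht : t ∉ Ioi 0) : coneBump c x₀ t₀ r (x, t) = 0 := by
    by_contra hne
    have hapex : t₀ - r / c ≤ t := (coneBump_support hc hr hne).2.1
    have : r / c < t₀ := (div_lt_iff₀' hc).2 hrt
    exact ht (mem_Ioi.2 (by linarith))
  calc ∫ p : ℝ × ℝ, φ p.1 (max p.2 0) * coneBump c x₀ t₀ r p
      = ∫ t, ∫ x, φ x (max t 0) * coneBump c x₀ t₀ r (x, t) := integral_prod_symm _ hint
    _ = ∫ t in Ioi (0 : ℝ), ∫ x, φ x (max t 0) * coneBump c x₀ t₀ r (x, t) := by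
        refine (setIntegral_eq_integral_of_forall_compl_eq_zero fun t ht => ?_).symm
        simp [hpos ht]
    _ = ∫ t in Ioi (0 : ℝ), ∫ x, φ x t * waveOp c (coneTest c x₀ t₀ r) (x, t) := by
        refine setIntegral_congr_fun measurableSet_Ioi fun t ht => ?_
        simp only [waveOp_coneTest c x₀ t₀ r _ ht, max_eq_left (mem_Ioi.1 ht).le]
    _ = β * ∫ t in Ioi (0 : ℝ), coneTest c x₀ t₀ r (y t, t) :=
        h _ (coneTest_contDiff c x₀ t₀ r) (coneTest_hasCompactSupport hc hr)

theorem le_of_exists_bump_integral_le {X : Type*} [TopologicalSpace X] [MeasurableSpace X]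
    [OpensMeasurableSpace X] {μ : Measure X} [μ.IsOpenPosMeasure] [IsFiniteMeasureOnCompacts μ]
    {f g : X → ℝ} (hf : Continuous f) (hg : Continuous g) {p : X}
    (h : ∀ U ∈ 𝓝 p, ∃ k : X → ℝ, Continuous k ∧ HasCompactSupport k ∧ (∀ q, 0 ≤ k q) ∧
      (∃ q, k q ≠ 0) ∧ Function.support k ⊆ U ∧ ∫ q, f q * k q ∂μ ≤ ∫ q, g q * k q ∂μ) :
    f p ≤ g p := by
  by_contra! hlt
  obtain ⟨k, hk, hkc, hk0, ⟨q, hq⟩, hkU, hle⟩ := h {q | g q < f q} ((isOpen_lt hg hf).mem_nhds hlt)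
  have hpos : 0 < ∫ q, (f q - g q) * k q ∂μ := by
    refine ((hf.sub hg).mul hk).integral_pos_of_hasCompactSupport_nonneg_nonzero hkc.mul_left
      (fun q => ?_) (mul_ne_zero (sub_pos.2 (hkU hq)).ne' hq)
    by_cases hq : k q = 0
    · simp [hq]
    · exact mul_nonneg (sub_nonneg.2 (hkU hq).le) (hk0 q)
  simp only [sub_mul] at hpos
  have hsub := integral_sub ((hf.mul hk).integrable_of_hasCompactSupport (μ := μ) hkc.mul_left)
    ((hg.mul hk).integrable_of_hasCompactSupport (μ := μ) hkc.mul_left)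
  simp only [Pi.mul_apply] at hsub
  linarith

theorem exists_coneBump_support_subset {c x₀ t₀ : ℝ} (hc : 0 < c) (ht₀ : 0 < t₀)
    {U : Set (ℝ × ℝ)} (hU : U ∈ 𝓝 (x₀, t₀)) :
    ∃ r, 0 < r ∧ r < c * t₀ ∧ Function.support (coneBump c x₀ t₀ r) ⊆ U := by
  obtain ⟨ρ, hρ, hball⟩ := Metric.nhds_basis_closedBall.mem_iff.1 hU
  obtain ⟨r, hr, hrlt⟩ := exists_between (show 0 < min (min ρ (c * ρ)) (c * t₀) by positivity)
  simp only [lt_min_iff] at hrlt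
  refine ⟨r, hr, hrlt.2, fun p hp => hball ?_⟩
  obtain ⟨hspace, htime⟩ := coneBump_support hc hr hp
  have hrc : r / c < ρ := (div_lt_iff₀' hc).2 hrlt.1.2
  rw [Metric.mem_closedBall, Prod.dist_eq, max_le_iff, Real.dist_eq, Real.dist_eq, abs_le, abs_le]
  refine ⟨⟨?_, ?_⟩, ?_, ?_⟩ <;> linarith [hspace.1, hspace.2, htime.1, htime.2, hrlt.1.1]

theorem IsWeakDeltaField.le {c β : ℝ} (hc : 0 < c) {φ₁ φ₂ : ℝ → ℝ → ℝ} {y₁ y₂ : ℝ → ℝ}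
    (h₁ : IsWeakDeltaField c β φ₁ y₁) (h₂ : IsWeakDeltaField c β φ₂ y₂)
    (hφ₁ : ContinuousOn (fun p : ℝ × ℝ => φ₁ p.1 p.2) (univ ×ˢ Ici 0))
    (hφ₂ : ContinuousOn (fun p : ℝ × ℝ => φ₂ p.1 p.2) (univ ×ˢ Ici 0))
    (hy : ∀ t, 0 < t → y₁ t = y₂ t) (x : ℝ) {t : ℝ} (ht : 0 < t) : φ₁ x t ≤ φ₂ x t := by
  have hmax : Continuous fun p : ℝ × ℝ => (p.1, max p.2 0) := by fun_prop
  have hhalf (p : ℝ × ℝ) : (p.1, max p.2 0) ∈ (univ : Set ℝ) ×ˢ Ici (0 : ℝ) := by simp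
  have hφ₁c : Continuous fun p : ℝ × ℝ => φ₁ p.1 (max p.2 0) := hφ₁.comp_continuous hmax hhalf
  have hφ₂c : Continuous fun p : ℝ × ℝ => φ₂ p.1 (max p.2 0) := hφ₂.comp_continuous hmax hhalf
  have hle := le_of_exists_bump_integral_le (μ := volume) hφ₁c hφ₂c (p := (x, t)) fun U hU => by
    obtain ⟨r, hr, hrt, hrU⟩ := exists_coneBump_support_subset hc ht hU
    refine ⟨coneBump c x t r, coneBump_continuous c x t r, coneBump_hasCompactSupport hc hr,
      coneBump_nonneg hr, exists_coneBump_ne_zero hc hr, hrU, le_of_eq ?_⟩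
    rw [h₁.integral_mul_coneBump hφ₁c hc hr hrt, h₂.integral_mul_coneBump hφ₂c hc hr hrt]
    congr 1
    exact setIntegral_congr_fun measurableSet_Ioi fun s hs => by rw [hy s hs]
  simpa only [max_eq_left ht.le] using hle

theorem IsWeakDeltaField.unique {c β : ℝ} (hc : 0 < c) {φ₁ φ₂ : ℝ → ℝ → ℝ} {y₁ y₂ : ℝ → ℝ}
    (h₁ : IsWeakDeltaField c β φ₁ y₁) (h₂ : IsWeakDeltaField c β φ₂ y₂)
    (hφ₁ : ContinuousOn (fun p : ℝ × ℝ => φ₁ p.1 p.2) (univ ×ˢ Ici 0))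
    (hφ₂ : ContinuousOn (fun p : ℝ × ℝ => φ₂ p.1 p.2) (univ ×ˢ Ici 0))
    (hy : ∀ t, 0 < t → y₁ t = y₂ t) (x : ℝ) {t : ℝ} (ht : 0 < t) : φ₁ x t = φ₂ x t :=
  le_antisymm (h₁.le hc h₂ hφ₁ hφ₂ hy x ht)
    (h₂.le hc h₁ hφ₂ hφ₁ (fun t ht => (hy t ht).symm) x ht)

/-! ### The point particle -/

theorem tendstoUniformlyOn_of_dist_le_mul {ι α : Type*} [PseudoMetricSpace α] {F : ℝ → ι → α}
    {f : ι → α} {S : Set ι} {C : ℝ}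
    (h : ∀ᶠ σ in 𝓝[>] (0 : ℝ), ∀ p ∈ S, dist (F σ p) (f p) ≤ C * σ) :
    TendstoUniformlyOn F f (𝓝[>] (0 : ℝ)) S := by
  rw [Metric.tendstoUniformlyOn_iff]
  intro ε hε
  have hlim : Tendsto (fun σ : ℝ => C * σ) (𝓝[>] 0) (𝓝 0) := by
    simpa using ((continuous_const_mul C).tendsto 0).mono_left nhdsWithin_le_nhds
  filter_upwards [hlim.eventually (gt_mem_nhds hε), h] with σ hσε hσ p hp
  rw [dist_comm]
  exact (hσ p hp).trans_lt hσε

theorem retardedField_sharpStep_continuousOn {v : ℝ → ℝ} {c K : ℝ} (hv : Continuous v)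
    (hKc : K < c) (hK : ∀ t, 0 ≤ t → |v t| ≤ K) :
    ContinuousOn (fun p : ℝ × ℝ => retardedField sharpStep c (position v) p.1 p.2)
      (univ ×ˢ Ici 0) := by
  have hunif : TendstoUniformlyOn
      (fun σ (p : ℝ × ℝ) => retardedField (smoothStep σ) c (position v) p.1 p.2)
      (fun p => retardedField sharpStep c (position v) p.1 p.2) (𝓝[>] (0 : ℝ))
      (univ ×ˢ Ici 0) := by
    refine tendstoUniformlyOn_of_dist_le_mul (C := 4 / (c - K)) ?_
    filter_upwards [self_mem_nhdsWithin] with σ hσ p hp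
    rw [Real.dist_eq, div_mul_eq_mul_div]
    exact abs_retardedField_smoothStep_sub_sharpStep_le hv hKc hp.2 (fun s hs => hK s hs.1) hσ p.1
  exact hunif.continuousOn (Frequently.of_forall fun σ =>
    (retardedField_continuous (smoothStep_continuous σ) (position_continuous hv) c).continuousOn)

section

variable {v : ℝ → ℝ} {c K t : ℝ}

theorem abs_position_lt (hKc : K < c) (ht : 0 < t) (hK : ∀ s ∈ Icc 0 t, |v s| ≤ K) :
    |position v t| < c * t := by
  have hle := intervalIntegral.norm_integral_le_of_norm_le_const (a := 0) (b := t) (f := v)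
    (C := K) fun s hs => by
      rw [uIoc_of_le ht.le] at hs
      exact hK s ⟨hs.1.le, hs.2⟩
  rw [sub_zero, abs_of_pos ht] at hle
  exact hle.trans_lt (by gcongr)

theorem tendsto_retardedField_gaussianDelta (hv : Continuous v) (hKc : K < c) (ht : 0 < t)
    (hK : ∀ s ∈ Icc 0 t, |v s| ≤ K) {A : ℝ} (hA : ∀ s ∈ Icc 0 t, |v t - v s| ≤ A * (t - s))
    (hA0 : 0 ≤ A) :
    Tendsto (fun ε => retardedField (gaussianDelta ε) c (position v) (position v t) t) (𝓝[>] 0)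
      (𝓝 (meanSlope c (v t))) := by
  obtain ⟨hlower, hupper⟩ := abs_lt.1 (abs_position_lt hKc ht hK)
  have hadd := tendsto_mul_gaussianDelta (x := position v t + c * t) (by linarith)
  have hsub := tendsto_mul_gaussianDelta (x := position v t - c * t) (by linarith)
  have hlip : Tendsto (fun ε : ℝ => ε * (2 * A / (c - K) ^ 2)) (𝓝[>] 0) (𝓝 0) := by
    have hε : Tendsto (fun ε : ℝ => ε) (𝓝[>] 0) (𝓝 0) := nhdsWithin_le_nhds
    simpa only [zero_mul] using hε.mul_const (2 * A / (c - K) ^ 2)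
  have hbound := ((hlip.add hadd).add hsub).const_mul (2 / (c - K))
  simp only [add_zero, mul_zero] at hbound
  rw [tendsto_iff_dist_tendsto_zero]
  refine squeeze_zero' (Eventually.of_forall fun _ => dist_nonneg) ?_ hbound
  filter_upwards [self_mem_nhdsWithin] with ε hε
  rw [Real.dist_eq]
  refine (abs_retardedField_sub_meanSlope_le hv hKc ht.le hK hA hA0 hε).trans_eq ?_
  ring

end

theorem IsTrajectory.exists_velocity_lipschitz {v₀ : ℝ} {y : ℝ → ℝ} (h : IsTrajectory v₀ y)
    (t : ℝ) : ∃ A : ℝ, 0 ≤ A ∧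
      ∀ s ∈ Icc 0 t, |velocity y t - velocity y s| ≤ A * (t - s) := by
  have hvel := h.velocity_contDiffOn
  obtain ⟨A, hA⟩ := isCompact_Icc.exists_bound_of_continuousOn (s := Icc 0 t)
    ((hvel.continuousOn_derivWithin (uniqueDiffOn_Ici 0) le_rfl).mono Icc_subset_Ici_self)
  refine ⟨|A|, abs_nonneg A, fun s hs => ?_⟩
  have hmvt := (convex_Icc 0 t).norm_image_sub_le_of_norm_hasDerivWithin_le (C := |A|)
    (fun r hr => (hvel.differentiableOn (by norm_num) r hr.1).hasDerivWithinAt.mono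
      Icc_subset_Ici_self) (fun r hr => (hA r hr).trans (le_abs_self A)) hs
    (⟨hs.1.trans hs.2, le_rfl⟩ : t ∈ Icc 0 t)
  rwa [Real.norm_eq_abs, Real.norm_eq_abs, abs_of_nonneg (sub_nonneg.2 hs.2)] at hmvt

theorem IsTrajectory.tendsto_selfForce {v₀ c K : ℝ} {y : ℝ → ℝ} (h : IsTrajectory v₀ y)
    (hKc : K < c) (hK : ∀ t, 0 ≤ t → |velocity y t| ≤ K) {t : ℝ} (ht : 0 < t) :
    Tendsto (fun ε => retardedField (gaussianDelta ε) c (position (extendedVelocity y)) (y t) t)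
      (𝓝[>] 0) (𝓝 (meanSlope c (velocity y t))) := by
  obtain ⟨A, hA0, hA⟩ := h.exists_velocity_lipschitz t
  rw [h.eq_position ht.le, ← extendedVelocity_of_nonneg y ht.le]
  refine tendsto_retardedField_gaussianDelta h.extendedVelocity_continuous hKc ht
    (fun s _ => hK _ (le_max_right _ _)) (fun s hs => ?_) hA0
  rw [extendedVelocity_of_nonneg y ht.le, extendedVelocity_of_nonneg y hs.1]
  exact hA s hs

namespace IsDeltaSolution

variable {m c β v₀ K : ℝ} {φ : ℝ → ℝ → ℝ} {y : ℝ → ℝ}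

theorem field_eq (hc : 0 < c) (h : IsDeltaSolution m c β v₀ φ y) (hKc : K < c)
    (hK : ∀ t, 0 ≤ t → |velocity y t| ≤ K) (x : ℝ) {t : ℝ} (ht : 0 ≤ t) :
    φ x t = β / (2 * c) *
      retardedField sharpStep c (position (extendedVelocity y)) x t := by
  have hv := h.trajectory.extendedVelocity_continuous
  rcases ht.eq_or_lt with rfl | ht
  · rw [h.field_zero, retardedField_zero, mul_zero]
  · exact h.wave.unique hc (isWeakDeltaField_retardedField hc β (position_continuous hv))
      h.field_continuousOn
      (continuousOn_const.mul (retardedField_sharpStep_continuousOn hv hKc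
        fun t _ => hK _ (le_max_right _ _)))
      (fun t ht => h.trajectory.eq_position ht.le) x ht

theorem newton_eq (hm : 0 < m) (hc : 0 < c) (h : IsDeltaSolution m c β v₀ φ y) (hKc : K < c)
    (hK : ∀ t, 0 ≤ t → |velocity y t| ≤ K) {t : ℝ} (ht : 0 < t) :
    iteratedDeriv 2 y t = β ^ 2 / (2 * c * m) * meanSlope c (velocity y t) := by
  obtain ⟨F, hF, hlim⟩ := h.newton t ht
  have hF_eq : ∀ ε, 0 < ε → F ε = β * (β / (2 * c)) *
      retardedField (gaussianDelta ε) c (position (extendedVelocity y)) (y t) t := by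
    intro ε hε
    have hforce := hF ε hε
    rw [funext fun x => h.field_eq hc hKc hK x ht.le] at hforce
    exact hforce.2.unique (hasForce_sharpStep hε
      (position_continuous h.trajectory.extendedVelocity_continuous) c β _ _ ht.le).2
  have hlim_eq := tendsto_nhds_unique_of_eventuallyEq hlim
    ((h.trajectory.tendsto_selfForce hKc hK ht).const_mul (β * (β / (2 * c)))) (by
      filter_upwards [self_mem_nhdsWithin] with ε hε using hF_eq ε hε)
  field_simp at hlim_eq ⊢
  linarith

theorem velocity_eq (hm : 0 < m) (hc : 0 < c) (h : IsDeltaSolution m c β v₀ φ y) (hKc : K < c)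
    (hK : ∀ t, 0 ≤ t → |velocity y t| ≤ K) {t : ℝ} (ht : 0 ≤ t) :
    extendedVelocity y t =
      v₀ + ∫ s in (0 : ℝ)..t, β ^ 2 / (2 * c * m) * meanSlope c (extendedVelocity y s) := by
  rw [extendedVelocity_of_nonneg y ht]
  refine h.trajectory.velocity_eq_integral ?_ (fun s hs => ?_) ht
  · exact (continuous_const.mul (continuous_meanSlope_comp hKc
      h.trajectory.extendedVelocity_continuous fun s => hK _ (le_max_right _ _))).continuousOn
  · rw [h.newton_eq hm hc hKc hK hs, extendedVelocity_of_nonneg y hs.le]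

theorem extendedVelocity_eq (hm : 0 < m) (hc : 0 < c) (hv₀ : |v₀| < c) {v : ℝ → ℝ}
    (hv : IsLimitVelocity (β ^ 2 / (2 * c * m)) c v₀ v) (h : IsDeltaSolution m c β v₀ φ y)
    (hsub : UniformlySubsonic c y) {t : ℝ} (ht : 0 ≤ t) : extendedVelocity y t = v t := by
  obtain ⟨K', hK'c, hK'⟩ := hsub
  have hKc : max K' |v₀| < c := max_lt hK'c hv₀
  have hK (t : ℝ) (ht : 0 ≤ t) : |velocity y t| ≤ max K' |v₀| := (hK' t ht).trans (le_max_left _ _)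
  have hdiff := abs_sub_le_of_approx_solution (T := t) hKc le_rfl hv.continuous
    h.trajectory.extendedVelocity_continuous (fun s _ => (hv.abs_le s).trans (le_max_right _ _))
    (fun s _ => hK _ (le_max_right _ _)) (fun s hs => hv.eq_integral s hs.1)
    (fun s hs => by rw [← h.velocity_eq hm hc hKc hK hs.1, sub_self, abs_zero]) t ⟨ht, le_rfl⟩
  rw [mul_zero, zero_mul] at hdiff
  exact sub_eq_zero.1 (abs_nonpos_iff.1 hdiff)

theorem unique_of_subsonic (hm : 0 < m) (hc : 0 < c) (hv₀ : |v₀| < c) {v : ℝ → ℝ}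
    (hv : IsLimitVelocity (β ^ 2 / (2 * c * m)) c v₀ v) (h : IsDeltaSolution m c β v₀ φ y)
    (hsub : UniformlySubsonic c y) {t : ℝ} (ht : 0 ≤ t) :
    y t = position v t ∧
      ∀ x, φ x t = β / (2 * c) * retardedField sharpStep c (position v) x t := by
  have hpos (s : ℝ) (hs : 0 ≤ s) : position (extendedVelocity y) s = position v s :=
    position_congr hs fun r hr => h.extendedVelocity_eq hm hc hv₀ hv hsub hr.1
  refine ⟨(h.trajectory.eq_position ht).trans (hpos t ht), fun x => ?_⟩
  obtain ⟨K, hKc, hK⟩ := hsub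
  rw [h.field_eq hc hKc hK x ht, retardedField_congr ht fun s hs => hpos s hs.1]

end IsDeltaSolution

namespace IsLimitVelocity

variable {b c v₀ : ℝ} {v : ℝ → ℝ}

theorem isTrajectory_position (h : IsLimitVelocity b c v₀ v) (hv₀ : |v₀| < c) :
    IsTrajectory v₀ (position v) :=
  PointParticle.isTrajectory_position h.continuous (h.continuous_mul_meanSlope hv₀) h.eq_integral

theorem uniformlySubsonic_position (h : IsLimitVelocity b c v₀ v) (hv₀ : |v₀| < c) :
    UniformlySubsonic c (position v) :=
  ⟨|v₀|, hv₀, fun t ht => (velocity_position h.continuous ht).symm ▸ h.abs_le t⟩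

theorem isDeltaSolution {m β : ℝ} (hm : 0 < m) (hc : 0 < c) (hv₀ : |v₀| < c)
    (h : IsLimitVelocity (β ^ 2 / (2 * c * m)) c v₀ v) :
    IsDeltaSolution m c β v₀
      (fun x t => β / (2 * c) * retardedField sharpStep c (position v) x t) (position v) where
  field_continuousOn := continuousOn_const.mul
    (retardedField_sharpStep_continuousOn h.continuous hv₀ fun t _ => h.abs_le t)
  field_zero x := by rw [retardedField_zero, mul_zero]
  wave := isWeakDeltaField_retardedField hc β (position_continuous h.continuous)
  trajectory := h.isTrajectory_position hv₀
  newton t ht := by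
    have htraj := h.isTrajectory_position hv₀
    obtain ⟨A, hA0, hA⟩ := htraj.exists_velocity_lipschitz t
    have hlim := (tendsto_retardedField_gaussianDelta h.continuous hv₀ ht (fun s _ => h.abs_le s)
      (fun s hs => by simpa only [velocity_position h.continuous hs.1,
        velocity_position h.continuous ht.le] using hA s hs) hA0).const_mul (β * (β / (2 * c)))
    refine ⟨_, fun ε hε =>
      hasForce_sharpStep hε (position_continuous h.continuous) c β _ _ ht.le, ?_⟩
    convert hlim using 2
    rw [iteratedDeriv_two_position h.continuous (h.continuous_mul_meanSlope hv₀) h.eq_integral ht]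
    field_simp

end IsLimitVelocity

/-! ### The limit of vanishing smearing width -/

theorem forall_lt_of_continuation {d : ℝ → ℝ} {T r : ℝ} (hd : Continuous d) (h0 : d 0 < r)
    (h : ∀ t ∈ Icc 0 T, (∀ s ∈ Icc 0 t, d s ≤ r) → d t < r) : ∀ t ∈ Icc 0 T, d t < r := by
  intro t₁ ht₁
  by_contra! hge
  have hcompact : IsCompact (Icc 0 t₁ ∩ {s | r ≤ d s}) :=
    isCompact_Icc.inter_right (isClosed_le continuous_const hd)
  obtain ⟨t, ⟨ht, htr⟩, hmin⟩ := hcompact.exists_isLeast ⟨t₁, ⟨ht₁.1, le_rfl⟩, hge⟩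
  have hbefore : Ico 0 t ⊆ {s | d s ≤ r} := fun s hs => by
    by_contra hlt
    have hrs : r ≤ d s := (not_le.1 hlt).le
    exact hs.2.not_ge (hmin ⟨⟨hs.1, hs.2.le.trans ht.2⟩, hrs⟩)
  have ht0 : t ≠ 0 := by
    rintro rfl
    exact h0.not_ge htr
  have hclosure := closure_minimal hbefore (isClosed_le hd continuous_const)
  rw [closure_Ico ht0.symm] at hclosure
  exact (h t ⟨ht.1, ht.2.trans ht₁.2⟩ fun s hs => hclosure hs).not_ge htr

section

variable {b c K ε v₀ t : ℝ} {w : ℝ → ℝ}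

theorem abs_selfAcceleration_gaussianDelta_le (hb : 0 ≤ b) (hKc : K < c) (hε : 0 < ε)
    (hw : Continuous w) (ht : 0 ≤ t) (hK : ∀ s ∈ Icc 0 t, |w s| ≤ K) :
    |selfAcceleration b c (gaussianDelta ε) w t| ≤ b / (c - K) := by
  rw [selfAcceleration, abs_mul, abs_of_nonneg hb, div_eq_mul_one_div]
  gcongr
  exact abs_retardedField_gaussianDelta_le hw hKc ht hK hε _

theorem abs_sub_le_of_smeared_equation (hb : 0 ≤ b) (hKc : K < c) (hε : 0 < ε)
    (hw : Continuous w) (hK : ∀ s ∈ Icc 0 t, |w s| ≤ K)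
    (hwe : ∀ t, 0 ≤ t →
      w t = v₀ + ∫ s in (0 : ℝ)..t, selfAcceleration b c (gaussianDelta ε) w s) :
    ∀ s ∈ Icc 0 t, |w t - w s| ≤ b / (c - K) * (t - s) := by
  intro s hs
  have hac := (selfAcceleration_gaussianDelta_causalLipschitz b c hε).continuous w hw
  have hsub : w t - w s = ∫ r in s..t, selfAcceleration b c (gaussianDelta ε) w r := by
    rw [hwe t (hs.1.trans hs.2), hwe s hs.1, add_sub_add_left_eq_sub,
      intervalIntegral.integral_interval_sub_left (hac.intervalIntegrable _ _)
      (hac.intervalIntegrable _ _)]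
  rw [hsub, ← Real.norm_eq_abs, ← abs_of_nonneg (sub_nonneg.2 hs.2)]
  refine intervalIntegral.norm_integral_le_of_norm_le_const fun r hr => ?_
  rw [uIoc_of_le hs.2] at hr
  exact abs_selfAcceleration_gaussianDelta_le hb hKc hε hw (hs.1.trans hr.1.le)
    fun q hq => hK q ⟨hq.1, hq.2.trans hr.2⟩

theorem abs_selfAcceleration_sub_meanSlope_le (hb : 0 ≤ b) (hKc : K < c) (hε : 0 < ε)
    (hw : Continuous w) (ht : 0 ≤ t) (hK : ∀ s ∈ Icc 0 t, |w s| ≤ K)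
    (hwe : ∀ t, 0 ≤ t →
      w t = v₀ + ∫ s in (0 : ℝ)..t, selfAcceleration b c (gaussianDelta ε) w s) :
    |selfAcceleration b c (gaussianDelta ε) w t - b * meanSlope c (w t)| ≤
      b * (2 * ε / (c - K)) * (2 * (b / (c - K)) / (c - K) ^ 2 +
        gaussianDelta ε (-(0 - position w t + c * (0 - t))) +
        gaussianDelta ε (0 - position w t - c * (0 - t))) := by
  have := sub_pos.2 hKc
  rw [selfAcceleration, ← mul_sub, abs_mul, abs_of_nonneg hb, mul_assoc b,
    show -(0 - position w t + c * (0 - t)) = position w t + c * t by ring,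
    show 0 - position w t - c * (0 - t) = -(position w t - c * t) by ring, gaussianDelta_neg]
  gcongr
  exact abs_retardedField_sub_meanSlope_le hw hKc ht hK
    (abs_sub_le_of_smeared_equation hb hKc hε hw hK hwe) (by positivity) hε

/-- Integrating in time makes the Gaussians in the pointwise error of the self-force harmless:
both characteristic coordinates move at speed at least `c - K`. -/
theorem abs_sub_limit_equation_le (hb : 0 ≤ b) (hKc : K < c) (hε : 0 < ε)
    (hw : Continuous w) (ht : 0 ≤ t) (hK : ∀ s ∈ Icc 0 t, |w s| ≤ K)
    (hwe : ∀ t, 0 ≤ t →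
      w t = v₀ + ∫ s in (0 : ℝ)..t, selfAcceleration b c (gaussianDelta ε) w s) :
    |w t - (v₀ + ∫ s in (0 : ℝ)..t, b * meanSlope c (w s))| ≤
      b * (2 / (c - K)) * (2 * (b / (c - K)) / (c - K) ^ 2 * t + 2 / (c - K)) * ε := by
  have := sub_pos.2 hKc
  have hp := position_continuous hw
  have hac := (selfAcceleration_gaussianDelta_causalLipschitz b c hε).continuous w hw
  have hslope : IntervalIntegrable (fun s => b * meanSlope c (w s)) volume 0 t :=
    (continuousOn_const.mul (continuousOn_meanSlope_comp hKc hw.continuousOn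
      hK)).intervalIntegrable_of_Icc ht
  have hadd := integral_gaussianDelta_retarded_add_le hw hKc ht hK hε 0 0
  have hsub := integral_gaussianDelta_retarded_sub_le hw hKc ht hK hε 0 0
  calc |w t - (v₀ + ∫ s in (0 : ℝ)..t, b * meanSlope c (w s))|
      = ‖∫ s in (0 : ℝ)..t,
          (selfAcceleration b c (gaussianDelta ε) w s - b * meanSlope c (w s))‖ := by
        rw [intervalIntegral.integral_sub (hac.intervalIntegrable _ _) hslope, hwe t ht,
          add_sub_add_left_eq_sub, Real.norm_eq_abs]
    _ ≤ ∫ s in (0 : ℝ)..t, b * (2 * ε / (c - K)) * (2 * (b / (c - K)) / (c - K) ^ 2 +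
          gaussianDelta ε (-(0 - position w s + c * (0 - s))) +
          gaussianDelta ε (0 - position w s - c * (0 - s))) :=
        intervalIntegral.norm_integral_le_of_norm_le ht
          (Eventually.of_forall fun s hs => abs_selfAcceleration_sub_meanSlope_le hb hKc hε hw
            hs.1.le (fun r hr => hK r ⟨hr.1, hr.2.trans hs.2⟩) hwe)
          (Continuous.intervalIntegrable (by fun_prop) _ _)
    _ ≤ b * (2 * ε / (c - K)) *
          (2 * (b / (c - K)) / (c - K) ^ 2 * t + 1 / (c - K) + 1 / (c - K)) := by
        rw [intervalIntegral.integral_const_mul, intervalIntegral.integral_add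
          (Continuous.intervalIntegrable (by fun_prop) _ _)
          (Continuous.intervalIntegrable (by fun_prop) _ _), intervalIntegral.integral_add
          (Continuous.intervalIntegrable (by fun_prop) _ _)
          (Continuous.intervalIntegrable (by fun_prop) _ _), intervalIntegral.integral_const,
          smul_eq_mul, sub_zero, mul_comm t]
        gcongr
    _ = b * (2 / (c - K)) * (2 * (b / (c - K)) / (c - K) ^ 2 * t + 2 / (c - K)) * ε := by ring

end

namespace IsLimitVelocity

variable {b c v₀ T : ℝ} {v : ℝ → ℝ}

theorem exists_abs_sub_le_of_abs_le {K : ℝ} (h : IsLimitVelocity b c v₀ v) (hb : 0 ≤ b)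
    (hKc : K < c) (hv₀ : |v₀| ≤ K) (hT : 0 ≤ T) :
    ∃ M : ℝ, 0 ≤ M ∧ ∀ ε, 0 < ε → ∀ w : ℝ → ℝ, Continuous w →
      (∀ t, 0 ≤ t →
        w t = v₀ + ∫ s in (0 : ℝ)..t, selfAcceleration b c (gaussianDelta ε) w s) →
      ∀ t ∈ Icc 0 T, (∀ s ∈ Icc 0 t, |w s| ≤ K) → |w t - v t| ≤ M * ε := by
  have := sub_pos.2 hKc
  set N := b * (2 / (c - K)) * (2 * (b / (c - K)) / (c - K) ^ 2 * T + 2 / (c - K))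
  have : 0 ≤ N := by positivity
  refine ⟨2 * N * Real.exp ((2 * (|b| / (c - K) ^ 2) + 1) * T), by positivity,
    fun ε hε w hw hwe t ht hwK => ?_⟩
  have happrox (s : ℝ) (hs : s ∈ Icc 0 t) :
      |w s - (v₀ + ∫ r in (0 : ℝ)..s, b * meanSlope c (w r))| ≤ N * ε := by
    refine (abs_sub_limit_equation_le hb hKc hε hw hs.1
      (fun r hr => hwK r ⟨hr.1, hr.2.trans hs.2⟩) hwe).trans ?_
    simp only [N]
    gcongr
    exact hs.2.trans ht.2
  calc |w t - v t| ≤ 2 * (N * ε) * Real.exp ((2 * (|b| / (c - K) ^ 2) + 1) * t) :=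
        abs_sub_le_of_approx_solution hKc (by positivity) h.continuous hw
          (fun s _ => (h.abs_le s).trans hv₀) hwK (fun s hs => h.eq_integral s hs.1) happrox t
          ⟨ht.1, le_rfl⟩
    _ ≤ 2 * (N * ε) * Real.exp ((2 * (|b| / (c - K) ^ 2) + 1) * T) := by
        gcongr
        exact ht.2
    _ = 2 * N * Real.exp ((2 * (|b| / (c - K) ^ 2) + 1) * T) * ε := by ring

/-- The rate holds as long as the smeared velocity stays below a bound `K < c`; for small `ε` it
forces the velocity to stay below `K`, so it propagates to the whole interval. -/
theorem exists_eventually_abs_sub_le (h : IsLimitVelocity b c v₀ v) (hb : 0 ≤ b)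
    (hv₀ : |v₀| < c) (hT : 0 ≤ T) :
    ∃ M : ℝ, ∀ᶠ ε in 𝓝[>] (0 : ℝ), ∀ w : ℝ → ℝ, Continuous w →
      (∀ t, 0 ≤ t →
        w t = v₀ + ∫ s in (0 : ℝ)..t, selfAcceleration b c (gaussianDelta ε) w s) →
      ∀ t ∈ Icc 0 T, |w t - v t| ≤ M * ε := by
  obtain ⟨K, hv₀K, hKc⟩ := exists_between hv₀
  obtain ⟨M, hM, hrate⟩ := h.exists_abs_sub_le_of_abs_le hb hKc hv₀K.le hT
  have := sub_pos.2 hv₀K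
  refine ⟨M, ?_⟩
  filter_upwards [Ioo_mem_nhdsGT (show 0 < (K - |v₀|) / (M + 1) by positivity)]
    with ε ⟨hε, hεlt⟩ w hw hwe
  have hMε : M * ε < K - |v₀| := by
    rw [lt_div_iff₀ (by positivity)] at hεlt
    linarith
  have hbound {s : ℝ} (hs : |w s - v s| ≤ K - |v₀|) : |w s| ≤ K := by
    have := abs_sub_abs_le_abs_sub (w s) (v s)
    linarith [h.abs_le s]
  have hw0 : |w 0 - v 0| < K - |v₀| := by simpa [h.apply_zero, hwe 0 le_rfl] using hv₀K
  have hclose := forall_lt_of_continuation (d := fun s => |w s - v s|) (T := T)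
    (hw.sub h.continuous).abs hw0 fun t ht hle =>
      (hrate ε hε w hw hwe t ht fun s hs => hbound (hle s hs)).trans_lt hMε
  exact fun t ht => hrate ε hε w hw hwe t ht fun s hs =>
    hbound (hclose s ⟨hs.1, hs.2.trans ht.2⟩).le

end IsLimitVelocity

theorem IsTrajectory.abs_sub_position_le {v₀ T A : ℝ} {v y : ℝ → ℝ} (h : IsTrajectory v₀ y)
    (hv : Continuous v) (hA : ∀ t ∈ Icc 0 T, |velocity y t - v t| ≤ A) {t : ℝ}
    (ht : t ∈ Icc 0 T) : |position (extendedVelocity y) t - position v t| ≤ A * T := by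
  have hA0 : 0 ≤ A := (abs_nonneg _).trans (hA t ht)
  calc |position (extendedVelocity y) t - position v t| ≤ A * t :=
        abs_position_sub_le h.extendedVelocity_continuous hv ht.1 fun s hs => by
          rw [extendedVelocity_of_nonneg y hs.1]
          exact hA s ⟨hs.1, hs.2.trans ht.2⟩
    _ ≤ A * T := by
        gcongr
        exact ht.2

namespace IsSmoothSolution

variable {m c β v₀ σ T : ℝ} {φ : ℝ → ℝ → ℝ} {v y : ℝ → ℝ}

theorem abs_field_sub_le {K A : ℝ} (hc : 0 < c) (hσ : 0 < σ)
    (h : IsSmoothSolution m c β v₀ (gaussianDelta σ) φ y) (hv : Continuous v) (hKc : K < c)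
    (hK : ∀ t ∈ Icc 0 T, |v t| ≤ K) (hA : ∀ t ∈ Icc 0 T, |velocity y t - v t| ≤ A) (x : ℝ) {t : ℝ}
    (ht : t ∈ Icc 0 T) :
    |φ x t - β / (2 * c) * retardedField sharpStep c (position v) x t| ≤
      |β / (2 * c)| * (4 * (A * T) / (c - K) + 4 * σ / (c - K)) := by
  have hK' (s : ℝ) (hs : s ∈ Icc 0 t) : |v s| ≤ K := hK s ⟨hs.1, hs.2.trans ht.2⟩
  have hposition := abs_retardedField_smoothStep_sub_le hv hKc ht.1 hK' hσ
    (position_continuous h.trajectory.extendedVelocity_continuous)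
    (fun s hs => h.trajectory.abs_sub_position_le hv hA ⟨hs.1, hs.2.trans ht.2⟩) x
  have hsharp := abs_retardedField_smoothStep_sub_sharpStep_le hv hKc ht.1 hK' hσ x
  rw [h.field_eq hc x ht.1, retardedField_congr ht.1 fun s hs => h.trajectory.eq_position hs.1,
    ← mul_sub, abs_mul]
  gcongr
  exact (abs_sub_le _ _ _).trans (add_le_add hposition hsharp)

theorem exists_eventually_abs_velocity_sub_le (hm : 0 < m) (hc : 0 < c) (hv₀ : |v₀| < c)
    (hv : IsLimitVelocity (β ^ 2 / (2 * c * m)) c v₀ v) (hT : 0 ≤ T) :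
    ∃ M : ℝ, ∀ᶠ σ in 𝓝[>] (0 : ℝ), ∀ (φ : ℝ → ℝ → ℝ) (y : ℝ → ℝ),
      IsSmoothSolution m c β v₀ (gaussianDelta σ) φ y →
      ∀ t ∈ Icc 0 T, |velocity y t - v t| ≤ M * σ := by
  obtain ⟨M, hM⟩ := hv.exists_eventually_abs_sub_le (by positivity) hv₀ hT
  have hscale : Tendsto (fun σ : ℝ => √2 * σ) (𝓝[>] 0) (𝓝[>] 0) :=
    tendsto_nhdsWithin_iff.2 ⟨by
      have hσ : Tendsto (fun σ : ℝ => σ) (𝓝[>] 0) (𝓝 0) := nhdsWithin_le_nhds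
      simpa only [mul_zero] using hσ.const_mul √2, by
      filter_upwards [self_mem_nhdsWithin] with σ hσ using mul_pos (Real.sqrt_pos.2 two_pos) hσ⟩
  refine ⟨M * √2, ?_⟩
  filter_upwards [hscale.eventually hM, self_mem_nhdsWithin] with σ hrate hσ φ y h t ht
  rw [← extendedVelocity_of_nonneg y ht.1, mul_assoc]
  exact hrate _ h.trajectory.extendedVelocity_continuous (fun s hs => h.velocity_eq hm hc hσ hs)
    t ht

theorem tendstoUniformlyOn (hm : 0 < m) (hc : 0 < c) (hv₀ : |v₀| < c)
    (hv : IsLimitVelocity (β ^ 2 / (2 * c * m)) c v₀ v) {Φ : ℝ → ℝ → ℝ → ℝ} {Y : ℝ → ℝ → ℝ}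
    (h : ∀ σ, 0 < σ → IsSmoothSolution m c β v₀ (gaussianDelta σ) (Φ σ) (Y σ)) (hT : 0 ≤ T) :
    TendstoUniformlyOn Y (position v) (𝓝[>] (0 : ℝ)) (Icc 0 T) ∧
      TendstoUniformlyOn (fun σ => velocity (Y σ)) v (𝓝[>] (0 : ℝ)) (Icc 0 T) ∧
      TendstoUniformlyOn (fun σ (p : ℝ × ℝ) => Φ σ p.1 p.2)
        (fun p : ℝ × ℝ => β / (2 * c) * retardedField sharpStep c (position v) p.1 p.2)
        (𝓝[>] (0 : ℝ)) (univ ×ˢ Icc 0 T) := by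
  obtain ⟨M, hM⟩ := exists_eventually_abs_velocity_sub_le hm hc hv₀ hv hT
  have hvel : ∀ᶠ σ in 𝓝[>] (0 : ℝ), ∀ t ∈ Icc 0 T, |velocity (Y σ) t - v t| ≤ M * σ := by
    filter_upwards [hM, self_mem_nhdsWithin] with σ hσM hσ using hσM _ _ (h σ hσ)
  refine ⟨tendstoUniformlyOn_of_dist_le_mul (C := M * T) ?_,
    tendstoUniformlyOn_of_dist_le_mul hvel, tendstoUniformlyOn_of_dist_le_mul
      (C := |β / (2 * c)| * (4 * (M * T) / (c - |v₀|) + 4 / (c - |v₀|))) ?_⟩ <;>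
    filter_upwards [hvel, self_mem_nhdsWithin] with σ hσvel hσ
  · intro t ht
    rw [Real.dist_eq, (h σ hσ).trajectory.eq_position ht.1, mul_right_comm]
    exact (h σ hσ).trajectory.abs_sub_position_le hv.continuous hσvel ht
  · intro p hp
    refine ((h σ hσ).abs_field_sub_le hc hσ hv.continuous hv₀ (fun s _ => hv.abs_le s) hσvel p.1
      hp.2).trans_eq ?_
    ring

end IsSmoothSolution

end PointParticle

end

theorem mainTheorem3 (m c β v₀ : ℝ) (hm : 0 < m) (hc : 0 < c) :
    -- for each `σ > 0` there is a global solution, and it is unique on `[0, ∞)`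
    (∀ σ : ℝ, 0 < σ →
      (∃ (φ : ℝ → ℝ → ℝ) (y : ℝ → ℝ),
        PointParticle.IsSmoothSolution m c β v₀ (PointParticle.gaussianDelta σ) φ y) ∧
      (∀ (φ₁ φ₂ : ℝ → ℝ → ℝ) (y₁ y₂ : ℝ → ℝ),
        PointParticle.IsSmoothSolution m c β v₀ (PointParticle.gaussianDelta σ) φ₁ y₁ →
        PointParticle.IsSmoothSolution m c β v₀ (PointParticle.gaussianDelta σ) φ₂ y₂ →
        ∀ t : ℝ, 0 ≤ t → y₁ t = y₂ t ∧ ∀ x : ℝ, φ₁ x t = φ₂ x t)) ∧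
    (|v₀| < c →
      -- the solution `(φ, y)` for the delta interaction
      ∃ (φ : ℝ → ℝ → ℝ) (y : ℝ → ℝ),
        PointParticle.IsDeltaSolution m c β v₀ φ y ∧
        ContDiffOn ℝ ∞ (PointParticle.velocity y) (Ici 0) ∧
        (MonotoneOn (PointParticle.velocity y) (Ici 0) ∨
          AntitoneOn (PointParticle.velocity y) (Ici 0)) ∧
        PointParticle.UniformlySubsonic c y ∧
        (β ≠ 0 → ∃ A κ : ℝ, 0 < κ ∧ ∀ t : ℝ, 0 ≤ t →
          |PointParticle.velocity y t| ≤ A * Real.exp (-κ * t)) ∧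
        (∀ (φ' : ℝ → ℝ → ℝ) (y' : ℝ → ℝ),
          PointParticle.IsDeltaSolution m c β v₀ φ' y' →
          PointParticle.UniformlySubsonic c y' →
          ∀ t : ℝ, 0 ≤ t → y' t = y t ∧ ∀ x : ℝ, φ' x t = φ x t) ∧
        -- the smeared solutions converge to it as `σ → 0+`
        (∀ (Φ : ℝ → ℝ → ℝ → ℝ) (Y : ℝ → ℝ → ℝ),
          (∀ σ : ℝ, 0 < σ →
            PointParticle.IsSmoothSolution m c β v₀ (PointParticle.gaussianDelta σ)
              (Φ σ) (Y σ)) →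
          ∀ T : ℝ, 0 < T →
            TendstoUniformlyOn (fun σ t => Y σ t) y (𝓝[>] (0 : ℝ)) (Icc 0 T) ∧
            TendstoUniformlyOn (fun σ t => PointParticle.velocity (Y σ) t)
              (PointParticle.velocity y) (𝓝[>] (0 : ℝ)) (Icc 0 T) ∧
            TendstoUniformlyOn (fun σ (p : ℝ × ℝ) => Φ σ p.1 p.2)
              (fun p : ℝ × ℝ => φ p.1 p.2) (𝓝[>] (0 : ℝ)) (univ ×ˢ Icc 0 T))) := by
  refine ⟨fun σ hσ => ⟨PointParticle.exists_isSmoothSolution β v₀ hm hc hσ,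
    fun φ₁ φ₂ y₁ y₂ h₁ h₂ t ht => h₁.unique hm hc hσ h₂ ht⟩, fun hv₀ => ?_⟩
  have hb : 0 ≤ β ^ 2 / (2 * c * m) := by positivity
  obtain ⟨v, hv⟩ := PointParticle.exists_isLimitVelocity hb hv₀
  have hvel (t : ℝ) (ht : 0 ≤ t) :
      PointParticle.velocity (PointParticle.position v) t = v t :=
    PointParticle.velocity_position hv.continuous ht
  refine ⟨_, _, hv.isDeltaSolution hm hc hv₀, (hv.contDiffOn hv₀).congr hvel, ?_,
    hv.uniformlySubsonic_position hv₀,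
    fun hβ => ⟨|v₀|, β ^ 2 / (2 * c * m) / c ^ 2, by positivity, fun t ht => ?_⟩,
    fun φ' y' h' hsub t ht => h'.unique_of_subsonic hm hc hv₀ hv hsub ht,
    fun Φ Y h T hT => ?_⟩
  · exact (hv.monotoneOn_or_antitoneOn hb hv₀).imp
      (·.congr fun t ht => (hvel t ht).symm) (·.congr fun t ht => (hvel t ht).symm)
  · rw [hvel t ht]
    exact hv.abs_le_mul_exp hb hv₀ ht
  · obtain ⟨hY, hV, hΦ⟩ :=
      PointParticle.IsSmoothSolution.tendstoUniformlyOn hm hc hv₀ hv h hT.le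
    exact ⟨hY, hV.congr_right fun t ht => (hvel t ht.1).symm, hΦ⟩
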